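/- Fix a mass $m>0$, a charge $e\in\mathbb{R}$ and a smooth, compactly supported real four-potential $A=(A_\mu)$ on Minkowski space-time $\mathbb{R}^4$ (signature $(+,-,-,-)$), and let $\gamma^\mu$ be the Dirac matrices. A Cauchy surface $\Sigma\subset\mathbb{R}^4$ is a smooth three-dimensional submanifold with space-like tangent spaces that every continuous time- or light-like path without end points in either direction meets in exactly one point. Let $\mathcal{H}_\Sigma=L^2(\Sigma,\mathbb{C}^4)$ with scalar product $\langle\phi,\psi\rangle=\int_\Sigma\overline{\phi}\,i_\gamma(d^4x)\,\psi$, where $\overline\phi=\phi^*\gamma^0$ and $i_\gamma(d^4x)$ is the contraction of the volume form $dx^0\wedge dx^1\wedge dx^2\wedge dx^3$ with $\gamma^\mu$. Let $U^A_{\Sigma'\Sigma}:\mathcal{H}_\Sigma\to\mathcal{H}_{\Sigma'}$ be the one-particle Dirac evolution, i.e. the unitary extension of the map $\psi|_\Sigma\mapsto\psi|_{\Sigma'}$, where $\psi$ runs through the smooth solutions of $(i\gamma^\mu\partial_\mu-m)\psi=e\,\gamma^\mu A_\mu\psi$ with spatially compact support. Let $\mathrm{Pol}(\mathcal{H}_\Sigma)$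 be the set of closed subspaces $V\subset\mathcal{H}_\Sigma$ such that $V$ and $V^\perp$ are infinite dimensional, and let $P^V$ be the orthogonal projection onto $V$. Let $\mathcal{H}_\Sigma^-$ be the negative spectral subspace of the free Dirac Hamiltonian on $\{x^0=0\}$, transported to $\Sigma$ by the free Dirac evolution. Fix a Cauchy surface $\Sigma_{\mathrm{in}}$ with $\operatorname{supp}A\cap\Sigma_{\mathrm{in}}=\emptyset$ such that $\operatorname{supp}A$ lies in the causal future of $\Sigma_{\mathrm{in}}$, and put $$\mathtt{C}_\Sigma(A)=\{W\in\mathrm{Pol}(\mathcal{H}_\Sigma)\mid P^W-P^{X}\text{ is a Hilbert--Schmidt operator, where }X=U^A_{\Sigma\Sigma_{\mathrm{in}}}\mathcal{H}^-_{\Sigma_{\mathrm{in}}}\}.$$ For $V\in\mathrm{Pol}(\mathcal{H}_\Sigma)$ let $$\mathcal{F}(V,\mathcal{H}_\Sigma)=\bigoplus_{c\in\mathbb{Z}}\ \bigoplus_{n,k\in\mathbb{N}_0,\,c=k-n}(V^\perp)^{\wedge n}\otimes\overline{V}^{\,\wedge k}$$ be the associated Fock space (Hilbert sums and Hilbert tensor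 products), where $\overline V$ is the complex conjugate of $V$, and for $f\in\mathcal{H}_\Sigma$ let $a_\Sigma^*(f)$ be the creation operator on it: the sum of exterior multiplication with $P^{V^\perp}f$ on the factors $(V^\perp)^{\wedge n}$ and of $(-1)^n$ times contraction with $P^Vf\in\overline V$ on the factors $\overline V^{\wedge k}$. Let $\Sigma,\Sigma'$ be Cauchy surfaces, $V\in\mathtt{C}_\Sigma(A)$ and $W\in\mathtt{C}_{\Sigma'}(A)$. Then there is a unitary operator $\widetilde U:\mathcal{F}(V,\mathcal{H}_\Sigma)\to\mathcal{F}(W,\mathcal{H}_{\Sigma'})$ with $$\widetilde U\,a_\Sigma^*(f)\,\widetilde U^{-1}=a_{\Sigma'}^*(U^A_{\Sigma'\Sigma}f)\qquad\text{for all }f\in\mathcal{H}_\Sigma,$$ and it is unique up to a phase: a unitary $\widetilde U'$ satisfies the same condition if and only if $\widetilde U'=e^{i\theta}\widetilde U$ for some $\theta\in\mathbb{R}$. -/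

import Mathlib

open MeasureTheory
open scoped TensorProduct ComplexConjugate ContDiff

noncomputable section

/-- Points `(x⁰, x¹, x², x³)` of Minkowski space-time `ℝ⁴`. -/
abbrev Spacetime : Type := Fin 4 → ℝ

/-- Euclidean three-space. -/
abbrev Space : Type := EuclideanSpace ℝ (Fin 3)

/-- The spin space `ℂ⁴`. -/
abbrev Spinor : Type := EuclideanSpace ℂ (Fin 4)

/-- The Minkowski square `v_μ v^μ`, with signature `(+,-,-,-)`. -/
def minkowskiSq (v : Spacetime) : ℝ := v 0 ^ 2 - v 1 ^ 2 - v 2 ^ 2 - v 3 ^ 2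

/-- The Dirac matrices `γ⁰, γ¹, γ², γ³` in the Dirac representation. -/
def gammaMat : Fin 4 → Matrix (Fin 4) (Fin 4) ℂ :=
  ![!![1, 0, 0, 0; 0, 1, 0, 0; 0, 0, -1, 0; 0, 0, 0, -1],
    !![0, 0, 0, 1; 0, 0, 1, 0; 0, -1, 0, 0; -1, 0, 0, 0],
    !![0, 0, 0, -Complex.I; 0, 0, Complex.I, 0; 0, Complex.I, 0, 0; -Complex.I, 0, 0, 0],
    !![0, 0, 1, 0; 0, 0, 0, -1; -1, 0, 0, 0; 0, 1, 0, 0]]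

/-- A matrix acting on spinors. -/
def spinAct (M : Matrix (Fin 4) (Fin 4) ℂ) (a : Spinor) : Spinor := WithLp.toLp 2 (M.mulVec a.ofLp)

/-- A continuous, (future directed) time- or light-like path without end points in either
direction. Every time- or light-like path can be traversed in the future direction. -/
structure IsInextensibleCausalPath (c : ℝ → Spacetime) : Prop where
  continuous : Continuous c
  causal : ∀ s s', s < s' → 0 < (c s' - c s) 0 ∧ 0 ≤ minkowskiSq (c s' - c s)
  no_future_end : ¬ ∃ p, Filter.Tendsto c Filter.atTop (nhds p)
  no_past_end : ¬ ∃ p, Filter.Tendsto c Filter.atBot (nhds p)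

/-- `v` is the velocity at `x` of a curve inside `S`; for a submanifold `S` these vectors form the
tangent space `T_x S`. -/
def IsTangentTo (S : Set Spacetime) (x v : Spacetime) : Prop :=
  ∃ c : ℝ → Spacetime, (∀ s, c s ∈ S) ∧ c 0 = x ∧ HasDerivAt c v 0

/-- `S` is a smooth three-dimensional submanifold of `ℝ⁴`: locally the zero set of a smooth function
with non-vanishing differential. -/
def IsSmoothHypersurface (S : Set Spacetime) : Prop :=
  ∀ x ∈ S, ∃ O : Set Spacetime, IsOpen O ∧ x ∈ O ∧ ∃ g : Spacetime → ℝ,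
    ContDiffOn ℝ ∞ g O ∧ (∀ y ∈ O, fderiv ℝ g y ≠ 0) ∧ ∀ y ∈ O, y ∈ S ↔ g y = 0

/-- Cauchy surfaces in Minkowski space-time. -/
structure CauchySurface where
  carrier : Set Spacetime
  smooth : IsSmoothHypersurface carrier
  existsUnique_mem : ∀ c, IsInextensibleCausalPath c → ∃! p, p ∈ Set.range c ∧ p ∈ carrier
  spacelike : ∀ x ∈ carrier, ∀ v, IsTangentTo carrier x v → v ≠ 0 → minkowskiSq v < 0

theorem isInextensibleCausalPath_line (x v : Spacetime) (h0 : 0 < v 0) (hv : 0 ≤ minkowskiSq v) :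
    IsInextensibleCausalPath (fun s => x + s • v) where
  continuous := by fun_prop
  causal s s' h := by
    have e : x + s' • v - (x + s • v) = (s' - s) • v := by rw [sub_smul]; abel
    have hs : 0 < s' - s := sub_pos.2 h
    rw [e]
    refine ⟨by simpa using mul_pos hs h0, ?_⟩
    have : minkowskiSq ((s' - s) • v) = (s' - s) ^ 2 * minkowskiSq v := by
      simp [minkowskiSq]; ring
    rw [this]; positivity
  no_future_end := by
    rintro ⟨p, hp⟩
    have h1 : Filter.Tendsto (fun s : ℝ => x 0 + s * v 0) Filter.atTop Filter.atTop :=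
      Filter.tendsto_atTop_add_const_left _ _ (Filter.tendsto_id.atTop_mul_const h0)
    have h2 := (tendsto_pi_nhds.1 hp) 0
    exact not_tendsto_nhds_of_tendsto_atTop h1 _ (by simpa using h2)
  no_past_end := by
    rintro ⟨p, hp⟩
    have h1 : Filter.Tendsto (fun s : ℝ => x 0 + s * v 0) Filter.atBot Filter.atBot :=
      Filter.tendsto_atBot_add_const_left _ _ (Filter.tendsto_id.atBot_mul_const h0)
    have h2 := (tendsto_pi_nhds.1 hp) 0
    exact not_tendsto_nhds_of_tendsto_atBot h1 _ (by simpa using h2)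

/-- The space-time point with time `t` and position `x`. -/
def eventAt (t : ℝ) (x : Space) : Spacetime := ![t, x 0, x 1, x 2]

namespace CauchySurface

variable (S : CauchySurface)

theorem exists_height (x : Space) : ∃ t : ℝ, eventAt t x ∈ S.carrier := by
  obtain ⟨p, ⟨⟨s, hs⟩, hp⟩, -⟩ := S.existsUnique_mem _
    (isInextensibleCausalPath_line (eventAt 0 x) (eventAt 1 0) (by simp [eventAt])
      (by simp [minkowskiSq, eventAt]))
  refine ⟨s, ?_⟩
  have : eventAt s x = p := by
    rw [← hs]; ext i; fin_cases i <;> simp [eventAt]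
  rwa [this]

/-- The function `t_Σ : ℝ³ → ℝ` whose graph `{(t_Σ(x), x)}` is the Cauchy surface `Σ`. -/
def height (x : Space) : ℝ := (S.exists_height x).choose

/-- The global chart `x ↦ (t_Σ(x), x)` of `Σ`. -/
def chart (x : Space) : Spacetime := eventAt (S.height x) x

theorem chart_mem (x : Space) : S.chart x ∈ S.carrier := (S.exists_height x).choose_spec

theorem mem_unique {p q : Spacetime} (hp : p ∈ S.carrier) (hq : q ∈ S.carrier)
    (h0 : 0 < (q - p) 0) : minkowskiSq (q - p) < 0 := by
  by_contra h
  obtain ⟨r, -, hr⟩ := S.existsUnique_mem _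
    (isInextensibleCausalPath_line p (q - p) h0 (not_lt.1 h))
  have h1 := hr p ⟨⟨0, by simp⟩, hp⟩
  have h2 := hr q ⟨⟨1, by simp⟩, hq⟩
  rw [h1, h2] at h0
  simp at h0

theorem eq_chart {p : Spacetime} (hp : p ∈ S.carrier) :
    p = S.chart (WithLp.toLp 2 ![p 1, p 2, p 3]) := by
  set x : Space := WithLp.toLp 2 ![p 1, p 2, p 3]
  have hq := S.chart_mem x
  have key : p 0 = S.height x := by
    rcases lt_trichotomy (p 0) (S.height x) with h | h | h
    · have := S.mem_unique hp hq (by simpa [chart, eventAt] using h)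
      simp [minkowskiSq, chart, eventAt, x] at this
      nlinarith
    · exact h
    · have := S.mem_unique hq hp (by simpa [chart, eventAt] using h)
      simp [minkowskiSq, chart, eventAt, x] at this
      nlinarith
  ext i
  fin_cases i <;> simp [chart, eventAt, x, key]

/-- The partial derivatives `∂₁t_Σ, ∂₂t_Σ, ∂₃t_Σ`. -/
def slope (x : Space) (i : Fin 3) : ℝ := fderiv ℝ S.height x (EuclideanSpace.single i 1)

/-- The tangent vectors `∂₁, ∂₂, ∂₃` of `Σ` in the chart. -/
def frame (x : Space) (i : Fin 3) : Spacetime :=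
  eventAt (S.slope x i) (EuclideanSpace.single i 1)

theorem slope_sq_lt_one (x : Space) :
    S.slope x 0 ^ 2 + S.slope x 1 ^ 2 + S.slope x 2 ^ 2 < 1 := by
  by_cases hd : DifferentiableAt ℝ S.height x
  swap
  · simp [slope, fderiv_zero_of_not_differentiableAt hd]
  set r := S.slope x 0 ^ 2 + S.slope x 1 ^ 2 + S.slope x 2 ^ 2 with hr
  set v : Space := WithLp.toLp 2 (S.slope x) with hv
  have hlin : fderiv ℝ S.height x v = r := by
    have e : v = ∑ i, S.slope x i • EuclideanSpace.single i (1 : ℝ) := by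
      ext j; fin_cases j <;> simp [hv, Fin.sum_univ_three]
    rw [e, map_sum]
    simp only [map_smul, smul_eq_mul, Fin.sum_univ_three]
    change S.slope x 0 * S.slope x 0 + S.slope x 1 * S.slope x 1 + S.slope x 2 * S.slope x 2 = r
    rw [hr]; ring
  by_contra hcon
  have hr1 : 1 ≤ r := not_lt.1 hcon
  have hpath : HasDerivAt (fun s : ℝ => x + s • v) v 0 := by
    simpa using ((hasDerivAt_id (0 : ℝ)).smul_const v).const_add x
  have hht : HasDerivAt (fun s : ℝ => S.height (x + s • v)) r 0 := by
    have h1 : HasFDerivAt S.height (fderiv ℝ S.height x) (x + (0 : ℝ) • v) := by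
      simpa using hd.hasFDerivAt
    rw [← hlin]
    exact h1.comp_hasDerivAt (0 : ℝ) hpath
  have htan : IsTangentTo S.carrier (S.chart x) (eventAt r v) := by
    refine ⟨fun s => S.chart (x + s • v), fun s => S.chart_mem _, by simp, ?_⟩
    rw [hasDerivAt_pi]
    have hc : ∀ j : Fin 3, HasDerivAt (fun s : ℝ => (x + s • v) j) (v j) 0 := fun j => by
      simpa using ((hasDerivAt_id (0 : ℝ)).mul_const (v j)).const_add (x j)
    intro i
    fin_cases i
    · simpa [chart, eventAt] using hht
    · simpa [chart, eventAt] using hc 0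
    · simpa [chart, eventAt] using hc 1
    · simpa [chart, eventAt] using hc 2
  have hne : eventAt r v ≠ 0 := fun h => by
    have := congrFun h 0
    simp [eventAt] at this
    linarith
  have := S.spacelike _ (S.chart_mem x) _ htan hne
  have e : minkowskiSq (eventAt r v) = r ^ 2 - r := by
    simp [minkowskiSq, eventAt, hv, hr]; ring
  nlinarith

/-- The contraction `i_γ(d⁴x)` of the volume form `d⁴x = dx⁰∧dx¹∧dx²∧dx³` with the matrix-valued
vector `γ^μ`, evaluated on the tangent vectors `∂₁, ∂₂, ∂₃` of `Σ`:
`d⁴x(γ, ∂₁, ∂₂, ∂₃) = ∑_μ det(e_μ, ∂₁, ∂₂, ∂₃) γ^μ`. -/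
def volumeContraction (x : Space) : Matrix (Fin 4) (Fin 4) ℂ :=
  ∑ μ : Fin 4, ((Matrix.of ![Pi.single μ 1, S.frame x 0, S.frame x 1, S.frame x 2]).det : ℂ) •
    gammaMat μ

/-- The density `φ̄ i_γ(d⁴x) ψ`, with `φ̄ = φ* γ⁰`, at a point of `Σ`. -/
def density (x : Space) (a b : Spinor) : ℂ :=
  inner ℂ a (spinAct (gammaMat 0 * S.volumeContraction x) b)

end CauchySurface

/-- `∑ pᵢ γ⁰γⁱ`. -/
def alphaDot (p : Fin 3 → ℝ) : Matrix (Fin 4) (Fin 4) ℂ :=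
  (p 0 : ℂ) • (gammaMat 0 * gammaMat 1) + (p 1 : ℂ) • (gammaMat 0 * gammaMat 2) +
    (p 2 : ℂ) • (gammaMat 0 * gammaMat 3)

theorem alphaDot_eq (p : Fin 3 → ℝ) : alphaDot p =
    !![0, 0, (p 2 : ℂ), p 0 - p 1 * Complex.I; 0, 0, p 0 + p 1 * Complex.I, -p 2;
      p 2, p 0 - p 1 * Complex.I, 0, 0; p 0 + p 1 * Complex.I, -p 2, 0, 0] := by
  ext i j
  fin_cases i <;> fin_cases j <;>
    simp [alphaDot, gammaMat] <;> ring

theorem alphaDot_mul_self (p : Fin 3 → ℝ) :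
    alphaDot p * alphaDot p = ((p 0 ^ 2 + p 1 ^ 2 + p 2 ^ 2 : ℝ) : ℂ) • 1 := by
  rw [alphaDot_eq]
  ext i j
  fin_cases i <;> fin_cases j <;>
    simp [Matrix.mul_apply, Fin.sum_univ_four] <;> ring_nf <;> simp

theorem alphaDot_isHermitian (p : Fin 3 → ℝ) : (alphaDot p).IsHermitian := by
  rw [alphaDot_eq]
  ext i j
  fin_cases i <;> fin_cases j <;> simp [Matrix.conjTranspose_apply] <;> ring

theorem det_frame (a b c : ℝ) (w : Spacetime) :
    (Matrix.of ![w, ![a, 1, 0, 0], ![b, 0, 1, 0], ![c, 0, 0, 1]]).det =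
      w 0 - a * w 1 - b * w 2 - c * w 3 := by
  simp [Matrix.det_succ_row_zero, Fin.sum_univ_succ, Matrix.submatrix, Fin.succAbove]
  ring

theorem volumeContraction_eq (S : CauchySurface) (x : Space) :
    S.volumeContraction x = gammaMat 0 - ((S.slope x 0 : ℂ) • gammaMat 1 +
      (S.slope x 1 : ℂ) • gammaMat 2 + (S.slope x 2 : ℂ) • gammaMat 3) := by
  have e0 : S.frame x 0 = ![S.slope x 0, 1, 0, 0] := by
    simp [CauchySurface.frame, eventAt]
  have e1 : S.frame x 1 = ![S.slope x 1, 0, 1, 0] := by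
    simp [CauchySurface.frame, eventAt]
  have e2 : S.frame x 2 = ![S.slope x 2, 0, 0, 1] := by
    simp [CauchySurface.frame, eventAt]
  simp only [CauchySurface.volumeContraction, e0, e1, e2, det_frame, Fin.sum_univ_four]
  simp
  module

theorem gamma_mul_volumeContraction (S : CauchySurface) (x : Space) :
    gammaMat 0 * S.volumeContraction x = 1 - alphaDot (S.slope x) := by
  have h : gammaMat 0 * gammaMat 0 = 1 := by
    ext i j
    fin_cases i <;> fin_cases j <;> simp [gammaMat, Matrix.mul_apply, Fin.sum_univ_four]
  rw [volumeContraction_eq, mul_sub, h, mul_add, mul_add, mul_smul_comm, mul_smul_comm,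
    mul_smul_comm, alphaDot]

/-- `√(1 - |p|²)`. -/
def lorentzRoot (p : Fin 3 → ℝ) : ℝ := √(1 - (p 0 ^ 2 + p 1 ^ 2 + p 2 ^ 2))

/-- The scalar coefficient of the square root of `1 - ∑ pᵢ γ⁰γⁱ`. -/
def rootCoeff (p : Fin 3 → ℝ) : ℝ := √((1 + lorentzRoot p) / 2)

/-- The positive square root of `1 - ∑ pᵢ γ⁰γⁱ`, for `|p| < 1`. -/
def densityRoot (p : Fin 3 → ℝ) : Matrix (Fin 4) (Fin 4) ℂ :=
  (rootCoeff p : ℂ) • 1 - ((1 / (2 * rootCoeff p) : ℝ) : ℂ) • alphaDot p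

/-- The inverse of `densityRoot p`, for `|p| < 1`. -/
def densityRootInv (p : Fin 3 → ℝ) : Matrix (Fin 4) (Fin 4) ℂ :=
  (((lorentzRoot p)⁻¹ : ℝ) : ℂ) •
    ((rootCoeff p : ℂ) • 1 + ((1 / (2 * rootCoeff p) : ℝ) : ℂ) • alphaDot p)

theorem rootCoeff_pos (p : Fin 3 → ℝ) : 0 < rootCoeff p := by
  have : 0 ≤ lorentzRoot p := Real.sqrt_nonneg _
  exact Real.sqrt_pos.2 (by linarith)

theorem rootCoeff_sq (p : Fin 3 → ℝ) : rootCoeff p ^ 2 = (1 + lorentzRoot p) / 2 := by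
  have : 0 ≤ lorentzRoot p := Real.sqrt_nonneg _
  exact Real.sq_sqrt (by linarith)

theorem lorentzRoot_sq {p : Fin 3 → ℝ} (h : p 0 ^ 2 + p 1 ^ 2 + p 2 ^ 2 < 1) :
    lorentzRoot p ^ 2 = 1 - (p 0 ^ 2 + p 1 ^ 2 + p 2 ^ 2) :=
  Real.sq_sqrt (by linarith)

theorem densityRoot_mul_self {p : Fin 3 → ℝ} (h : p 0 ^ 2 + p 1 ^ 2 + p 2 ^ 2 < 1) :
    densityRoot p * densityRoot p = 1 - alphaDot p := by
  have hp := rootCoeff_pos p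
  have hw : 0 ≤ lorentzRoot p := Real.sqrt_nonneg _
  have h1 : rootCoeff p * rootCoeff p + 1 / (2 * rootCoeff p) * (1 / (2 * rootCoeff p)) *
      (p 0 ^ 2 + p 1 ^ 2 + p 2 ^ 2) = 1 := by
    have hs := rootCoeff_sq p
    have hl := lorentzRoot_sq h
    field_simp
    have : rootCoeff p ^ 4 = ((1 + lorentzRoot p) / 2) ^ 2 := by rw [← hs]; ring
    nlinarith
  have h2 : rootCoeff p * (1 / (2 * rootCoeff p)) = 1 / 2 := by field_simp
  have h1' := congrArg (fun t : ℝ => (t : ℂ)) h1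
  have h2' := congrArg (fun t : ℝ => (t : ℂ)) h2
  simp only [Complex.ofReal_add, Complex.ofReal_mul] at h1' h2'
  have : densityRoot p * densityRoot p =
      ((rootCoeff p : ℂ) * rootCoeff p) • 1
      - (2 * ((rootCoeff p : ℂ) * ((1 / (2 * rootCoeff p) : ℝ) : ℂ))) • alphaDot p
      + (((1 / (2 * rootCoeff p) : ℝ) : ℂ) * ((1 / (2 * rootCoeff p) : ℝ) : ℂ)) •
        (alphaDot p * alphaDot p) := by
    simp only [densityRoot, sub_mul, mul_sub, smul_mul_assoc, mul_smul_comm, one_mul, mul_one]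
    module
  rw [this, h2', alphaDot_mul_self, smul_smul]
  have e : ((rootCoeff p : ℂ) * rootCoeff p) • (1 : Matrix (Fin 4) (Fin 4) ℂ) -
      (2 * ((1 / 2 : ℝ) : ℂ)) • alphaDot p +
      (((1 / (2 * rootCoeff p) : ℝ) : ℂ) * ((1 / (2 * rootCoeff p) : ℝ) : ℂ) *
        ((p 0 ^ 2 + p 1 ^ 2 + p 2 ^ 2 : ℝ) : ℂ)) • (1 : Matrix (Fin 4) (Fin 4) ℂ) =
      ((rootCoeff p : ℂ) * rootCoeff p + ((1 / (2 * rootCoeff p) : ℝ) : ℂ) *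
        ((1 / (2 * rootCoeff p) : ℝ) : ℂ) * ((p 0 ^ 2 + p 1 ^ 2 + p 2 ^ 2 : ℝ) : ℂ)) •
        (1 : Matrix (Fin 4) (Fin 4) ℂ) - (2 * ((1 / 2 : ℝ) : ℂ)) • alphaDot p := by module
  rw [e, Complex.ofReal_add, Complex.ofReal_add, h1']
  norm_num

theorem densityRoot_mul_inv {p : Fin 3 → ℝ} (h : p 0 ^ 2 + p 1 ^ 2 + p 2 ^ 2 < 1) :
    densityRoot p * densityRootInv p = 1 := by
  have hp := rootCoeff_pos p
  have hl := lorentzRoot_sq h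
  have hw : 0 < lorentzRoot p := Real.sqrt_pos.2 (by linarith)
  have h1 : (lorentzRoot p)⁻¹ * (rootCoeff p * rootCoeff p - 1 / (2 * rootCoeff p) *
      (1 / (2 * rootCoeff p)) * (p 0 ^ 2 + p 1 ^ 2 + p 2 ^ 2)) = 1 := by
    have hs := rootCoeff_sq p
    field_simp
    have : rootCoeff p ^ 4 = ((1 + lorentzRoot p) / 2) ^ 2 := by rw [← hs]; ring
    nlinarith
  have h1' := congrArg (fun t : ℝ => (t : ℂ)) h1
  simp only [Complex.ofReal_mul, Complex.ofReal_sub] at h1'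
  have : densityRoot p * densityRootInv p = (((lorentzRoot p)⁻¹ : ℝ) : ℂ) •
      (((rootCoeff p : ℂ) * rootCoeff p) • 1
      - (((1 / (2 * rootCoeff p) : ℝ) : ℂ) * ((1 / (2 * rootCoeff p) : ℝ) : ℂ)) •
        (alphaDot p * alphaDot p)) := by
    simp only [densityRoot, densityRootInv, sub_mul, mul_add, smul_mul_assoc, mul_smul_comm,
      one_mul, mul_one]
    module
  rw [this, alphaDot_mul_self, smul_smul, ← sub_smul, smul_smul, h1']
  simp

theorem densityRoot_isHermitian (p : Fin 3 → ℝ) : (densityRoot p).IsHermitian := by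
  have := alphaDot_isHermitian p
  unfold densityRoot Matrix.IsHermitian at *
  rw [Matrix.conjTranspose_sub, Matrix.conjTranspose_smul, Matrix.conjTranspose_smul, this]
  simp

theorem spinAct_mul (M N : Matrix (Fin 4) (Fin 4) ℂ) (a : Spinor) :
    spinAct (M * N) a = spinAct M (spinAct N a) := by
  simp [spinAct, Matrix.mulVec_mulVec]

theorem spinAct_one (a : Spinor) : spinAct 1 a = a := by simp [spinAct]

theorem spinAct_add (M : Matrix (Fin 4) (Fin 4) ℂ) (a b : Spinor) :
    spinAct M (a + b) = spinAct M a + spinAct M b := by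
  simp [spinAct, Matrix.mulVec_add]

theorem spinAct_smul (M : Matrix (Fin 4) (Fin 4) ℂ) (z : ℂ) (a : Spinor) :
    spinAct M (z • a) = z • spinAct M a := by
  simp [spinAct, Matrix.mulVec_smul]

theorem inner_spinAct {M : Matrix (Fin 4) (Fin 4) ℂ} (hM : M.IsHermitian) (a b : Spinor) :
    inner ℂ a (spinAct M b) = inner ℂ (spinAct M a) b := by
  simp only [spinAct, EuclideanSpace.inner_eq_star_dotProduct, Matrix.star_mulVec, hM.eq]
  rw [dotProduct_comm, Matrix.dotProduct_mulVec, dotProduct_comm]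

theorem CauchySurface.density_eq (S : CauchySurface) (x : Space) (a b : Spinor) :
    S.density x a b =
      inner ℂ (spinAct (densityRoot (S.slope x)) a) (spinAct (densityRoot (S.slope x)) b) := by
  rw [← inner_spinAct (densityRoot_isHermitian _), ← spinAct_mul,
    densityRoot_mul_self (S.slope_sq_lt_one x), CauchySurface.density,
    gamma_mul_volumeContraction]

theorem continuous_alphaDot : Continuous alphaDot := by
  unfold alphaDot; fun_prop

theorem continuous_lorentzRoot : Continuous lorentzRoot := by
  unfold lorentzRoot; fun_prop

theorem continuous_rootCoeff : Continuous rootCoeff := by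
  have := continuous_lorentzRoot
  unfold rootCoeff; fun_prop

theorem continuous_rootPart : Continuous fun p : Fin 3 → ℝ =>
    ((1 / (2 * rootCoeff p) : ℝ) : ℂ) • alphaDot p := by
  have h1 := continuous_rootCoeff
  have h2 := continuous_alphaDot
  have h3 : Continuous fun p : Fin 3 → ℝ => (1 / (2 * rootCoeff p) : ℝ) :=
    Continuous.div continuous_const (by fun_prop)
      (fun p => by have := rootCoeff_pos p; positivity)
  fun_prop

theorem continuous_densityRoot : Continuous densityRoot := by
  have h1 := continuous_rootCoeff
  have h2 := continuous_rootPart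
  unfold densityRoot; fun_prop

theorem continuous_spinAct : Continuous fun q : Matrix (Fin 4) (Fin 4) ℂ × Spinor =>
    spinAct q.1 q.2 := by
  unfold spinAct; fun_prop

namespace CauchySurface

variable (S : CauchySurface)

theorem measurable_slope : Measurable S.slope :=
  measurable_pi_lambda _ fun _ => measurable_fderiv_apply_const ℝ S.height _

theorem aestronglyMeasurable_spinAct {M : Space → Matrix (Fin 4) (Fin 4) ℂ}
    (hM : StronglyMeasurable M) {f : Space → Spinor} (hf : AEStronglyMeasurable f volume) :
    AEStronglyMeasurable (fun x => spinAct (M x) (f x)) volume := by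
  have h : AEStronglyMeasurable (fun x => (M x, f x)) volume :=
    AEStronglyMeasurable.prodMk hM.aestronglyMeasurable hf
  exact Continuous.comp_aestronglyMeasurable (f := fun x => (M x, f x)) continuous_spinAct h

theorem stronglyMeasurable_root :
    StronglyMeasurable (fun x => densityRoot (S.slope x)) :=
  Continuous.comp_stronglyMeasurable (f := S.slope) continuous_densityRoot
    S.measurable_slope.stronglyMeasurable

theorem stronglyMeasurable_rootInv :
    StronglyMeasurable (fun x => densityRootInv (S.slope x)) := by
  have h1 := continuous_rootCoeff
  have h2 := continuous_rootPart
  have h3 : Measurable fun x => (((lorentzRoot (S.slope x))⁻¹ : ℝ) : ℂ) :=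
    Complex.measurable_ofReal.comp
      (continuous_lorentzRoot.measurable.comp S.measurable_slope).inv
  have h4 : Continuous fun p : Fin 3 → ℝ =>
    ((rootCoeff p : ℂ) • (1 : Matrix (Fin 4) (Fin 4) ℂ) +
      ((1 / (2 * rootCoeff p) : ℝ) : ℂ) • alphaDot p) := by
    have h5 : Continuous fun p : Fin 3 → ℝ =>
        ((rootCoeff p : ℂ) • (1 : Matrix (Fin 4) (Fin 4) ℂ)) := by fun_prop
    exact h5.add h2
  have h6 := Continuous.comp_stronglyMeasurable (f := S.slope) h4
    S.measurable_slope.stronglyMeasurable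
  exact StronglyMeasurable.smul h3.stronglyMeasurable h6

end CauchySurface

namespace CauchySurface

variable (S : CauchySurface)

theorem density_self (x : Space) (a : Spinor) :
    S.density x a a = ((‖spinAct (densityRoot (S.slope x)) a‖ ^ 2 : ℝ) : ℂ) := by
  rw [density_eq, inner_self_eq_norm_sq_to_K]
  push_cast; rfl

theorem integrable_density_iff (f : Space →ₘ[volume] Spinor) :
    Integrable (fun x => S.density x (f x) (f x)) volume ↔
      MemLp (fun x => spinAct (densityRoot (S.slope x)) (f x)) 2 volume := by
  rw [memLp_two_iff_integrable_sq_norm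
    (aestronglyMeasurable_spinAct S.stronglyMeasurable_root f.aestronglyMeasurable)]
  simp only [density_self]
  exact ⟨fun h => by simpa only [RCLike.re_to_complex, Complex.ofReal_re] using h.re, fun h => h.ofReal⟩

/-- The measurable spinor fields `φ : Σ → ℂ⁴` (modulo null sets, read in the chart of `Σ`) with
`∫_Σ φ̄ i_γ(d⁴x) φ < ∞`. -/
def squareIntegrable : Submodule ℂ (Space →ₘ[volume] Spinor) where
  carrier := {f | Integrable (fun x => S.density x (f x) (f x)) volume}
  zero_mem' := by
    refine (S.integrable_density_iff 0).2 (MemLp.ae_eq (f := fun _ => 0) ?_ MemLp.zero)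
    filter_upwards [AEEqFun.coeFn_zero (μ := volume) (α := Space) (β := Spinor)] with x hx
    rw [hx]; simp [spinAct]
  add_mem' {f g} hf hg := by
    have hf' := (S.integrable_density_iff f).1 hf
    have hg' := (S.integrable_density_iff g).1 hg
    refine (S.integrable_density_iff (f + g)).2 ((hf'.add hg').ae_eq ?_)
    filter_upwards [AEEqFun.coeFn_add f g] with x hx
    rw [hx, Pi.add_apply, Pi.add_apply, spinAct_add]
  smul_mem' z f hf := by
    have hf' := (S.integrable_density_iff f).1 hf
    refine (S.integrable_density_iff (z • f)).2 ((hf'.const_smul z).ae_eq ?_)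
    filter_upwards [AEEqFun.coeFn_smul z f] with x hx
    rw [hx, Pi.smul_apply, Pi.smul_apply, spinAct_smul]

end CauchySurface

/-- The Hilbert space `H_Σ = L²(Σ, ℂ⁴)` of a Cauchy surface, with the scalar product
`⟨φ, ψ⟩ = ∫_Σ φ̄ i_γ(d⁴x) ψ`. -/
def DiracSpace (S : CauchySurface) : Type := S.squareIntegrable

namespace DiracSpace

variable {S : CauchySurface}

instance : AddCommGroup (DiracSpace S) := inferInstanceAs (AddCommGroup S.squareIntegrable)

instance : Module ℂ (DiracSpace S) := inferInstanceAs (Module ℂ S.squareIntegrable)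

/-- The spinor field of an element of `H_Σ`, read in the chart of `Σ`. -/
def field (f : DiracSpace S) : Space →ₘ[volume] Spinor := Subtype.val (show S.squareIntegrable from f)

theorem field_injective : Function.Injective (field (S := S)) := Subtype.val_injective

theorem field_add (f g : DiracSpace S) : (f + g).field = f.field + g.field := rfl

theorem field_smul (z : ℂ) (f : DiracSpace S) : (z • f).field = z • f.field := rfl

theorem memLp_root (f : DiracSpace S) :
    MemLp (fun x => spinAct (densityRoot (S.slope x)) (f.field x)) 2 volume :=
  (S.integrable_density_iff f.field).1 (Subtype.property (show S.squareIntegrable from f))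

/-- Multiplication with the square root of the density, mapping `H_Σ` to the unweighted `L²` space;
it serves only to prove that `H_Σ` is a Hilbert space. -/
def toLpLin : DiracSpace S →ₗ[ℂ] Lp Spinor 2 (volume : Measure Space) where
  toFun f := f.memLp_root.toLp _
  map_add' f g := by
    rw [← MemLp.toLp_add]
    refine MemLp.toLp_congr _ _ ?_
    filter_upwards [AEEqFun.coeFn_add f.field g.field] with x hx
    rw [field_add, hx, Pi.add_apply, Pi.add_apply, spinAct_add]
  map_smul' z f := by
    rw [RingHom.id_apply, ← MemLp.toLp_const_smul]
    refine MemLp.toLp_congr _ _ ?_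
    filter_upwards [AEEqFun.coeFn_smul z f.field] with x hx
    rw [field_smul, hx, Pi.smul_apply, Pi.smul_apply, spinAct_smul]

theorem toLpLin_bijective : Function.Bijective (toLpLin (S := S)) := by
  have hinj : ∀ p : Fin 3 → ℝ, p 0 ^ 2 + p 1 ^ 2 + p 2 ^ 2 < 1 → ∀ a : Spinor,
      spinAct (densityRootInv p) (spinAct (densityRoot p) a) = a := fun p hp a => by
    rw [← spinAct_mul, mul_eq_one_comm.1 (densityRoot_mul_inv hp), spinAct_one]
  constructor
  · intro f g hfg
    have h := (MemLp.toLp_eq_toLp_iff f.memLp_root g.memLp_root).1 hfg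
    refine field_injective (AEEqFun.ext ?_)
    filter_upwards [h] with x hx
    have := congrArg (spinAct (densityRootInv (S.slope x))) hx
    rwa [hinj _ (S.slope_sq_lt_one x), hinj _ (S.slope_sq_lt_one x)] at this
  · intro u
    have hu := CauchySurface.aestronglyMeasurable_spinAct S.stronglyMeasurable_rootInv
      (Lp.aestronglyMeasurable u)
    let f : Space →ₘ[volume] Spinor := AEEqFun.mk _ hu
    have hf : (fun x => spinAct (densityRoot (S.slope x)) (f x)) =ᵐ[volume] u := by
      filter_upwards [AEEqFun.coeFn_mk _ hu] with x hx
      rw [hx, ← spinAct_mul, densityRoot_mul_inv (S.slope_sq_lt_one x), spinAct_one]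
    have hm : f ∈ S.squareIntegrable :=
      (S.integrable_density_iff f).2 ((Lp.memLp u).ae_eq hf.symm)
    refine ⟨(⟨f, hm⟩ : S.squareIntegrable), ?_⟩
    refine Lp.ext ?_
    have hf2 : MemLp (fun x => spinAct (densityRoot (S.slope x)) (f x)) 2 volume :=
      (S.integrable_density_iff f).1 hm
    exact (MemLp.coeFn_toLp hf2).trans hf

/-- `toLpLin` as a linear bijection. -/
def toLp : DiracSpace S ≃ₗ[ℂ] Lp Spinor 2 (volume : Measure Space) :=
  LinearEquiv.ofBijective toLpLin toLpLin_bijective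

theorem toLp_ae (f : DiracSpace S) :
    toLp f =ᵐ[volume] fun x => spinAct (densityRoot (S.slope x)) (f.field x) :=
  MemLp.coeFn_toLp f.memLp_root

/-- The scalar product `∫_Σ φ̄ i_γ(d⁴x) ψ`. -/
def scalarProduct (f g : DiracSpace S) : ℂ := ∫ x, S.density x (f.field x) (g.field x)

theorem scalarProduct_eq (f g : DiracSpace S) : scalarProduct f g = inner ℂ (toLp f) (toLp g) := by
  rw [L2.inner_def, scalarProduct]
  refine integral_congr_ae ?_
  filter_upwards [toLp_ae f, toLp_ae g] with x hf hg
  rw [hf, hg, CauchySurface.density_eq]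

@[reducible] def innerCore : InnerProductSpace.Core ℂ (DiracSpace S) where
  inner f g := scalarProduct f g
  conj_inner_symm f g := by rw [scalarProduct_eq, scalarProduct_eq, inner_conj_symm]
  re_inner_nonneg f := by rw [scalarProduct_eq]; exact inner_self_nonneg
  add_left f g h := by
    rw [scalarProduct_eq, scalarProduct_eq, scalarProduct_eq, map_add, inner_add_left]
  smul_left f g z := by rw [scalarProduct_eq, scalarProduct_eq, map_smul, inner_smul_left]
  definite f h := by
    rw [scalarProduct_eq, inner_self_eq_zero] at h
    simpa using h

instance : NormedAddCommGroup (DiracSpace S) :=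
  InnerProductSpace.Core.toNormedAddCommGroup (𝕜 := ℂ) (cd := innerCore)

instance : InnerProductSpace ℂ (DiracSpace S) :=
  InnerProductSpace.ofCore (innerCore (S := S)).toCore

theorem inner_def (f g : DiracSpace S) :
    inner ℂ f g = ∫ x, S.density x (f.field x) (g.field x) := rfl

instance : CompleteSpace (DiracSpace S) := by
  let e : DiracSpace S ≃ₗᵢ[ℂ] Lp Spinor 2 (volume : Measure Space) :=
    toLp.isometryOfInner fun f g => (scalarProduct_eq f g).symm
  exact (completeSpace_congr (e := e.toEquiv) e.isometry.isUniformEmbedding).2 inferInstance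

end DiracSpace


theorem tendsto_time_atTop {c : ℝ → Spacetime}
    (h : ∀ s s', s < s' → 0 < (c s' - c s) 0 ∧ 0 ≤ minkowskiSq (c s' - c s))
    (hn : ¬ ∃ p, Filter.Tendsto c Filter.atTop (nhds p)) :
    Filter.Tendsto (fun s => c s 0) Filter.atTop Filter.atTop := by
  have hm : Monotone fun s => c s 0 := by
    have : StrictMono fun s => c s 0 := fun s s' hs => by simpa using (h s s' hs).1
    exact this.monotone
  refine (tendsto_atTop_of_monotone hm).resolve_right ?_
  rintro ⟨l, hl⟩
  refine hn (cauchySeq_tendsto_of_complete ?_)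
  rw [Metric.cauchySeq_iff']
  intro ε hε
  obtain ⟨N, hN⟩ := Metric.cauchySeq_iff'.1 hl.cauchySeq ε hε
  refine ⟨N, fun n hn => ?_⟩
  rcases eq_or_lt_of_le (show N ≤ n from hn) with rfl | hlt
  · simpa using hε
  have h1 := h N n hlt
  have h2 := hN n hn
  simp only [Pi.sub_apply, minkowskiSq] at h1
  rw [Real.dist_eq, abs_of_pos h1.1] at h2
  rw [dist_pi_lt_iff hε]
  intro i
  refine lt_of_le_of_lt ?_ h2
  rw [Real.dist_eq]
  apply abs_le_of_sq_le_sq _ h1.1.le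
  have q1 := sq_nonneg (c n 1 - c N 1)
  have q2 := sq_nonneg (c n 2 - c N 2)
  have q3 := sq_nonneg (c n 3 - c N 3)
  fin_cases i <;> simp <;> linarith [h1.2]

theorem exists_time_eq_zero {c : ℝ → Spacetime} (hc : IsInextensibleCausalPath c) :
    ∃ s, c s 0 = 0 := by
  have h1 := tendsto_time_atTop hc.causal hc.no_future_end
  have h2 : Filter.Tendsto (fun s => (-c (-s)) 0) Filter.atTop Filter.atTop := by
    refine tendsto_time_atTop (c := fun s => -c (-s)) (fun s s' hs => ?_) ?_
    · have := hc.causal (-s') (-s) (by linarith)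
      have e : -c (-s') - -c (-s) = c (-s) - c (-s') := by abel
      rwa [e]
    · rintro ⟨p, hp⟩
      refine hc.no_past_end ⟨-p, ?_⟩
      have := (hp.comp Filter.tendsto_neg_atBot_atTop).neg
      simpa [Function.comp_def] using this
  obtain ⟨a, ha⟩ := (h1.eventually_ge_atTop 0).exists
  obtain ⟨b, hb⟩ := (h2.eventually_ge_atTop 0).exists
  have hcont : Continuous fun s => c s 0 := (continuous_apply 0).comp hc.continuous
  exact mem_range_of_exists_le_of_exists_ge hcont ⟨-b, by simpa using hb⟩ ⟨a, ha⟩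

/-- The hyperplane `{x⁰ = 0}` as a Cauchy surface. -/
def flatSurface : CauchySurface where
  carrier := {p | p 0 = 0}
  smooth x _ := ⟨Set.univ, isOpen_univ, trivial, fun p => p 0, by fun_prop, fun y _ h => by
    have e : fderiv ℝ (fun p : Spacetime => p 0) y = ContinuousLinearMap.proj 0 :=
      (ContinuousLinearMap.proj (R := ℝ) (φ := fun _ : Fin 4 => ℝ) 0).fderiv
    rw [e] at h
    have := DFunLike.congr_fun h (fun _ => 1)
    simp at this, fun y _ => Iff.rfl⟩
  existsUnique_mem c hc := by
    obtain ⟨s, hs⟩ := exists_time_eq_zero hc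
    refine ⟨c s, ⟨⟨s, rfl⟩, hs⟩, ?_⟩
    rintro _ ⟨⟨s', rfl⟩, hs'⟩
    have hs'' : c s' 0 = 0 := hs'
    rcases lt_trichotomy s s' with h | rfl | h
    · have := (hc.causal _ _ h).1
      simp [hs, hs''] at this
    · rfl
    · have := (hc.causal _ _ h).1
      simp [hs, hs''] at this
  spacelike x _ v hv hne := by
    obtain ⟨c, hc, -, hd⟩ := hv
    have h0 : v 0 = 0 := by
      have h1 := (hasDerivAt_pi.1 hd) 0
      have h2 : (fun s => c s 0) = fun _ => (0 : ℝ) := funext hc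
      rw [h2] at h1
      exact h1.unique (hasDerivAt_const _ _)
    by_contra hcon
    refine hne ?_
    simp only [minkowskiSq, h0, not_lt] at hcon
    have q1 := sq_nonneg (v 1)
    have q2 := sq_nonneg (v 2)
    have q3 := sq_nonneg (v 3)
    ext i
    fin_cases i
    · exact h0
    · exact pow_eq_zero_iff two_ne_zero |>.1 (show v 1 ^ 2 = 0 by linarith)
    · exact pow_eq_zero_iff two_ne_zero |>.1 (show v 2 ^ 2 = 0 by linarith)
    · exact pow_eq_zero_iff two_ne_zero |>.1 (show v 3 ^ 2 = 0 by linarith)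

/-- The complex conjugate `K̄` of a complex vector space `K`: the same vectors, with scalar
multiplication `(z, x) ↦ z̄ x`. -/
def ConjSpace (K : Type*) : Type _ := K

namespace ConjSpace

variable {K : Type*}

/-- The identity map `K → K̄`. -/
def mk (x : K) : ConjSpace K := x

/-- The identity map `K̄ → K`. -/
def out (x : ConjSpace K) : K := x

instance [AddCommGroup K] : AddCommGroup (ConjSpace K) := inferInstanceAs (AddCommGroup K)

instance [AddCommGroup K] [Module ℂ K] : Module ℂ (ConjSpace K) :=
  Module.compHom K (starRingEnd ℂ)

theorem out_smul [AddCommGroup K] [Module ℂ K] (z : ℂ) (x : ConjSpace K) :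
    out (z • x) = conj z • out x := rfl

instance [NormedAddCommGroup K] : NormedAddCommGroup (ConjSpace K) :=
  inferInstanceAs (NormedAddCommGroup K)

instance [NormedAddCommGroup K] [InnerProductSpace ℂ K] : InnerProductSpace ℂ (ConjSpace K) where
  norm_smul_le z x := by
    change ‖conj z • out x‖ ≤ ‖z‖ * ‖out x‖
    rw [norm_smul, RCLike.norm_conj]
  inner x y := inner ℂ (out y) (out x)
  norm_sq_eq_re_inner x := norm_sq_eq_re_inner (𝕜 := ℂ) (out x)
  conj_inner_symm x y := inner_conj_symm (out y) (out x)
  add_left x y z := inner_add_right (out z) (out x) (out y)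
  smul_left x y z := inner_smul_right (out y) (out x) (conj z)

theorem inner_def [NormedAddCommGroup K] [InnerProductSpace ℂ K] (x y : ConjSpace K) :
    inner ℂ x y = inner ℂ (out y) (out x) := rfl

end ConjSpace

/-- A complex algebra with scalars acting through complex conjugation, so that `ℂ`-linear maps into
it are the conjugate-linear maps into the original algebra. -/
def ConjAlgebra (B : Type*) : Type _ := B

namespace ConjAlgebra

instance (B : Type*) [Ring B] : Ring (ConjAlgebra B) := inferInstanceAs (Ring B)

instance (B : Type*) [Ring B] [Algebra ℂ B] : Algebra ℂ (ConjAlgebra B) :=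
  Algebra.compHom B (starRingEnd ℂ)

theorem smul_def {B : Type*} [Ring B] [Algebra ℂ B] (z : ℂ) (x : ConjAlgebra B) :
    z • x = (show ConjAlgebra B from (conj z • (show B from x) : B)) := rfl

end ConjAlgebra

namespace ExteriorAlgebra

variable {K : Type*} [NormedAddCommGroup K] [InnerProductSpace ℂ K]

/-- The contraction `⟨g, ·⟩ ⌋` on `⋀K`, the adjoint of the exterior multiplication with `g`. -/
def innerContract (g : K) : ExteriorAlgebra ℂ K →ₗ[ℂ] ExteriorAlgebra ℂ K :=
  CliffordAlgebra.contractLeft (Q := (0 : QuadraticForm ℂ K)) (innerₛₗ ℂ g)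

theorem innerContract_ι_mul (g h : K) (x : ExteriorAlgebra ℂ K) :
    innerContract g (ι ℂ h * x) = inner ℂ g h • x - ι ℂ h * innerContract g x :=
  CliffordAlgebra.contractLeft_ι_mul (innerₛₗ ℂ g) h x

theorem innerContract_algebraMap (g : K) (z : ℂ) :
    innerContract g (algebraMap ℂ (ExteriorAlgebra ℂ K) z) = 0 :=
  CliffordAlgebra.contractLeft_algebraMap (0 : QuadraticForm ℂ K) (innerₛₗ ℂ g) z

theorem innerContract_innerContract (g : K) (x : ExteriorAlgebra ℂ K) :
    innerContract g (innerContract g x) = 0 :=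
  CliffordAlgebra.contractLeft_contractLeft (innerₛₗ ℂ g) x

/-- `g ↦ innerContract g` as a linear map into the conjugate opposite endomorphism algebra. -/
def contractLin : K →ₗ[ℂ] ConjAlgebra (Module.End ℂ (ExteriorAlgebra ℂ K))ᵐᵒᵖ where
  toFun g := MulOpposite.op (innerContract g : Module.End ℂ (ExteriorAlgebra ℂ K))
  map_add' g h := by
    refine MulOpposite.unop_injective ?_
    change innerContract (g + h) = innerContract g + innerContract h
    simp [innerContract]
  map_smul' z g := by
    refine MulOpposite.unop_injective ?_
    change innerContract (z • g) = conj z • innerContract g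
    simp [innerContract]

/-- The conjugate-linear antimultiplicative map `⋀K → End (⋀K)` that sends
`x₁ ∧ ⋯ ∧ xₙ` to the composite of contractions `⟨xₙ, ·⟩⌋ ∘ ⋯ ∘ ⟨x₁, ·⟩⌋`. -/
def contract : ExteriorAlgebra ℂ K →ₐ[ℂ] ConjAlgebra (Module.End ℂ (ExteriorAlgebra ℂ K))ᵐᵒᵖ :=
  lift ℂ ⟨contractLin, fun g => by
    refine MulOpposite.unop_injective ?_
    change innerContract g ∘ₗ innerContract g = 0
    ext x
    simp [innerContract_innerContract]⟩

/-- `contractBy x y = ⟨xₙ, ·⟩⌋ ⋯ ⟨x₁, ·⟩⌋ y` for `x = x₁ ∧ ⋯ ∧ xₙ`. -/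
def contractBy (x : ExteriorAlgebra ℂ K) : Module.End ℂ (ExteriorAlgebra ℂ K) :=
  MulOpposite.unop (show (Module.End ℂ (ExteriorAlgebra ℂ K))ᵐᵒᵖ from contract x)

theorem contractBy_add (x x' : ExteriorAlgebra ℂ K) :
    contractBy (x + x') = contractBy x + contractBy x' := by
  unfold contractBy; rw [map_add]; rfl

theorem contractBy_smul (z : ℂ) (x : ExteriorAlgebra ℂ K) :
    contractBy (z • x) = conj z • contractBy x := by
  unfold contractBy; rw [map_smul]; rfl

theorem contractBy_one : contractBy (1 : ExteriorAlgebra ℂ K) = 1 := by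
  unfold contractBy; rw [map_one]; rfl

theorem contractBy_ι_mul (g : K) (x y : ExteriorAlgebra ℂ K) :
    contractBy (ι ℂ g * x) y = contractBy x (innerContract g y) := by
  unfold contractBy; rw [map_mul]
  have : contract (ι ℂ g) = contractLin g := lift_ι_apply ℂ _ _ g
  rw [this]; rfl

/-- The inner product on `⋀K` with
`⟨x₁ ∧ ⋯ ∧ xₙ, y₁ ∧ ⋯ ∧ yₘ⟩ = δₙₘ det (⟨xᵢ, yⱼ⟩)`: contract `y` by `x` and take the scalar part. -/
def extInner (x y : ExteriorAlgebra ℂ K) : ℂ :=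
  algebraMapInv (contractBy x y)

theorem extInner_add_l (x x' y : ExteriorAlgebra ℂ K) :
    extInner (x + x') y = extInner x y + extInner x' y := by
  simp [extInner, contractBy_add]

theorem extInner_smul_l (z : ℂ) (x y : ExteriorAlgebra ℂ K) :
    extInner (z • x) y = conj z * extInner x y := by
  simp [extInner, contractBy_smul]

theorem extInner_add_r (x y y' : ExteriorAlgebra ℂ K) :
    extInner x (y + y') = extInner x y + extInner x y' := by
  simp [extInner]

theorem extInner_smul_r (z : ℂ) (x y : ExteriorAlgebra ℂ K) :
    extInner x (z • y) = z * extInner x y := by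
  simp [extInner]

theorem extInner_neg_r (x y : ExteriorAlgebra ℂ K) :
    extInner x (-y) = - extInner x y := by
  simp [extInner]

theorem extInner_sub_r (x y y' : ExteriorAlgebra ℂ K) :
    extInner x (y - y') = extInner x y - extInner x y' := by
  simp [extInner]

theorem extInner_ι_mul (g : K) (x y : ExteriorAlgebra ℂ K) :
    extInner (ι ℂ g * x) y = extInner x (innerContract g y) := by
  simp [extInner, contractBy_ι_mul]

theorem extInner_algebraMap (z : ℂ) (y : ExteriorAlgebra ℂ K) :
    extInner (algebraMap ℂ (ExteriorAlgebra ℂ K) z) y = conj z * algebraMapInv y := by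
  rw [Algebra.algebraMap_eq_smul_one, extInner_smul_l, extInner, contractBy_one]; rfl

theorem extInner_innerContract (g : K) (x y : ExteriorAlgebra ℂ K) :
    extInner (innerContract g x) y = extInner x (ι ℂ g * y) := by
  induction x using CliffordAlgebra.left_induction generalizing y with
  | algebraMap z =>
    have : innerContract g (algebraMap ℂ (ExteriorAlgebra ℂ K) z) = 0 :=
      innerContract_algebraMap g z
    have h0 : extInner (0 : ExteriorAlgebra ℂ K) y = 0 := by
      rw [← zero_smul ℂ (0 : ExteriorAlgebra ℂ K), extInner_smul_l]; simp
    have h1 : (algebraMapInv (ι ℂ g * y) : ℂ) = 0 := by simp [algebraMapInv]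
    change extInner (innerContract g (algebraMap ℂ (ExteriorAlgebra ℂ K) z)) y =
      extInner (algebraMap ℂ (ExteriorAlgebra ℂ K) z) (ι ℂ g * y)
    rw [this, h0, extInner_algebraMap, h1, mul_zero]
  | add a b ha hb => rw [map_add, extInner_add_l, extInner_add_l, ha, hb]
  | ι_mul a h ha =>
    change extInner (innerContract g (ι ℂ h * a)) y = extInner (ι ℂ h * a) (ι ℂ g * y)
    rw [innerContract_ι_mul, extInner_ι_mul, innerContract_ι_mul, extInner_sub_r, extInner_smul_r,
      sub_eq_add_neg, extInner_add_l, extInner_smul_l, ← neg_one_smul ℂ, extInner_smul_l, extInner_ι_mul, ha,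
      inner_conj_symm]
    simp [sub_eq_add_neg]

theorem extInner_conj_symm (x y : ExteriorAlgebra ℂ K) :
    conj (extInner y x) = extInner x y := by
  induction x using CliffordAlgebra.left_induction generalizing y with
  | algebraMap z =>
    erw [extInner_algebraMap]
    induction y using CliffordAlgebra.left_induction with
    | algebraMap w => erw [extInner_algebraMap]; simp [algebraMapInv]; ring
    | add a b ha hb => rw [extInner_add_l, map_add, ha, hb, map_add, mul_add]
    | ι_mul a h _ =>
      have h0 : innerContract h (algebraMap ℂ (ExteriorAlgebra ℂ K) z) = 0 :=
        innerContract_algebraMap h z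
      have h1 : (algebraMapInv (ι ℂ h * a) : ℂ) = 0 := by simp [algebraMapInv]
      erw [extInner_ι_mul, h0, h1]
      simp [extInner]
  | add a b ha hb => rw [extInner_add_l, extInner_add_r, map_add, ha, hb]
  | ι_mul a h ha =>
    change conj (extInner y (ι ℂ h * a)) = extInner (ι ℂ h * a) y
    rw [extInner_ι_mul, ← ha, extInner_innerContract]


theorem innerContract_eq_zero_of_mem_adjoin {s : Set K} {g : K}
    (hg : ∀ h ∈ s, inner ℂ g h = 0) {x : ExteriorAlgebra ℂ K}
    (hx : x ∈ Algebra.adjoin ℂ (ι ℂ '' s)) : innerContract g x = 0 := by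
  suffices H : ∀ y, innerContract g y = 0 → innerContract g (x * y) = 0 by
    simpa using H 1 (by simpa using innerContract_algebraMap g 1)
  induction hx using Algebra.adjoin_induction with
  | mem x hx =>
    obtain ⟨h, hh, rfl⟩ := hx
    intro y hy
    rw [innerContract_ι_mul, hg h hh, hy]; simp
  | algebraMap r =>
    intro y hy
    rw [← Algebra.smul_def, map_smul, hy, smul_zero]
  | add a b _ _ ha hb => intro y hy; rw [add_mul, map_add, ha y hy, hb y hy, add_zero]
  | mul a b _ _ ha hb => intro y hy; rw [mul_assoc]; exact ha _ (hb y hy)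

theorem exists_of_mem_adjoin_insert {s : Set K} {g : K} {x : ExteriorAlgebra ℂ K}
    (hx : x ∈ Algebra.adjoin ℂ (ι ℂ '' (insert g s))) :
    ∃ y ∈ Algebra.adjoin ℂ (ι ℂ '' s), ∃ z ∈ Algebra.adjoin ℂ (ι ℂ '' s),
      x = y + ι ℂ g * z := by
  suffices H : ∀ y ∈ Algebra.adjoin ℂ (ι ℂ '' s), ∀ z ∈ Algebra.adjoin ℂ (ι ℂ '' s),
      ∃ y' ∈ Algebra.adjoin ℂ (ι ℂ '' s), ∃ z' ∈ Algebra.adjoin ℂ (ι ℂ '' s),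
      x * (y + ι ℂ g * z) = y' + ι ℂ g * z' by
    simpa using H 1 (one_mem _) 0 (zero_mem _)
  induction hx using Algebra.adjoin_induction with
  | mem x hx =>
    obtain ⟨h, hh, rfl⟩ := hx
    intro y hy z hz
    rcases hh with rfl | hh
    · exact ⟨0, zero_mem _, y, hy, by rw [mul_add, ← mul_assoc, ι_sq_zero]; simp⟩
    · have hm : ι ℂ h ∈ Algebra.adjoin ℂ (ι ℂ '' s) := Algebra.subset_adjoin ⟨h, hh, rfl⟩
      refine ⟨ι ℂ h * y, mul_mem hm hy, -(ι ℂ h * z), neg_mem (mul_mem hm hz), ?_⟩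
      have := ι_add_mul_swap (R := ℂ) h g
      rw [mul_add, ← mul_assoc, eq_neg_of_add_eq_zero_left this]
      noncomm_ring
  | algebraMap r =>
    intro y hy z hz
    refine ⟨r • y, Subalgebra.smul_mem _ hy r, r • z, Subalgebra.smul_mem _ hz r, ?_⟩
    rw [← Algebra.smul_def]; simp
  | add a b _ _ ha hb =>
    intro y hy z hz
    obtain ⟨y1, hy1, z1, hz1, h1⟩ := ha y hy z hz
    obtain ⟨y2, hy2, z2, hz2, h2⟩ := hb y hy z hz
    exact ⟨_, add_mem hy1 hy2, _, add_mem hz1 hz2, by rw [add_mul, h1, h2]; noncomm_ring⟩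
  | mul a b _ _ ha hb =>
    intro y hy z hz
    obtain ⟨y2, hy2, z2, hz2, h2⟩ := hb y hy z hz
    rw [mul_assoc, h2]
    exact ha _ hy2 _ hz2

theorem extInner_self_adjoin (s : Finset K) (hs : Orthonormal ℂ (fun x : s => (x : K)))
    (x : ExteriorAlgebra ℂ K) (hx : x ∈ Algebra.adjoin ℂ (ι ℂ '' (s : Set K))) :
    0 ≤ RCLike.re (extInner x x) ∧ (extInner x x = 0 → x = 0) := by
  classical
  induction s using Finset.induction_on generalizing x with
  | empty =>
    rw [Finset.coe_empty, Set.image_empty, Algebra.adjoin_empty, Algebra.mem_bot] at hx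
    obtain ⟨z, rfl⟩ := hx
    rw [extInner_algebraMap]
    have : (algebraMapInv (algebraMap ℂ (ExteriorAlgebra ℂ K) z) : ℂ) = z := by
      simp [algebraMapInv]
    rw [this]
    constructor
    · rw [RCLike.conj_mul]; norm_cast; positivity
    · intro h
      have : z = 0 := by simpa using h
      simp [this]
  | insert g s hgs ih =>
    have hs' : Orthonormal ℂ (fun x : s => (x : K)) :=
      hs.comp (fun x : s => (⟨x, Finset.mem_insert_of_mem x.2⟩ : (insert g s : Finset K)))
        (fun a b hab => Subtype.ext (by simpa using hab))
    have hg1 : inner ℂ g g = 1 := by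
      have := hs.1 ⟨g, Finset.mem_insert_self g s⟩
      rw [inner_self_eq_norm_sq_to_K]; simp at this; simp [this]
    have hg0 : ∀ h ∈ (s : Set K), inner ℂ g h = 0 := fun h hh =>
      hs.2 (i := ⟨g, Finset.mem_insert_self g s⟩)
        (j := ⟨h, Finset.mem_insert_of_mem hh⟩) (by rintro ⟨⟩; exact hgs hh)
    rw [Finset.coe_insert] at hx
    obtain ⟨y, hy, z, hz, rfl⟩ := exists_of_mem_adjoin_insert hx
    have cy := innerContract_eq_zero_of_mem_adjoin hg0 hy
    have cz := innerContract_eq_zero_of_mem_adjoin hg0 hz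
    have h0 : extInner z (0 : ExteriorAlgebra ℂ K) = 0 := by simp [extInner]
    have h0' : extInner (0 : ExteriorAlgebra ℂ K) z = 0 := by
      rw [← extInner_conj_symm, h0, map_zero]
    have e : extInner (y + ι ℂ g * z) (y + ι ℂ g * z) = extInner y y + extInner z z := by
      rw [extInner_add_r, extInner_add_l, extInner_add_l, extInner_ι_mul, extInner_ι_mul, cy,
        innerContract_ι_mul, cz, ← extInner_innerContract, cy, hg1, one_smul, mul_zero,
        sub_zero, h0, h0', add_zero, zero_add]
    obtain ⟨py, dy⟩ := ih hs' y hy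
    obtain ⟨pz, dz⟩ := ih hs' z hz
    rw [e]
    constructor
    · rw [map_add]; exact add_nonneg py pz
    · intro h
      have h' := congrArg RCLike.re h
      rw [map_add, map_zero] at h'
      have im0 : ∀ w : ExteriorAlgebra ℂ K, RCLike.im (extInner w w : ℂ) = 0 := fun w =>
        RCLike.conj_eq_iff_im.mp (extInner_conj_symm w w)
      have y0 : extInner y y = 0 := RCLike.ext (by rw [map_zero]; linarith) (by simpa using im0 y)
      have z0 : extInner z z = 0 := RCLike.ext (by rw [map_zero]; linarith) (by simpa using im0 z)
      rw [dy y0, dz z0]; simp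

theorem exists_orthonormal_mem_adjoin (x : ExteriorAlgebra ℂ K) :
    ∃ s : Finset K, Orthonormal ℂ (fun x : s => (x : K)) ∧
      x ∈ Algebra.adjoin ℂ (ι ℂ '' (s : Set K)) := by
  classical
  have hx : ∃ t : Finset K, x ∈ Algebra.adjoin ℂ (ι ℂ '' (t : Set K)) := by
    induction x using ExteriorAlgebra.induction with
    | algebraMap r => exact ⟨∅, Subalgebra.algebraMap_mem _ r⟩
    | ι v => exact ⟨{v}, Algebra.subset_adjoin ⟨v, by simp, rfl⟩⟩
    | mul a b ha hb =>
      obtain ⟨t, ht⟩ := ha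
      obtain ⟨u, hu⟩ := hb
      exact ⟨t ∪ u, mul_mem
        (Algebra.adjoin_mono (Set.image_mono (by simp)) ht)
        (Algebra.adjoin_mono (Set.image_mono (by simp)) hu)⟩
    | add a b ha hb =>
      obtain ⟨t, ht⟩ := ha
      obtain ⟨u, hu⟩ := hb
      exact ⟨t ∪ u, add_mem
        (Algebra.adjoin_mono (Set.image_mono (by simp)) ht)
        (Algebra.adjoin_mono (Set.image_mono (by simp)) hu)⟩
  obtain ⟨t, ht⟩ := hx
  let L := Submodule.span ℂ (t : Set K)
  let b := stdOrthonormalBasis ℂ L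
  let f : Fin (Module.finrank ℂ L) → K := fun i => (b i : K)
  have hf : Orthonormal ℂ f := b.orthonormal.comp_linearIsometry L.subtypeₗᵢ
  refine ⟨Finset.univ.image f, ?_, ?_⟩
  · have := hf.toSubtypeRange
    have e : Set.range f = ((Finset.univ.image f : Finset K) : Set K) := by simp
    rw [e] at this
    exact this
  · refine Algebra.adjoin_le ?_ ht
    rintro _ ⟨v, hv, rfl⟩
    have hv' : v ∈ L := Submodule.subset_span hv
    have : v = ∑ i, b.repr ⟨v, hv'⟩ i • f i := by
      have := congrArg (Subtype.val) (b.sum_repr ⟨v, hv'⟩)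
      simpa [f] using this.symm
    rw [this, map_sum]
    refine sum_mem fun i _ => ?_
    rw [map_smul]
    exact Subalgebra.smul_mem _ (Algebra.subset_adjoin (Set.mem_image_of_mem _ (by simp))) _

/-- The inner product on `⋀K` is positive definite. -/
@[reducible] def innerCore : InnerProductSpace.Core ℂ (ExteriorAlgebra ℂ K) where
  inner x y := extInner x y
  conj_inner_symm := extInner_conj_symm
  re_inner_nonneg x := by
    obtain ⟨s, hs, hx⟩ := exists_orthonormal_mem_adjoin x
    exact (extInner_self_adjoin s hs x hx).1
  add_left := extInner_add_l
  smul_left x y z := extInner_smul_l z x y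
  definite x h := by
    obtain ⟨s, hs, hx⟩ := exists_orthonormal_mem_adjoin x
    exact (extInner_self_adjoin s hs x hx).2 h

instance instNormedAddCommGroup : NormedAddCommGroup (ExteriorAlgebra ℂ K) :=
  InnerProductSpace.Core.toNormedAddCommGroup (𝕜 := ℂ) (cd := innerCore)

instance instInnerProductSpace : InnerProductSpace ℂ (ExteriorAlgebra ℂ K) :=
  InnerProductSpace.ofCore (innerCore (K := K)).toCore

theorem inner_eq_extInner (x y : ExteriorAlgebra ℂ K) : inner ℂ x y = extInner x y := rfl

theorem inner_ι_mul (g : K) (x y : ExteriorAlgebra ℂ K) :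
    inner ℂ (ι ℂ g * x) y = inner ℂ x (innerContract g y) :=
  extInner_ι_mul g x y

theorem inner_innerContract (g : K) (x y : ExteriorAlgebra ℂ K) :
    inner ℂ (innerContract g x) y = inner ℂ x (ι ℂ g * y) :=
  extInner_innerContract g x y

theorem norm_ι_mul_sq_add (g : K) (x : ExteriorAlgebra ℂ K) :
    ‖ι ℂ g * x‖ ^ 2 + ‖innerContract g x‖ ^ 2 = (‖g‖ * ‖x‖) ^ 2 := by
  have h1 : inner ℂ (ι ℂ g * x) (ι ℂ g * x) + inner ℂ (innerContract g x) (innerContract g x)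
      = inner ℂ g g * inner ℂ x x := by
    rw [inner_ι_mul, inner_innerContract, innerContract_ι_mul, inner_sub_right, inner_smul_right]
    ring
  rw [inner_self_eq_norm_sq_to_K (𝕜 := ℂ), inner_self_eq_norm_sq_to_K (𝕜 := ℂ),
    inner_self_eq_norm_sq_to_K (𝕜 := ℂ), inner_self_eq_norm_sq_to_K (𝕜 := ℂ)] at h1
  rw [mul_pow]
  exact_mod_cast h1

/-- Exterior multiplication `g ∧ ·` as a bounded operator. -/
def wedgeL (g : K) : ExteriorAlgebra ℂ K →L[ℂ] ExteriorAlgebra ℂ K :=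
  (LinearMap.mulLeft ℂ (ι ℂ g)).mkContinuous ‖g‖ fun x => by
    refine abs_le_of_sq_le_sq' ?_ (by positivity) |>.2
    have := norm_ι_mul_sq_add g x
    simp only [LinearMap.mulLeft_apply]
    nlinarith [sq_nonneg ‖innerContract g x‖]

/-- Contraction `⟨g, ·⟩⌋` as a bounded operator. -/
def contractL (g : K) : ExteriorAlgebra ℂ K →L[ℂ] ExteriorAlgebra ℂ K :=
  (innerContract g).mkContinuous ‖g‖ fun x => by
    refine abs_le_of_sq_le_sq' ?_ (by positivity) |>.2
    have := norm_ι_mul_sq_add g x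
    nlinarith [sq_nonneg ‖ι ℂ g * x‖]

/-- The parity operator `(-1)^n` on `⋀ⁿK`. -/
def parity : ExteriorAlgebra ℂ K →ₐ[ℂ] ExteriorAlgebra ℂ K :=
  CliffordAlgebra.involute (Q := (0 : QuadraticForm ℂ K))

theorem parity_ι_mul (g : K) (x : ExteriorAlgebra ℂ K) :
    parity (ι ℂ g * x) = - (ι ℂ g * parity x) := by
  rw [map_mul]
  have : parity (ι ℂ g) = - ι ℂ g := CliffordAlgebra.involute_ι g
  rw [this, neg_mul]

theorem parity_innerContract (g : K) (x : ExteriorAlgebra ℂ K) :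
    innerContract g (parity x) = - parity (innerContract g x) := by
  induction x using CliffordAlgebra.left_induction with
  | algebraMap z =>
    change innerContract g (parity (algebraMap ℂ (ExteriorAlgebra ℂ K) z)) =
      - parity (innerContract g (algebraMap ℂ (ExteriorAlgebra ℂ K) z))
    rw [AlgHom.commutes, innerContract_algebraMap]; simp
  | add a b ha hb => simp only [map_add, ha, hb]; abel
  | ι_mul a h ha =>
    change innerContract g (parity (ι ℂ h * a)) = - parity (innerContract g (ι ℂ h * a))
    rw [parity_ι_mul, innerContract_ι_mul, map_neg, innerContract_ι_mul, ha, map_sub,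
      parity_ι_mul, map_smul]
    simp

theorem inner_parity (x y : ExteriorAlgebra ℂ K) :
    inner ℂ (parity x) (parity y) = inner ℂ x y := by
  induction x using CliffordAlgebra.left_induction generalizing y with
  | algebraMap z =>
    change inner ℂ (parity (algebraMap ℂ (ExteriorAlgebra ℂ K) z)) _ =
      inner ℂ (algebraMap ℂ (ExteriorAlgebra ℂ K) z) y
    rw [AlgHom.commutes]
    rw [inner_eq_extInner, inner_eq_extInner, extInner_algebraMap, extInner_algebraMap]
    congr 1
    have : (algebraMapInv : ExteriorAlgebra ℂ K →ₐ[ℂ] ℂ).comp parity = algebraMapInv := by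
      ext v
      have : parity (ι ℂ v) = - ι ℂ v := CliffordAlgebra.involute_ι v
      simp [algebraMapInv, this]
    exact congrArg (fun f : ExteriorAlgebra ℂ K →ₐ[ℂ] ℂ => f y) this
  | add a b ha hb => rw [map_add, inner_add_left, inner_add_left, ha, hb]
  | ι_mul a h ha =>
    change inner ℂ (parity (ι ℂ h * a)) _ = inner ℂ (ι ℂ h * a) y
    rw [parity_ι_mul, inner_neg_left]
    rw [inner_ι_mul, inner_ι_mul, parity_innerContract, inner_neg_right, neg_neg]
    exact ha _

/-- The parity operator as a bounded operator. -/
def parityL : ExteriorAlgebra ℂ K →L[ℂ] ExteriorAlgebra ℂ K :=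
  (LinearMap.isometryOfInner parity.toLinearMap inner_parity).toContinuousLinearMap

end ExteriorAlgebra

/-- The pre-Hilbert space underlying the exterior algebra, `⋀K = ⨁ₙ K^{∧n}` (algebraic sum). -/
def WedgeSpace (K : Type*) [NormedAddCommGroup K] [InnerProductSpace ℂ K] : Type _ :=
  ExteriorAlgebra ℂ K

namespace WedgeSpace

variable {K : Type*} [NormedAddCommGroup K] [InnerProductSpace ℂ K]

instance : NormedAddCommGroup (WedgeSpace K) :=
  inferInstanceAs (NormedAddCommGroup (ExteriorAlgebra ℂ K))

instance : InnerProductSpace ℂ (WedgeSpace K) :=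
  inferInstanceAs (InnerProductSpace ℂ (ExteriorAlgebra ℂ K))

/-- Exterior multiplication `g ∧ ·`. -/
def wedge (g : K) : WedgeSpace K →L[ℂ] WedgeSpace K := ExteriorAlgebra.wedgeL g

/-- Contraction `⟨g, ·⟩⌋`. -/
def contraction (g : K) : WedgeSpace K →L[ℂ] WedgeSpace K := ExteriorAlgebra.contractL g

/-- The parity `(-1)^n` on `K^{∧n}`. -/
def sign : WedgeSpace K →L[ℂ] WedgeSpace K := ExteriorAlgebra.parityL

end WedgeSpace

/-- The free Hamiltonian `H⁰ = γ⁰(-iγ·∇ + m)` in momentum space: `γ⁰(γ·k + m)`. -/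
def hamiltonianSymbol (m : ℝ) (k : Space) : Matrix (Fin 4) (Fin 4) ℂ :=
  gammaMat 0 * ((k 0 : ℂ) • gammaMat 1 + (k 1 : ℂ) • gammaMat 2 + (k 2 : ℂ) • gammaMat 3 +
    (m : ℂ) • 1)

/-- The relativistic energy `√(|k|² + m²)`. -/
def energy (m : ℝ) (k : Space) : ℝ := √(‖k‖ ^ 2 + m ^ 2)

/-- The negative energy subspace `H⁻ ⊂ L²({0} × ℝ³, ℂ⁴)` of `H⁰`: at almost every momentum `k` the
Fourier transform is an eigenvector of `γ⁰(γ·k + m)` with eigenvalue `-√(|k|² + m²)`. In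
Mathlib's normalization, the frequency `p` corresponds to the momentum `k = 2πp`. -/
def negativeEnergy (m : ℝ) : Submodule ℂ (DiracSpace flatSurface) where
  carrier := {φ | ∃ f : Lp Spinor 2 (volume : Measure Space), f =ᵐ[volume] φ.field ∧
    ∀ᵐ p ∂(volume : Measure Space),
      spinAct (hamiltonianSymbol m ((2 * Real.pi) • p)) (Lp.fourierTransformₗᵢ Space Spinor f p) =
        -(energy m ((2 * Real.pi) • p) : ℂ) • Lp.fourierTransformₗᵢ Space Spinor f p}
  zero_mem' := by
    refine ⟨0, ?_, ?_⟩
    · filter_upwards [Lp.coeFn_zero Spinor 2 (volume : Measure Space),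
        AEEqFun.coeFn_zero (μ := (volume : Measure Space)) (β := Spinor)] with x h1 h2
      exact h1.trans h2.symm
    · rw [map_zero]
      filter_upwards [Lp.coeFn_zero Spinor 2 (volume : Measure Space)] with p hp
      rw [hp]; simp [spinAct]
  add_mem' := by
    rintro φ ψ ⟨f, hf, hf'⟩ ⟨g, hg, hg'⟩
    refine ⟨f + g, ?_, ?_⟩
    · filter_upwards [Lp.coeFn_add f g, AEEqFun.coeFn_add φ.field ψ.field, hf, hg]
        with x h1 h2 h3 h4
      rw [DiracSpace.field_add, h1, h2, Pi.add_apply, Pi.add_apply, h3, h4]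
    · rw [map_add]
      filter_upwards [Lp.coeFn_add (Lp.fourierTransformₗᵢ Space Spinor f)
        (Lp.fourierTransformₗᵢ Space Spinor g), hf', hg'] with p h1 h2 h3
      rw [h1, Pi.add_apply, spinAct_add, h2, h3, smul_add]
  smul_mem' := by
    rintro z φ ⟨f, hf, hf'⟩
    refine ⟨z • f, ?_, ?_⟩
    · filter_upwards [Lp.coeFn_smul z f, AEEqFun.coeFn_smul z φ.field, hf] with x h1 h2 h3
      rw [DiracSpace.field_smul, h1, h2, Pi.smul_apply, Pi.smul_apply, h3]
    · rw [map_smul]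
      filter_upwards [Lp.coeFn_smul z (Lp.fourierTransformₗᵢ Space Spinor f), hf'] with p h1 h2
      rw [h1, Pi.smul_apply, spinAct_smul, h2, smul_comm]

/-- `ψ` is a smooth solution of the Dirac equation `(i∂̸ - m)ψ = e A̸ ψ` with spatially compact
support: its support meets every Cauchy surface in a compact set. -/
structure IsDiracSolution (m e : ℝ) (A : Spacetime → Fin 4 → ℝ) (ψ : Spacetime → Spinor) :
    Prop where
  smooth : ContDiff ℝ ∞ ψ
  dirac : ∀ x, ∑ μ : Fin 4, Complex.I • spinAct (gammaMat μ) (fderiv ℝ ψ x (Pi.single μ 1)) -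
    (m : ℂ) • ψ x = (e : ℂ) • spinAct (∑ μ : Fin 4, (A x μ : ℂ) • gammaMat μ) (ψ x)
  compact : ∀ S : CauchySurface, IsCompact (tsupport ψ ∩ S.carrier)

/-- The pairs `(ψ|_Σ, ψ|_Σ')` of restrictions of solutions of the Dirac equation. -/
def solutionPairs (m e : ℝ) (A : Spacetime → Fin 4 → ℝ) (S S' : CauchySurface) :
    Set (DiracSpace S × DiracSpace S') :=
  {p | ∃ ψ, IsDiracSolution m e A ψ ∧ p.1.field =ᵐ[volume] (fun x => ψ (S.chart x)) ∧
    p.2.field =ᵐ[volume] (fun x => ψ (S'.chart x))}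

/-- `U` is the unitary extension of the map `ψ|_Σ ↦ ψ|_Σ'`, for solutions `ψ`: its graph is the
closure of the graph of that map. -/
def IsDiracEvolution (m e : ℝ) (A : Spacetime → Fin 4 → ℝ) (S S' : CauchySurface)
    (U : DiracSpace S ≃ₗᵢ[ℂ] DiracSpace S') : Prop :=
  closure (solutionPairs m e A S S') = {p | p.2 = U p.1}

open Classical in
/-- The one-particle Dirac evolution `U^A_{Σ'Σ} : H_Σ → H_Σ'`. -/
def diracEvolution (m e : ℝ) (A : Spacetime → Fin 4 → ℝ) (S S' : CauchySurface) :
    DiracSpace S →L[ℂ] DiracSpace S' :=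
  if h : ∃ U, IsDiracEvolution m e A S S' U then
    (h.choose.toContinuousLinearEquiv : DiracSpace S →L[ℂ] DiracSpace S')
  else 0

/-- The standard polarization `H_Σ⁻` of `H_Σ`: the negative energy subspace on `{x⁰ = 0}`,
transported to `Σ` by the free Dirac evolution. -/
def standardPolarization (m : ℝ) (S : CauchySurface) : Submodule ℂ (DiracSpace S) :=
  (negativeEnergy m).map (diracEvolution m 0 0 flatSurface S : DiracSpace flatSurface →ₗ[ℂ] _)

section Polarizations

variable {H H' : Type*} [NormedAddCommGroup H] [InnerProductSpace ℂ H] [CompleteSpace H]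
  [NormedAddCommGroup H'] [InnerProductSpace ℂ H'] [CompleteSpace H']

/-- `Pol(H)`: the closed subspaces `V` of `H` such that `V` and `Vᗮ` are infinite dimensional. -/
def Pol (H : Type*) [NormedAddCommGroup H] [InnerProductSpace ℂ H] :
    Set (ClosedSubmodule ℂ H) :=
  {V | ¬ FiniteDimensional ℂ V.toSubmodule ∧ ¬ FiniteDimensional ℂ V.toSubmoduleᗮ}

/-- Hilbert-Schmidt operators. -/
def IsHilbertSchmidt (T : H →L[ℂ] H') : Prop :=
  ∃ (w : Set H) (b : HilbertBasis w ℂ H), Summable fun i => ‖T (b i)‖ ^ 2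

/-- The Fock space `F(V) = ⨁_{c ∈ ℤ} ⨁_{c = m - n} (Vᗮ)^{∧n} ⊗ V̄^{∧m}`: the Hilbert space
completion of `⋀(Vᗮ) ⊗ ⋀(V̄)`, that is, the Hilbert sum of the spaces
`(Vᗮ)^{∧n} ⊗ V̄^{∧m}` over all `n` and `m`. -/
abbrev FockSpace (V : ClosedSubmodule ℂ H) : Type _ :=
  UniformSpace.Completion
    (WedgeSpace V.toSubmoduleᗮ ⊗[ℂ] WedgeSpace (ConjSpace V.toSubmodule))

/-- The creation operator `a*(f) = b*(Pᗮ f) + c*(P f)` on `F(V)`, where `P` projects onto `V`: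
`b*(g)` is the exterior multiplication `g ∧ · ` on `⋀(Vᗮ)`, and `c*(g)` annihilates
the hole `g`, i.e. it is the contraction with `g ∈ V̄` on `⋀(V̄)` together with the sign
`(-1)^n` on `(Vᗮ)^{∧n}`, which makes it anticommute with `b*`. -/
def creation (V : ClosedSubmodule ℂ H) (f : H) : FockSpace V →L[ℂ] FockSpace V :=
  ContinuousLinearMap.completion
    (TensorProduct.mapL
        (WedgeSpace.wedge (V.toSubmoduleᗮ.orthogonalProjectionOnto f))
        (ContinuousLinearMap.id ℂ (WedgeSpace (ConjSpace V.toSubmodule))) +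
      TensorProduct.mapL (WedgeSpace.sign (K := V.toSubmoduleᗮ))
        (WedgeSpace.contraction (ConjSpace.mk (V.toSubmodule.orthogonalProjectionOnto f))))

/-- The lift condition `Ũ a*(f) Ũ⁻¹ = a*(U f)` for all `f ∈ H`. -/
def IsLift (V : ClosedSubmodule ℂ H) (W : ClosedSubmodule ℂ H') (U : H →L[ℂ] H')
    (L : FockSpace V ≃ₗᵢ[ℂ] FockSpace W) : Prop :=
  ∀ f : H, ∀ Φ : FockSpace W, L (creation V f (L.symm Φ)) = creation W (U f) Φ

end Polarizations

/-- `Σ_in` is a Cauchy surface in the remote past of the potential: `supp A` does not meet `Σ_in`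
and lies in its causal future. -/
def CauchySurface.IsInitialFor (Sin : CauchySurface) (A : Spacetime → Fin 4 → ℝ) : Prop :=
  tsupport A ∩ Sin.carrier = ∅ ∧
    ∀ x ∈ tsupport A, ∃ y ∈ Sin.carrier, 0 ≤ (x - y) 0 ∧ 0 ≤ minkowskiSq (x - y)

/-- The polarization class `C_Σ(A)`: the polarizations `W` of `H_Σ` such that the difference of the
orthogonal projections onto `W` and onto `U^A_{Σ Σ_in} H⁻_{Σ_in}` is Hilbert-Schmidt. -/
def polarizationClass (m e : ℝ) (A : Spacetime → Fin 4 → ℝ) (Sin S : CauchySurface) :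
    Set (ClosedSubmodule ℂ (DiracSpace S)) :=
  {W | W ∈ Pol (DiracSpace S) ∧ IsHilbertSchmidt (W.toSubmodule.starProjection -
    ((standardPolarization m Sin).map
      (diracEvolution m e A Sin S : DiracSpace Sin →ₗ[ℂ] DiracSpace S)
        ).topologicalClosure.starProjection)}

end

/-!
The proof separates into a statement about Fock spaces, in which the Dirac evolution enters as an
arbitrary unitary map `U`, and the construction of the evolution itself.

*Fock spaces.* The creation operators on the Fock space of `V` form an irreducible representation of
the canonical anticommutation relations with a vacuum vector, and these properties characterize it:
in any irreducible representation, a unit vector annihilated by the annihilation operators of `Vᗮ`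
and by the creation operators of `V` generates a copy of the Fock space
(`IsCAR.isFockModel_productState`, `IsFockModel.exists_intertwiner`). Irreducibility in the form of
Schur's lemma (`IsFockModel.eq_smul_of_commute`) follows from the uniqueness of the vacuum, and gives
the uniqueness of the lift up to a phase. For its existence one needs a vacuum vector of `V` for the
creation operators `f ↦ a*(U f)` on the Fock space of `W`. The annihilators of an orthonormal basis
of `Vᗮ` and the creators of one of `V` are fermionic modes. Their total occupation in the vacuum of
`W` is the squared Hilbert-Schmidt norm of `P^W U - U P^V`, and if a total occupation is finite in
some state, then there is a state in which all modes are empty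
(`IsFermionic.exists_common_kernel`). The result is `exists_lift_unique`. The Hilbert-Schmidt
condition holds because `V` and `W` are close to the reference polarizations of the two surfaces, and
`U` maps one of these to the other, by the composition law of the evolution
(`isHilbertSchmidt_off_diagonal`, `diracEvolution_comp`).

*The evolution.* The relation between the traces on `Σ` and on `Σ'` of the spatially compact smooth
solutions is isometric, because the Dirac current is conserved (`flux_height_eq`). It is the graph of
a unitary map, up to closure, if the traces of solutions are dense in `H_Σ` for every Cauchy surface
`Σ` (`dense_traces`). For the density, a compactly supported field `g` with prescribed values on `Σ`
is corrected to a solution: its source is cut along a thin layer above `Σ`, the part above is removed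
by a retarded solution, which vanishes on `Σ`, and the part below by an advanced solution, which on
`Σ` only feels the layer and is small by an energy estimate (`exists_solution_near`). So the Cauchy
problem is never solved exactly, and no coordinates adapted to `Σ` are needed beyond the graph
representation `x⁰ = h(x)` with `h` of class `C¹` (`CauchySurface.contDiff_height`).

Retarded solutions come from the Fourier transform on space-time. After conjugation with
`exp (l x⁰)` the free Dirac operator has an accretive symbol with inverse bounded by `l⁻¹`, while the
compactly supported potential acts as convolution with an integrable function; for large `l` the
Neumann series converges, in all weighted `L¹`-norms (`exists_neumannSeries`). The solution obtained
decays like `exp (l x⁰)` in the past (`exists_decaying_solution`), which by the energy inequality in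
backward light cones makes it vanish wherever no source is in its causal past (`eq_zero_of_decay`).
-/

noncomputable section

set_option linter.unusedSectionVars false

/-! ### The exterior algebra as a fermionic Fock space -/

namespace WedgeSpace

variable {K : Type*} [NormedAddCommGroup K] [InnerProductSpace ℂ K]

/-- The vacuum `1 ∈ ⋀⁰K`. -/
def vac : WedgeSpace K := (1 : ExteriorAlgebra ℂ K)

/-- The exterior algebra is spanned by the vectors `g₁ ∧ ⋯ ∧ gₙ`, which arise from the vacuum by
repeated exterior multiplication. -/
theorem induction {p : WedgeSpace K → Prop} (hvac : p vac) (hadd : ∀ x y, p x → p y → p (x + y))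
    (hsmul : ∀ (z : ℂ) x, p x → p (z • x)) (hwedge : ∀ g x, p x → p (wedge g x))
    (x : WedgeSpace K) : p x := by
  induction x using CliffordAlgebra.left_induction with
  | algebraMap z =>
    have : p (z • (vac : WedgeSpace K)) := hsmul z _ hvac
    have e : algebraMap ℂ (ExteriorAlgebra ℂ K) z = z • (1 : ExteriorAlgebra ℂ K) :=
      Algebra.algebraMap_eq_smul_one z
    change p (algebraMap ℂ (ExteriorAlgebra ℂ K) z : ExteriorAlgebra ℂ K)
    rw [e]
    exact this
  | add a b ha hb => exact hadd _ _ ha hb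
  | ι_mul a g ha => exact hwedge g a ha

theorem wedge_add (g h : K) (x : WedgeSpace K) : wedge (g + h) x = wedge g x + wedge h x := by
  let y : ExteriorAlgebra ℂ K := x
  change ExteriorAlgebra.ι ℂ (g + h) * y = ExteriorAlgebra.ι ℂ g * y + ExteriorAlgebra.ι ℂ h * y
  rw [map_add, add_mul]

theorem wedge_smul (z : ℂ) (g : K) (x : WedgeSpace K) : wedge (z • g) x = z • wedge g x := by
  let y : ExteriorAlgebra ℂ K := x
  change ExteriorAlgebra.ι ℂ (z • g) * y = z • (ExteriorAlgebra.ι ℂ g * y)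
  rw [map_smul, smul_mul_assoc]

theorem contraction_add (g h : K) (x : WedgeSpace K) :
    contraction (g + h) x = contraction g x + contraction h x := by
  change ExteriorAlgebra.innerContract (g + h) _ = _
  simp only [ExteriorAlgebra.innerContract, map_add]; rfl

theorem contraction_smul (z : ℂ) (g : K) (x : WedgeSpace K) :
    contraction (z • g) x = conj z • contraction g x := by
  change ExteriorAlgebra.innerContract (z • g) _ = _
  simp only [ExteriorAlgebra.innerContract, map_smulₛₗ]
  rfl

theorem wedge_wedge (g h : K) (x : WedgeSpace K) :
    wedge g (wedge h x) = - wedge h (wedge g x) := by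
  let y : ExteriorAlgebra ℂ K := x
  change ExteriorAlgebra.ι ℂ g * (ExteriorAlgebra.ι ℂ h * y) =
    - (ExteriorAlgebra.ι ℂ h * (ExteriorAlgebra.ι ℂ g * y))
  rw [← mul_assoc, ← mul_assoc, eq_neg_of_add_eq_zero_left (ExteriorAlgebra.ι_add_mul_swap g h),
    neg_mul]

theorem contraction_contraction (g h : K) (x : WedgeSpace K) :
    contraction g (contraction h x) = - contraction h (contraction g x) := by
  have hs : ∀ g : K, contraction g (contraction g x) = 0 := fun g =>
    ExteriorAlgebra.innerContract_innerContract g x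
  have h1 := hs (g + h)
  simp only [contraction_add, map_add, hs, zero_add, add_zero] at h1
  exact eq_neg_of_add_eq_zero_left (by rw [add_comm, h1])

theorem contraction_wedge (g h : K) (x : WedgeSpace K) :
    contraction g (wedge h x) = inner ℂ g h • x - wedge h (contraction g x) :=
  ExteriorAlgebra.innerContract_ι_mul g h x

theorem contraction_vac (g : K) : contraction g (vac : WedgeSpace K) = 0 := by
  have := ExteriorAlgebra.innerContract_algebraMap g 1
  rw [map_one] at this
  exact this

theorem sign_wedge (g : K) (x : WedgeSpace K) : sign (wedge g x) = - wedge g (sign x) :=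
  ExteriorAlgebra.parity_ι_mul g x

theorem sign_contraction (g : K) (x : WedgeSpace K) :
    sign (contraction g x) = - contraction g (sign x) := by
  have := ExteriorAlgebra.parity_innerContract g x
  exact (neg_eq_iff_eq_neg.2 this).symm

theorem sign_vac : sign (vac : WedgeSpace K) = vac := map_one ExteriorAlgebra.parity

theorem sign_sign (x : WedgeSpace K) : sign (sign x) = x :=
  CliffordAlgebra.involute_involute (Q := (0 : QuadraticForm ℂ K)) x

theorem inner_wedge (g : K) (x y : WedgeSpace K) :
    inner ℂ (wedge g x) y = inner ℂ x (contraction g y) :=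
  ExteriorAlgebra.inner_ι_mul g x y

theorem inner_contraction (g : K) (x y : WedgeSpace K) :
    inner ℂ (contraction g x) y = inner ℂ x (wedge g y) :=
  ExteriorAlgebra.inner_innerContract g x y

theorem inner_sign (x y : WedgeSpace K) : inner ℂ (sign x) y = inner ℂ x (sign y) := by
  have : inner ℂ (sign x) (sign (sign y)) = inner ℂ x (sign y) :=
    ExteriorAlgebra.inner_parity x (sign y)
  rwa [sign_sign] at this

theorem inner_vac_vac : inner ℂ (vac : WedgeSpace K) vac = 1 := by
  change ExteriorAlgebra.extInner (1 : ExteriorAlgebra ℂ K) 1 = 1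
  have := ExteriorAlgebra.extInner_algebraMap (K := K) 1 1
  simpa using this

end WedgeSpace

/-! ### Representations of the canonical anticommutation relations -/

section CAR

variable {H F : Type*} [NormedAddCommGroup H] [InnerProductSpace ℂ H]
  [NormedAddCommGroup F] [InnerProductSpace ℂ F] [CompleteSpace F]

open ContinuousLinearMap in
/-- `c` is a representation of the canonical anticommutation relations over `H` by creation
operators `c f` on `F`. The annihilation operators are their adjoints. -/
structure IsCAR (c : H → F →L[ℂ] F) : Prop where
  add : ∀ f g, c (f + g) = c f + c g
  smul : ∀ (z : ℂ) f, c (z • f) = z • c f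
  anticomm : ∀ f g Φ, c f (c g Φ) = - c g (c f Φ)
  car : ∀ f g Φ, adjoint (c f) (c g Φ) = inner ℂ f g • Φ - c g (adjoint (c f) Φ)

theorem eq_zero_of_eq_neg_self {x : F} (h : x = -x) : x = 0 := by
  have h2 : (2 : ℂ) • x = 0 := by
    rw [two_smul]
    nth_rewrite 2 [h]
    rw [add_neg_cancel]
  simpa using h2

namespace IsCAR

open ContinuousLinearMap

variable {c : H → F →L[ℂ] F} (hc : IsCAR c)
include hc

theorem adjoint_anticomm (f g : H) (Φ : F) :
    adjoint (c f) (adjoint (c g) Φ) = - adjoint (c g) (adjoint (c f) Φ) := by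
  refine ext_inner_left ℂ fun v => ?_
  rw [adjoint_inner_right, adjoint_inner_right, inner_neg_right, adjoint_inner_right,
    adjoint_inner_right, hc.anticomm, inner_neg_left]

theorem sq_zero (f : H) (Φ : F) : c f (c f Φ) = 0 := by
  exact eq_zero_of_eq_neg_self (hc.anticomm f f Φ)

theorem adjoint_sq_zero (f : H) (Φ : F) : adjoint (c f) (adjoint (c f) Φ) = 0 :=
  eq_zero_of_eq_neg_self (hc.adjoint_anticomm f f Φ)

theorem adjoint_add (f g : H) : adjoint (c (f + g)) = adjoint (c f) + adjoint (c g) := by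
  rw [hc.add, map_add]

theorem adjoint_smul (z : ℂ) (f : H) : adjoint (c (z • f)) = conj z • adjoint (c f) := by
  rw [hc.smul, map_smulₛₗ]

/-- The relation `c f ∘ (c f)† + (c f)† ∘ c f = ‖f‖²` in a state `Φ`; it is the source of all bounds
on creation and annihilation operators. -/
theorem norm_sq_add (f : H) (Φ : F) :
    ‖c f Φ‖ ^ 2 + ‖adjoint (c f) Φ‖ ^ 2 = (‖f‖ * ‖Φ‖) ^ 2 := by
  have h1 : inner ℂ (c f Φ) (c f Φ) + inner ℂ (adjoint (c f) Φ) (adjoint (c f) Φ) =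
      inner ℂ f f * inner ℂ Φ Φ := by
    rw [← adjoint_inner_right, hc.car, adjoint_inner_left, inner_sub_right, inner_smul_right]
    ring
  rw [inner_self_eq_norm_sq_to_K (𝕜 := ℂ), inner_self_eq_norm_sq_to_K (𝕜 := ℂ),
    inner_self_eq_norm_sq_to_K (𝕜 := ℂ), inner_self_eq_norm_sq_to_K (𝕜 := ℂ)] at h1
  rw [mul_pow]
  exact_mod_cast h1

theorem norm_apply_le (f : H) (Φ : F) : ‖c f Φ‖ ≤ ‖f‖ * ‖Φ‖ := by
  refine abs_le_of_sq_le_sq' ?_ (by positivity) |>.2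
  have := hc.norm_sq_add f Φ
  nlinarith [sq_nonneg ‖adjoint (c f) Φ‖]

theorem norm_adjoint_apply_le (f : H) (Φ : F) : ‖adjoint (c f) Φ‖ ≤ ‖f‖ * ‖Φ‖ := by
  refine abs_le_of_sq_le_sq' ?_ (by positivity) |>.2
  have := hc.norm_sq_add f Φ
  nlinarith [sq_nonneg ‖c f Φ‖]

/-- The vectors whose creation operator annihilates `Φ` form a closed subspace. -/
def killCreation (Φ : F) : Submodule ℂ H where
  carrier := {f | c f Φ = 0}
  zero_mem' := by
    have := hc.smul 0 0
    rw [zero_smul, zero_smul] at this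
    simp [this]
  add_mem' {f g} hf hg := by
    simp only [Set.mem_ofPred_eq] at hf hg ⊢
    rw [hc.add, _root_.add_apply, hf, hg, add_zero]
  smul_mem' z f hf := by
    simp only [Set.mem_ofPred_eq] at hf ⊢
    rw [hc.smul, _root_.smul_apply, hf, smul_zero]

/-- The vectors whose annihilation operator annihilates `Φ` form a closed subspace. -/
def killAnnihilation (Φ : F) : Submodule ℂ H where
  carrier := {f | adjoint (c f) Φ = 0}
  zero_mem' := by
    have := hc.adjoint_smul 0 0
    rw [zero_smul, map_zero, zero_smul] at this
    simp [this]
  add_mem' {f g} hf hg := by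
    simp only [Set.mem_ofPred_eq] at hf hg ⊢
    rw [hc.adjoint_add, _root_.add_apply, hf, hg, add_zero]
  smul_mem' z f hf := by
    simp only [Set.mem_ofPred_eq] at hf ⊢
    rw [hc.adjoint_smul, _root_.smul_apply, hf, smul_zero]

theorem continuous_apply_vector (Φ : F) : Continuous fun f => c f Φ := by
  refine (LipschitzWith.of_dist_le_mul (K := ‖Φ‖₊) fun f g => ?_).continuous
  have e : c f Φ - c g Φ = c (f - g) Φ := by
    have h := hc.add (f - g) g
    rw [sub_add_cancel] at h
    rw [h]; simp
  rw [dist_eq_norm, dist_eq_norm, e, mul_comm]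
  exact hc.norm_apply_le _ _

theorem continuous_adjoint_apply_vector (Φ : F) : Continuous fun f => adjoint (c f) Φ := by
  refine (LipschitzWith.of_dist_le_mul (K := ‖Φ‖₊) fun f g => ?_).continuous
  have e : adjoint (c f) Φ - adjoint (c g) Φ = adjoint (c (f - g)) Φ := by
    have h := hc.adjoint_add (f - g) g
    rw [sub_add_cancel] at h
    rw [h]; simp
  rw [dist_eq_norm, dist_eq_norm, e, mul_comm]
  exact hc.norm_adjoint_apply_le _ _

theorem isClosed_killCreation (Φ : F) : IsClosed (hc.killCreation Φ : Set H) :=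
  isClosed_eq (hc.continuous_apply_vector Φ) continuous_const

theorem isClosed_killAnnihilation (Φ : F) : IsClosed (hc.killAnnihilation Φ : Set H) :=
  isClosed_eq (hc.continuous_adjoint_apply_vector Φ) continuous_const

/-- Bogoliubov transformations by isometries preserve the anticommutation relations. -/
theorem comp {H' : Type*} [NormedAddCommGroup H'] [InnerProductSpace ℂ H'] (U : H' →ₗᵢ[ℂ] H) :
    IsCAR fun f => c (U f) where
  add f g := by rw [map_add, hc.add]
  smul z f := by rw [map_smul, hc.smul]
  anticomm f g Φ := hc.anticomm _ _ _
  car f g Φ := by rw [hc.car, LinearIsometry.inner_map_map]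

end IsCAR

/-- `Φ` is a vacuum vector for the polarization `V`: it is annihilated by the annihilation operators
of the particle states in `Vᗮ` and by the creation operators of the states in the sea `V`. -/
structure IsVacuum (c : H → F →L[ℂ] F) (V : Submodule ℂ H) (Φ : F) : Prop where
  particle : ∀ f ∈ Vᗮ, ContinuousLinearMap.adjoint (c f) Φ = 0
  sea : ∀ f ∈ V, c f Φ = 0

end CAR

/-! ### Fock representations -/

section FockModel

open ContinuousLinearMap

variable {H : Type*} [NormedAddCommGroup H] [InnerProductSpace ℂ H] [CompleteSpace H]
  {V : ClosedSubmodule ℂ H}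

/-- The component of `f` along `Vᗮ`. -/
def particlePart (V : ClosedSubmodule ℂ H) (f : H) : V.toSubmoduleᗮ :=
  V.toSubmoduleᗮ.orthogonalProjectionOnto f

/-- The component of `f` along `V`, as an element of the conjugate space. -/
def holePart (V : ClosedSubmodule ℂ H) (f : H) : ConjSpace V.toSubmodule :=
  ConjSpace.mk (V.toSubmodule.orthogonalProjectionOnto f)

theorem particlePart_add (f g : H) :
    particlePart V (f + g) = particlePart V f + particlePart V g :=
  map_add V.toSubmoduleᗮ.orthogonalProjectionOnto f g

theorem particlePart_smul (z : ℂ) (f : H) : particlePart V (z • f) = z • particlePart V f :=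
  map_smul V.toSubmoduleᗮ.orthogonalProjectionOnto z f

theorem holePart_add (f g : H) : holePart V (f + g) = holePart V f + holePart V g :=
  map_add V.toSubmodule.orthogonalProjectionOnto f g

theorem holePart_smul (z : ℂ) (f : H) : holePart V (z • f) = conj z • holePart V f := by
  change V.toSubmodule.orthogonalProjectionOnto (z • f) =
    conj (conj z) • V.toSubmodule.orthogonalProjectionOnto f
  rw [map_smul, RCLike.conj_conj]

theorem inner_parts (f g : H) : inner ℂ (particlePart V f) (particlePart V g) +
    inner ℂ (holePart V g) (holePart V f) = inner ℂ f g := by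
  have e1 : inner ℂ (particlePart V f) (particlePart V g) = inner ℂ f (particlePart V g : H) :=
    Submodule.inner_orthogonalProjectionOnto_eq_of_mem_right _ _
  have e2 : inner ℂ (holePart V g) (holePart V f) =
      inner ℂ f (V.toSubmodule.orthogonalProjectionOnto g : H) :=
    Submodule.inner_orthogonalProjectionOnto_eq_of_mem_right _ _
  have hg : (V.toSubmodule.orthogonalProjectionOnto g : H) +
      (V.toSubmoduleᗮ.orthogonalProjectionOnto g : H) = g :=
    V.toSubmodule.starProjection_add_starProjection_orthogonal g
  rw [e1, e2, ← inner_add_right, add_comm, particlePart, hg]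

theorem add_parts (f : H) :
    (particlePart V f : H) + ((holePart V f).out : H) = f := by
  rw [add_comm]
  exact V.toSubmodule.starProjection_add_starProjection_orthogonal f

theorem particlePart_of_mem {f : H} (hf : f ∈ V.toSubmodule) : particlePart V f = 0 := by
  rw [particlePart, Submodule.orthogonalProjectionOnto_eq_zero_iff]
  exact Submodule.le_orthogonal_orthogonal _ hf

theorem holePart_of_mem {f : H} (hf : f ∈ V.toSubmoduleᗮ) : holePart V f = 0 := by
  have : V.toSubmodule.orthogonalProjectionOnto f = 0 := by
    rwa [Submodule.orthogonalProjectionOnto_eq_zero_iff]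
  exact this

theorem particlePart_coe (g : V.toSubmoduleᗮ) : particlePart V (g : H) = g :=
  Submodule.orthogonalProjectionOnto_mem_subspace_eq_self g

theorem holePart_coe (g : V.toSubmodule) : holePart V (g : H) = ConjSpace.mk g := by
  rw [holePart, Submodule.orthogonalProjectionOnto_mem_subspace_eq_self g]

theorem WedgeSpace.wedge_zero {K : Type*} [NormedAddCommGroup K] [InnerProductSpace ℂ K]
    (x : WedgeSpace K) : wedge 0 x = 0 := by
  simpa using wedge_smul 0 0 x

theorem WedgeSpace.contraction_zero {K : Type*} [NormedAddCommGroup K] [InnerProductSpace ℂ K]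
    (x : WedgeSpace K) : contraction 0 x = 0 := by
  simpa using contraction_smul 0 0 x

variable {E : Type*} [NormedAddCommGroup E] [InnerProductSpace ℂ E] [CompleteSpace E]

/-- `E`, with the operators `c f` and `a f`, is a completion of `⋀(Vᗮ) ⊗ ⋀(V̄)` with the creation
and annihilation operators of the Fock space of `V`; `T x y` is the product state `x ⊗ y`. -/
structure IsFockModel (T : WedgeSpace V.toSubmoduleᗮ →ₗ[ℂ]
    WedgeSpace (ConjSpace V.toSubmodule) →ₗ[ℂ] E) (c a : H → E →L[ℂ] E) : Prop where
  inner_tmul : ∀ x y x' y', inner ℂ (T x y) (T x' y') = inner ℂ x x' * inner ℂ y y'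
  dense : (Submodule.span ℂ {Φ | ∃ x y, Φ = T x y}).topologicalClosure = ⊤
  creation_tmul : ∀ f x y, c f (T x y) = T (WedgeSpace.wedge (particlePart V f) x) y +
    T (WedgeSpace.sign x) (WedgeSpace.contraction (holePart V f) y)
  annihilation_tmul : ∀ f x y, a f (T x y) = T (WedgeSpace.contraction (particlePart V f) x) y +
    T (WedgeSpace.sign x) (WedgeSpace.wedge (holePart V f) y)

namespace IsFockModel

variable {T : WedgeSpace V.toSubmoduleᗮ →ₗ[ℂ] WedgeSpace (ConjSpace V.toSubmodule) →ₗ[ℂ] E}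
  {c a : H → E →L[ℂ] E} (hT : IsFockModel T c a)
include hT

theorem induction {p : E → Prop} (hcl : IsClosed {Φ | p Φ})
    (hadd : ∀ Φ Ψ, p Φ → p Ψ → p (Φ + Ψ)) (hsmul : ∀ (z : ℂ) Φ, p Φ → p (z • Φ))
    (htmul : ∀ x y, p (T x y)) (Φ : E) : p Φ := by
  have hmem : Φ ∈ (Submodule.span ℂ {Φ | ∃ x y, Φ = T x y}).topologicalClosure := by
    rw [hT.dense]; trivial
  refine closure_minimal (t := {Φ | p Φ}) ?_ hcl hmem
  intro Ψ hΨ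
  induction hΨ using Submodule.span_induction with
  | mem Ψ h => obtain ⟨x, y, rfl⟩ := h; exact htmul x y
  | zero => simpa using htmul 0 0
  | add Φ Ψ _ _ h h' => exact hadd _ _ h h'
  | smul z Ψ _ h => exact hsmul z Ψ h

theorem inner_annihilation_left (f : H) (Φ Ψ : E) :
    inner ℂ (a f Φ) Ψ = inner ℂ Φ (c f Ψ) := by
  induction Φ using hT.induction with
  | hcl => exact isClosed_eq (by fun_prop) (by fun_prop)
  | hadd Φ Φ' h h' => rw [map_add, inner_add_left, inner_add_left, h, h']
  | hsmul z Φ h => rw [map_smul, inner_smul_left, inner_smul_left, h]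
  | htmul x y =>
    induction Ψ using hT.induction with
    | hcl => exact isClosed_eq (by fun_prop) (by fun_prop)
    | hadd Ψ Ψ' h h' => rw [map_add, inner_add_right, inner_add_right, h, h']
    | hsmul z Ψ h => rw [map_smul, inner_smul_right, inner_smul_right, h]
    | htmul x' y' =>
      rw [hT.annihilation_tmul, hT.creation_tmul, inner_add_left, inner_add_right,
        hT.inner_tmul, hT.inner_tmul, hT.inner_tmul, hT.inner_tmul, WedgeSpace.inner_contraction,
        WedgeSpace.inner_sign, WedgeSpace.inner_wedge]

theorem adjoint_creation (f : H) : adjoint (c f) = a f :=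
  ((eq_adjoint_iff _ _).2 fun Φ Ψ => hT.inner_annihilation_left f Φ Ψ).symm

theorem isCAR : IsCAR c where
  add f g := by
    ext Φ
    rw [_root_.add_apply]
    induction Φ using hT.induction with
    | hcl => exact isClosed_eq (by fun_prop) (by fun_prop)
    | hadd Φ Φ' h h' => simp only [map_add, h, h']; abel
    | hsmul z Φ h => simp only [map_smul, h, smul_add]
    | htmul x y =>
      rw [hT.creation_tmul, hT.creation_tmul, hT.creation_tmul, holePart_add, particlePart_add,
        WedgeSpace.wedge_add, WedgeSpace.contraction_add, LinearMap.map_add₂, map_add]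
      abel
  smul z f := by
    ext Φ
    rw [_root_.smul_apply]
    induction Φ using hT.induction with
    | hcl => exact isClosed_eq (by fun_prop) (by fun_prop)
    | hadd Φ Φ' h h' => simp only [map_add, h, h', smul_add]
    | hsmul w Φ h => rw [map_smul, map_smul, h, smul_comm]
    | htmul x y =>
      rw [hT.creation_tmul, hT.creation_tmul, holePart_smul, particlePart_smul,
        WedgeSpace.wedge_smul, WedgeSpace.contraction_smul, LinearMap.map_smul₂, map_smul,
        smul_add, RCLike.conj_conj]
  anticomm f g Φ := by
    induction Φ using hT.induction with
    | hcl => exact isClosed_eq (by fun_prop) (by fun_prop)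
    | hadd Φ Φ' h h' => simp only [map_add, h, h']; abel
    | hsmul z Φ h => simp only [map_smul, h, smul_neg]
    | htmul x y =>
      simp only [hT.creation_tmul, map_add, WedgeSpace.sign_wedge, LinearMap.map_neg₂, neg_add]
      rw [WedgeSpace.wedge_wedge (particlePart V f), WedgeSpace.sign_sign,
        WedgeSpace.contraction_contraction (holePart V f), LinearMap.map_neg₂, map_neg]
      abel
  car f g Φ := by
    rw [hT.adjoint_creation, ← inner_parts (V := V) f g]
    induction Φ using hT.induction with
    | hcl => exact isClosed_eq (by fun_prop) (by fun_prop)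
    | hadd Φ Φ' h h' => simp only [map_add, h, h', smul_add]; abel
    | hsmul z Φ h => simp only [map_smul, h, smul_sub]; rw [smul_comm]
    | htmul x y =>
      simp only [hT.creation_tmul, hT.annihilation_tmul, map_add, WedgeSpace.sign_wedge,
        WedgeSpace.sign_contraction, LinearMap.map_neg₂]
      rw [WedgeSpace.contraction_wedge, WedgeSpace.sign_sign, WedgeSpace.contraction_wedge,
        LinearMap.map_sub₂, map_sub, LinearMap.map_smul₂, map_smul, add_smul]
      abel

theorem creation_particle (g : V.toSubmoduleᗮ) (x : WedgeSpace V.toSubmoduleᗮ)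
    (y : WedgeSpace (ConjSpace V.toSubmodule)) :
    c (g : H) (T x y) = T (WedgeSpace.wedge g x) y := by
  rw [hT.creation_tmul, particlePart_coe, holePart_of_mem g.2, WedgeSpace.contraction_zero,
    map_zero, add_zero]

theorem annihilation_hole (g : V.toSubmodule) (x : WedgeSpace V.toSubmoduleᗮ)
    (y : WedgeSpace (ConjSpace V.toSubmodule)) :
    a (g : H) (T x y) = T (WedgeSpace.sign x) (WedgeSpace.wedge (ConjSpace.mk g) y) := by
  rw [hT.annihilation_tmul, holePart_coe, particlePart_of_mem g.2, WedgeSpace.contraction_zero,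
    LinearMap.map_zero₂, zero_add]

theorem annihilation_vacuum (f : H) : a f (T WedgeSpace.vac WedgeSpace.vac) =
    T WedgeSpace.vac (WedgeSpace.wedge (holePart V f) WedgeSpace.vac) := by
  rw [hT.annihilation_tmul, WedgeSpace.contraction_vac, WedgeSpace.sign_vac, LinearMap.map_zero₂,
    zero_add]

theorem creation_vacuum (f : H) : c f (T WedgeSpace.vac WedgeSpace.vac) =
    T (WedgeSpace.wedge (particlePart V f) WedgeSpace.vac) WedgeSpace.vac := by
  rw [hT.creation_tmul, WedgeSpace.contraction_vac, map_zero, add_zero]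

theorem inner_vacuum_vacuum : inner ℂ (T WedgeSpace.vac WedgeSpace.vac)
    (T WedgeSpace.vac WedgeSpace.vac) = 1 := by
  rw [hT.inner_tmul, WedgeSpace.inner_vac_vac, WedgeSpace.inner_vac_vac, one_mul]

theorem norm_vacuum : ‖T WedgeSpace.vac WedgeSpace.vac‖ = 1 := by
  have h := hT.inner_vacuum_vacuum
  rw [inner_self_eq_norm_sq_to_K] at h
  have h' : ‖T WedgeSpace.vac WedgeSpace.vac‖ ^ 2 = 1 :=
    Complex.ofReal_injective (by simpa using h)
  exact (pow_eq_one_iff_of_nonneg (norm_nonneg _) two_ne_zero).1 h'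

theorem isVacuum_vacuum : IsVacuum c V.toSubmodule (T WedgeSpace.vac WedgeSpace.vac) where
  particle f hf := by
    rw [hT.adjoint_creation, hT.annihilation_vacuum, holePart_of_mem hf, WedgeSpace.wedge_zero,
      map_zero]
  sea f hf := by
    rw [hT.creation_vacuum, particlePart_of_mem hf, WedgeSpace.wedge_zero, LinearMap.map_zero₂]

/-- The occupation of the mode `f` in the vacuum is that of its sea component. -/
theorem norm_annihilation_vacuum (f : H) :
    ‖a f (T WedgeSpace.vac WedgeSpace.vac)‖ ^ 2 = ‖V.toSubmodule.starProjection f‖ ^ 2 := by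
  have h : inner ℂ (a f (T WedgeSpace.vac WedgeSpace.vac)) (a f (T WedgeSpace.vac WedgeSpace.vac)) =
      inner ℂ (holePart V f) (holePart V f) := by
    rw [hT.annihilation_vacuum, hT.inner_tmul, WedgeSpace.inner_wedge,
      WedgeSpace.contraction_wedge, WedgeSpace.contraction_vac, map_zero, sub_zero,
      inner_smul_right, WedgeSpace.inner_vac_vac, WedgeSpace.inner_vac_vac, mul_one, one_mul]
  rw [inner_self_eq_norm_sq_to_K, inner_self_eq_norm_sq_to_K] at h
  exact_mod_cast h

/-- Creation of `f` from the vacuum only sees the particle component of `f`. -/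
theorem norm_creation_vacuum (f : H) :
    ‖c f (T WedgeSpace.vac WedgeSpace.vac)‖ ^ 2 = ‖V.toSubmoduleᗮ.starProjection f‖ ^ 2 := by
  have h : inner ℂ (c f (T WedgeSpace.vac WedgeSpace.vac)) (c f (T WedgeSpace.vac WedgeSpace.vac)) =
      inner ℂ (particlePart V f) (particlePart V f) := by
    rw [hT.creation_vacuum, hT.inner_tmul, WedgeSpace.inner_wedge,
      WedgeSpace.contraction_wedge, WedgeSpace.contraction_vac, map_zero, sub_zero,
      inner_smul_right, WedgeSpace.inner_vac_vac, WedgeSpace.inner_vac_vac, mul_one, mul_one]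
  rw [inner_self_eq_norm_sq_to_K, inner_self_eq_norm_sq_to_K] at h
  exact_mod_cast h

/-- All states are generated from the vacuum by creating particles and holes. -/
theorem induction_vacuum {p : E → Prop} (hcl : IsClosed {Φ | p Φ})
    (hadd : ∀ Φ Ψ, p Φ → p Ψ → p (Φ + Ψ)) (hsmul : ∀ (z : ℂ) Φ, p Φ → p (z • Φ))
    (hvac : p (T WedgeSpace.vac WedgeSpace.vac))
    (hpart : ∀ (g : V.toSubmoduleᗮ) Φ, p Φ → p (c (g : H) Φ))
    (hhole : ∀ (g : V.toSubmodule) Φ, p Φ → p (a (g : H) Φ)) (Φ : E) : p Φ := by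
  induction Φ using hT.induction with
  | hcl => exact hcl
  | hadd Φ Φ' h h' => exact hadd _ _ h h'
  | hsmul z Φ h => exact hsmul _ _ h
  | htmul x y =>
    induction x using WedgeSpace.induction with
    | hvac =>
      induction y using WedgeSpace.induction with
      | hvac => exact hvac
      | hadd y y' h h' => rw [map_add]; exact hadd _ _ h h'
      | hsmul z y h => rw [map_smul]; exact hsmul _ _ h
      | hwedge g y h =>
        have := hhole (ConjSpace.out g) _ h
        rw [hT.annihilation_hole, WedgeSpace.sign_vac] at this
        exact this
    | hadd x x' h h' => rw [LinearMap.map_add₂]; exact hadd _ _ h h'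
    | hsmul z x h => rw [LinearMap.map_smul₂]; exact hsmul _ _ h
    | hwedge g x h => rw [← hT.creation_particle]; exact hpart _ _ h

/-- A vector annihilated by all annihilation operators of particles and holes is a multiple of the
vacuum: it is orthogonal to all states with at least one particle or hole. -/
theorem eq_smul_vacuum {Ψ : E} (hΨ : IsVacuum c V.toSubmodule Ψ) :
    Ψ = (inner ℂ (T WedgeSpace.vac WedgeSpace.vac) Ψ : ℂ) • T WedgeSpace.vac WedgeSpace.vac := by
  have hV := hT.isVacuum_vacuum
  have h1 := hT.inner_vacuum_vacuum
  refine ext_inner_left ℂ fun Φ => ?_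
  induction Φ using hT.induction_vacuum with
  | hcl => exact isClosed_eq (by fun_prop) (by fun_prop)
  | hadd Φ Φ' h h' => rw [inner_add_left, inner_add_left, h, h']
  | hsmul w Φ h => rw [inner_smul_left, inner_smul_left, h]
  | hvac => rw [inner_smul_right, h1, mul_one]
  | hpart g Φ _ =>
    rw [← adjoint_inner_right, ← adjoint_inner_right, map_smul, hΨ.particle _ g.2,
      hV.particle _ g.2, smul_zero]
  | hhole g Φ _ =>
    rw [hT.inner_annihilation_left, hT.inner_annihilation_left, map_smul, hΨ.sea _ g.2,
      hV.sea _ g.2, smul_zero]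

/-- Schur's lemma for the Fock representation: it is irreducible, since the vacuum is unique and
cyclic. -/
theorem eq_smul_of_commute (B : E →L[ℂ] E) (h1 : ∀ f Φ, B (c f Φ) = c f (B Φ))
    (h2 : ∀ f Φ, B (a f Φ) = a f (B Φ)) : ∃ z : ℂ, ∀ Φ, B Φ = z • Φ := by
  have hV := hT.isVacuum_vacuum
  have hB : IsVacuum c V.toSubmodule (B (T WedgeSpace.vac WedgeSpace.vac)) :=
    ⟨fun f hf => by
      have := hV.particle f hf
      rw [hT.adjoint_creation] at this ⊢
      rw [← h2, this, map_zero], fun f hf => by rw [← h1, hV.sea f hf, map_zero]⟩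
  obtain ⟨z, hz⟩ : ∃ z : ℂ, B (T WedgeSpace.vac WedgeSpace.vac) =
    z • T WedgeSpace.vac WedgeSpace.vac := ⟨_, hT.eq_smul_vacuum hB⟩
  refine ⟨z, fun Φ => ?_⟩
  induction Φ using hT.induction_vacuum with
  | hcl => exact isClosed_eq (by fun_prop) (by fun_prop)
  | hadd Φ Φ' h h' => rw [map_add, h, h', smul_add]
  | hsmul w Φ h => rw [map_smul, h, smul_comm]
  | hvac => exact hz
  | hpart g Φ h => rw [h1, h, map_smul]
  | hhole g Φ h => rw [h2, h, map_smul]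

end IsFockModel

end FockModel

/-! ### Unitary maps from isometric relations -/

/-- An isometric linear relation with dense domain and dense range is, after closure, the graph of
a unitary map. -/
theorem exists_unitary_of_isometric_relation {E E' : Type*} [NormedAddCommGroup E]
    [InnerProductSpace ℂ E] [CompleteSpace E] [NormedAddCommGroup E'] [InnerProductSpace ℂ E']
    [CompleteSpace E'] (G : Submodule ℂ (E × E')) (hn : ∀ p ∈ G, ‖p.1‖ = ‖p.2‖)
    (h1 : Dense (Prod.fst '' (G : Set (E × E')))) (h2 : Dense (Prod.snd '' (G : Set (E × E')))) :
    ∃ U : E ≃ₗᵢ[ℂ] E', closure (G : Set (E × E')) = {p | p.2 = U p.1} := by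
  let K := G.topologicalClosure
  have hK : ∀ p ∈ K, ‖p.1‖ = ‖p.2‖ := fun p hp =>
    closure_minimal (t := {p : E × E' | ‖p.1‖ = ‖p.2‖}) hn
      (isClosed_eq (by fun_prop) (by fun_prop)) hp
  have : CompleteSpace K := G.isClosed_topologicalClosure.completeSpace_coe
  let A : K →ₗᵢ[ℂ] E := ⟨(LinearMap.fst ℂ E E').comp K.subtype, fun p => by
    have h := hK p p.2
    change ‖p.1.1‖ = max ‖p.1.1‖ ‖p.1.2‖
    rw [← h, max_self]⟩
  let B : K →ₗᵢ[ℂ] E' := ⟨(LinearMap.snd ℂ E E').comp K.subtype, fun p => by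
    have h := hK p p.2
    change ‖p.1.2‖ = max ‖p.1.1‖ ‖p.1.2‖
    rw [h, max_self]⟩
  have hA : Function.Surjective A := by
    have hc : IsClosed (Set.range A) := A.isometry.isClosedEmbedding.isClosed_range
    refine Set.range_eq_univ.1 (hc.closure_eq ▸ Dense.closure_eq (h1.mono ?_))
    rintro _ ⟨p, hp, rfl⟩
    exact ⟨⟨p, G.le_topologicalClosure hp⟩, rfl⟩
  have hB : Function.Surjective B := by
    have hc : IsClosed (Set.range B) := B.isometry.isClosedEmbedding.isClosed_range
    refine Set.range_eq_univ.1 (hc.closure_eq ▸ Dense.closure_eq (h2.mono ?_))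
    rintro _ ⟨p, hp, rfl⟩
    exact ⟨⟨p, G.le_topologicalClosure hp⟩, rfl⟩
  let eA := LinearIsometryEquiv.ofSurjective A hA
  let eB := LinearIsometryEquiv.ofSurjective B hB
  refine ⟨eA.symm.trans eB, Set.ext fun p => ⟨fun hp => ?_, fun hp => ?_⟩⟩
  · have e : eA ⟨p, hp⟩ = p.1 := rfl
    change p.2 = eB (eA.symm p.1)
    rw [← e, eA.symm_apply_apply]
    rfl
  · obtain ⟨q, hq⟩ := hA p.1
    have e : eA q = p.1 := hq
    change p.2 = eB (eA.symm p.1) at hp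
    rw [← e, eA.symm_apply_apply] at hp
    have : p = (q : E × E') := Prod.ext hq.symm hp
    rw [this]
    exact q.2

namespace WedgeSpace

variable {K : Type*} [NormedAddCommGroup K] [InnerProductSpace ℂ K] {E : Type*}
  [NormedAddCommGroup E] [InnerProductSpace ℂ E]

/-- The action of `⋀K` on `E` generated by operators `L g` of square zero. -/
def lift (L : K →ₗ[ℂ] Module.End ℂ E) (hL : ∀ g, L g * L g = 0) :
    WedgeSpace K →ₗ[ℂ] Module.End ℂ E :=
  (ExteriorAlgebra.lift ℂ ⟨L, hL⟩ : ExteriorAlgebra ℂ K →ₐ[ℂ] Module.End ℂ E).toLinearMap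

theorem lift_vac (L : K →ₗ[ℂ] Module.End ℂ E) (hL : ∀ g, L g * L g = 0) : lift L hL vac = 1 :=
  map_one (ExteriorAlgebra.lift ℂ ⟨L, hL⟩)

theorem lift_wedge (L : K →ₗ[ℂ] Module.End ℂ E) (hL : ∀ g, L g * L g = 0) (g : K)
    (x : WedgeSpace K) : lift L hL (wedge g x) = L g * lift L hL x := by
  let x' : ExteriorAlgebra ℂ K := x
  change ExteriorAlgebra.lift ℂ ⟨L, hL⟩ (ExteriorAlgebra.ι ℂ g * x') = _
  rw [map_mul, ExteriorAlgebra.lift_ι_apply]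
  rfl

end WedgeSpace

section Models

open ContinuousLinearMap

variable {H : Type*} [NormedAddCommGroup H] [InnerProductSpace ℂ H] [CompleteSpace H]
  {V : ClosedSubmodule ℂ H} {E : Type*} [NormedAddCommGroup E] [InnerProductSpace ℂ E]
  [CompleteSpace E] {E' : Type*} [NormedAddCommGroup E'] [InnerProductSpace ℂ E']
  [CompleteSpace E']

theorem dense_range_lift
    {B : WedgeSpace V.toSubmoduleᗮ →ₗ[ℂ] WedgeSpace (ConjSpace V.toSubmodule) →ₗ[ℂ] E}
    (hB : (Submodule.span ℂ {Φ | ∃ x y, Φ = B x y}).topologicalClosure = ⊤) :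
    Dense (Set.range (TensorProduct.lift B)) := by
  have : (Submodule.span ℂ {Φ | ∃ x y, Φ = B x y}) ≤ LinearMap.range (TensorProduct.lift B) := by
    rw [Submodule.span_le]
    rintro _ ⟨x, y, rfl⟩
    exact ⟨x ⊗ₜ y, rfl⟩
  have h2 := Submodule.topologicalClosure_mono this
  rw [hB, top_le_iff] at h2
  exact Submodule.dense_iff_topologicalClosure_eq_top.2 h2

/-- Two Fock models of the same polarization are unitarily equivalent. -/
theorem IsFockModel.exists_intertwiner
    {T : WedgeSpace V.toSubmoduleᗮ →ₗ[ℂ] WedgeSpace (ConjSpace V.toSubmodule) →ₗ[ℂ] E}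
    {c a : H → E →L[ℂ] E} (hT : IsFockModel T c a)
    {T' : WedgeSpace V.toSubmoduleᗮ →ₗ[ℂ] WedgeSpace (ConjSpace V.toSubmodule) →ₗ[ℂ] E'}
    {c' a' : H → E' →L[ℂ] E'} (hT' : IsFockModel T' c' a') :
    ∃ L : E ≃ₗᵢ[ℂ] E', ∀ f Φ, L (c f Φ) = c' f (L Φ) := by
  let A := TensorProduct.lift T
  let A' := TensorProduct.lift T'
  have hA : ∀ p q, inner ℂ (A p) (A q) = inner ℂ (A' p) (A' q) := fun p q => by
    induction p using TensorProduct.induction_on with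
    | zero => simp
    | add p p' h h' => rw [map_add, map_add, inner_add_left, inner_add_left, h, h']
    | tmul x y =>
      induction q using TensorProduct.induction_on with
      | zero => simp
      | add p p' h h' => rw [map_add, map_add, inner_add_right, inner_add_right, h, h']
      | tmul x' y' =>
        change inner ℂ (T x y) (T x' y') = inner ℂ (T' x y) (T' x' y')
        rw [hT.inner_tmul, hT'.inner_tmul]
  let G := LinearMap.range (A.prod A')
  obtain ⟨L, hL⟩ := exists_unitary_of_isometric_relation G (by
    rintro _ ⟨p, rfl⟩
    have := hA p p
    rw [inner_self_eq_norm_sq_to_K, inner_self_eq_norm_sq_to_K] at this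
    have h2 : ‖A p‖ ^ 2 = ‖A' p‖ ^ 2 := by exact_mod_cast this
    exact (pow_left_inj₀ (norm_nonneg _) (norm_nonneg _) two_ne_zero).1 h2)
    ((dense_range_lift hT.dense).mono (by rintro _ ⟨p, rfl⟩; exact ⟨_, ⟨p, rfl⟩, rfl⟩))
    ((dense_range_lift hT'.dense).mono (by rintro _ ⟨p, rfl⟩; exact ⟨_, ⟨p, rfl⟩, rfl⟩))
  have hL' : ∀ x y, L (T x y) = T' x y := fun x y => by
    have : ((T x y, T' x y) : E × E') ∈ closure (G : Set (E × E')) :=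
      subset_closure ⟨x ⊗ₜ y, rfl⟩
    rw [hL] at this
    exact this.symm
  refine ⟨L, fun f Φ => ?_⟩
  induction Φ using hT.induction with
  | hcl =>
    exact isClosed_eq (L.continuous.comp (c f).continuous) ((c' f).continuous.comp L.continuous)
  | hadd Φ Φ' h h' => simp only [map_add, h, h']
  | hsmul z Φ h => simp only [map_smul, h]
  | htmul x y => rw [hT.creation_tmul, hL', hT'.creation_tmul, map_add, hL', hL']

/-- An element of the conjugate space of `V`, as a vector of `H`. -/
def seaVector (g : ConjSpace V.toSubmodule) : H := (ConjSpace.out g : V.toSubmodule)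

theorem seaVector_add (g h : ConjSpace V.toSubmodule) :
    seaVector (g + h) = seaVector g + seaVector h := rfl

theorem seaVector_smul (z : ℂ) (g : ConjSpace V.toSubmodule) :
    seaVector (z • g) = conj z • seaVector g := rfl

theorem seaVector_mem (g : ConjSpace V.toSubmodule) : seaVector g ∈ V.toSubmodule :=
  (ConjSpace.out g : V.toSubmodule).2

namespace IsCAR

variable {c : H → E →L[ℂ] E} (hc : IsCAR c)

/-- Creation operators of particle states, as a linear map. -/
def particleMap (V : ClosedSubmodule ℂ H) : V.toSubmoduleᗮ →ₗ[ℂ] Module.End ℂ E where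
  toFun g := (c (g : H) : E →ₗ[ℂ] E)
  map_add' g h := by rw [Submodule.coe_add, hc.add]; rfl
  map_smul' z g := by rw [Submodule.coe_smul, hc.smul]; rfl

/-- Annihilation operators of sea states, which create holes, as a linear map. -/
def holeMap (V : ClosedSubmodule ℂ H) : ConjSpace V.toSubmodule →ₗ[ℂ] Module.End ℂ E where
  toFun g := (adjoint (c (seaVector g)) : E →ₗ[ℂ] E)
  map_add' g h := by rw [seaVector_add, hc.adjoint_add]; rfl
  map_smul' z g := by rw [seaVector_smul, hc.adjoint_smul, RCLike.conj_conj]; rfl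

/-- Products of creation operators of particle states. -/
def particleRep (V : ClosedSubmodule ℂ H) : WedgeSpace V.toSubmoduleᗮ →ₗ[ℂ] Module.End ℂ E :=
  WedgeSpace.lift (hc.particleMap V) fun g => LinearMap.ext fun Φ => hc.sq_zero (g : H) Φ

/-- Products of annihilation operators of sea states, which create holes. -/
def holeRep (V : ClosedSubmodule ℂ H) :
    WedgeSpace (ConjSpace V.toSubmodule) →ₗ[ℂ] Module.End ℂ E :=
  WedgeSpace.lift (hc.holeMap V) fun g => LinearMap.ext fun Φ =>
    hc.adjoint_sq_zero (seaVector g) Φ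

/-- The product states generated from a vector `Ω`. -/
def productState (V : ClosedSubmodule ℂ H) (Ω : E) : WedgeSpace V.toSubmoduleᗮ →ₗ[ℂ]
    WedgeSpace (ConjSpace V.toSubmodule) →ₗ[ℂ] E :=
  LinearMap.mk₂ ℂ (fun x y => hc.particleRep V x (hc.holeRep V y Ω))
    (fun x x' _ => by rw [map_add]; rfl)
    (fun z x _ => by rw [map_smul]; rfl)
    (fun x y y' => by rw [map_add, LinearMap.add_apply, map_add])
    (fun z x y => by rw [map_smul, LinearMap.smul_apply, map_smul])

variable (Ω : E)

theorem productState_apply (x : WedgeSpace V.toSubmoduleᗮ)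
    (y : WedgeSpace (ConjSpace V.toSubmodule)) :
    hc.productState V Ω x y = hc.particleRep V x (hc.holeRep V y Ω) := rfl

theorem productState_vac_vac :
    hc.productState V Ω WedgeSpace.vac WedgeSpace.vac = Ω := by
  rw [productState_apply, particleRep, holeRep, WedgeSpace.lift_vac, WedgeSpace.lift_vac]; rfl

theorem productState_wedge (g : V.toSubmoduleᗮ) (x : WedgeSpace V.toSubmoduleᗮ)
    (y : WedgeSpace (ConjSpace V.toSubmodule)) :
    hc.productState V Ω (WedgeSpace.wedge g x) y = c (g : H) (hc.productState V Ω x y) := by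
  rw [productState_apply, particleRep, WedgeSpace.lift_wedge]; rfl

theorem productState_vac_wedge (g : ConjSpace V.toSubmodule)
    (y : WedgeSpace (ConjSpace V.toSubmodule)) :
    hc.productState V Ω WedgeSpace.vac (WedgeSpace.wedge g y) =
      adjoint (c (seaVector g)) (hc.productState V Ω WedgeSpace.vac y) := by
  rw [productState_apply, productState_apply, particleRep, WedgeSpace.lift_vac, holeRep,
    WedgeSpace.lift_wedge]; rfl

variable {Ω}

theorem annihilation_particle (hΩ : IsVacuum c V.toSubmodule Ω) (g : V.toSubmoduleᗮ)
    (x : WedgeSpace V.toSubmoduleᗮ) (y : WedgeSpace (ConjSpace V.toSubmodule)) :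
    adjoint (c (g : H)) (hc.productState V Ω x y) =
      hc.productState V Ω (WedgeSpace.contraction g x) y := by
  induction x using WedgeSpace.induction with
  | hvac =>
    rw [WedgeSpace.contraction_vac, LinearMap.map_zero₂]
    induction y using WedgeSpace.induction with
    | hvac => rw [productState_vac_vac, hΩ.particle _ g.2]
    | hadd y y' h h' => rw [map_add, map_add, h, h', add_zero]
    | hsmul z y h => rw [map_smul, map_smul, h, smul_zero]
    | hwedge k y h =>
      rw [productState_vac_wedge, hc.adjoint_anticomm, h, map_zero, neg_zero]
  | hadd x x' h h' =>
    rw [LinearMap.map_add₂, map_add (adjoint _), h, h', map_add (WedgeSpace.contraction _),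
      LinearMap.map_add₂]
  | hsmul z x h =>
    rw [LinearMap.map_smul₂, map_smul (adjoint _), h, map_smul (WedgeSpace.contraction _),
      LinearMap.map_smul₂]
  | hwedge k x h =>
    rw [productState_wedge, hc.car, h, WedgeSpace.contraction_wedge, LinearMap.map_sub₂,
      LinearMap.map_smul₂, productState_wedge]
    rfl

theorem annihilation_sea (g : ConjSpace V.toSubmodule) (x : WedgeSpace V.toSubmoduleᗮ)
    (y : WedgeSpace (ConjSpace V.toSubmodule)) :
    adjoint (c (seaVector g)) (hc.productState V Ω x y) =
      hc.productState V Ω (WedgeSpace.sign x) (WedgeSpace.wedge g y) := by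
  induction x using WedgeSpace.induction with
  | hvac => rw [WedgeSpace.sign_vac, productState_vac_wedge]
  | hadd x x' h h' =>
    rw [LinearMap.map_add₂, map_add (adjoint _), h, h', map_add WedgeSpace.sign,
      LinearMap.map_add₂]
  | hsmul z x h =>
    rw [LinearMap.map_smul₂, map_smul (adjoint _), h, map_smul WedgeSpace.sign,
      LinearMap.map_smul₂]
  | hwedge k x h =>
    have h0 : inner ℂ (seaVector g) (k : H) = 0 := k.2 _ (seaVector_mem g)
    rw [productState_wedge, hc.car, h, h0, zero_smul, zero_sub, WedgeSpace.sign_wedge,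
      LinearMap.map_neg₂, productState_wedge]

theorem creation_sea (hΩ : IsVacuum c V.toSubmodule Ω) (g : ConjSpace V.toSubmodule)
    (x : WedgeSpace V.toSubmoduleᗮ) (y : WedgeSpace (ConjSpace V.toSubmodule)) :
    c (seaVector g) (hc.productState V Ω x y) =
      hc.productState V Ω (WedgeSpace.sign x) (WedgeSpace.contraction g y) := by
  induction x using WedgeSpace.induction with
  | hvac =>
    rw [WedgeSpace.sign_vac]
    induction y using WedgeSpace.induction with
    | hvac =>
      rw [productState_vac_vac, hΩ.sea _ (seaVector_mem g), WedgeSpace.contraction_vac, map_zero]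
    | hadd y y' h h' => simp only [map_add, h, h']
    | hsmul z y h => simp only [map_smul, h]
    | hwedge k y h =>
      have e := hc.car (seaVector k) (seaVector g) (hc.productState V Ω WedgeSpace.vac y)
      have e2 : inner ℂ g k = inner ℂ (seaVector k) (seaVector g) := rfl
      rw [WedgeSpace.contraction_wedge, map_sub, map_smul, e2, productState_vac_wedge,
        productState_vac_wedge, ← h, e]
      abel
  | hadd x x' h h' =>
    rw [LinearMap.map_add₂, map_add (c _), h, h', map_add WedgeSpace.sign, LinearMap.map_add₂]
  | hsmul z x h =>
    rw [LinearMap.map_smul₂, map_smul (c _), h, map_smul WedgeSpace.sign, LinearMap.map_smul₂]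
  | hwedge k x h =>
    rw [productState_wedge, hc.anticomm, h, WedgeSpace.sign_wedge, LinearMap.map_neg₂,
      productState_wedge]

theorem inner_productState (hΩ : IsVacuum c V.toSubmodule Ω) (h1 : inner ℂ Ω Ω = 1)
    (x x' : WedgeSpace V.toSubmoduleᗮ) (y y' : WedgeSpace (ConjSpace V.toSubmodule)) :
    inner ℂ (hc.productState V Ω x y) (hc.productState V Ω x' y') =
      inner ℂ x x' * inner ℂ y y' := by
  induction x using WedgeSpace.induction generalizing x' with
  | hadd x z h h' => rw [LinearMap.map_add₂, inner_add_left, inner_add_left, h, h', add_mul]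
  | hsmul z x h => rw [LinearMap.map_smul₂, inner_smul_left, inner_smul_left, h, mul_assoc]
  | hwedge k x h =>
    rw [productState_wedge, ← adjoint_inner_right, hc.annihilation_particle hΩ, h,
      WedgeSpace.inner_wedge]
  | hvac =>
    induction y using WedgeSpace.induction generalizing x' y' with
    | hadd y z h h' => rw [map_add, inner_add_left, inner_add_left, h, h', mul_add]
    | hsmul z y h => rw [map_smul, inner_smul_left, inner_smul_left, h]; ring
    | hwedge k y h =>
      rw [productState_vac_wedge, adjoint_inner_left, hc.creation_sea hΩ, h, WedgeSpace.inner_wedge,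
        ← WedgeSpace.inner_sign, WedgeSpace.sign_vac]
    | hvac =>
      rw [productState_vac_vac]
      induction x' using WedgeSpace.induction with
      | hadd y z h h' => rw [LinearMap.map_add₂, inner_add_right, inner_add_right, h, h', add_mul]
      | hsmul z y h => rw [LinearMap.map_smul₂, inner_smul_right, inner_smul_right, h]; ring
      | hwedge k x h =>
        rw [productState_wedge, ← adjoint_inner_left, hΩ.particle _ k.2, inner_zero_left,
          ← WedgeSpace.inner_contraction, WedgeSpace.contraction_vac, inner_zero_left, zero_mul]
      | hvac =>
        induction y' using WedgeSpace.induction with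
        | hadd y z h h' => rw [map_add, inner_add_right, inner_add_right, h, h', mul_add]
        | hsmul z y h => rw [map_smul, inner_smul_right, inner_smul_right, h]; ring
        | hwedge k y h =>
          rw [← WedgeSpace.inner_contraction k, WedgeSpace.contraction_vac, inner_zero_left,
            mul_zero, productState_vac_wedge, adjoint_inner_right, hΩ.sea _ (seaVector_mem k),
            inner_zero_left]
        | hvac =>
          rw [productState_vac_vac, WedgeSpace.inner_vac_vac, WedgeSpace.inner_vac_vac, h1,
            one_mul]

/-- A vacuum vector for `V` in an irreducible representation generates a Fock model of `V`: the
anticommutation relations determine all inner products of product states. -/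
theorem isFockModel_productState (hΩ : IsVacuum c V.toSubmodule Ω) (h1 : inner ℂ Ω Ω = 1)
    (hirr : ∀ B : E →L[ℂ] E, (∀ f Φ, B (c f Φ) = c f (B Φ)) →
      (∀ f Φ, B (adjoint (c f) Φ) = adjoint (c f) (B Φ)) → ∃ z : ℂ, ∀ Φ, B Φ = z • Φ) :
    IsFockModel (hc.productState V Ω) c (fun f => adjoint (c f)) := by
  have hcr : ∀ f x y, c f (hc.productState V Ω x y) =
      hc.productState V Ω (WedgeSpace.wedge (particlePart V f) x) y +
      hc.productState V Ω (WedgeSpace.sign x) (WedgeSpace.contraction (holePart V f) y) := by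
    intro f x y
    conv_lhs => rw [← add_parts (V := V) f, hc.add, _root_.add_apply]
    rw [← productState_wedge]
    exact congrArg _ (hc.creation_sea hΩ (holePart V f) x y)
  have han : ∀ f x y, adjoint (c f) (hc.productState V Ω x y) =
      hc.productState V Ω (WedgeSpace.contraction (particlePart V f) x) y +
      hc.productState V Ω (WedgeSpace.sign x) (WedgeSpace.wedge (holePart V f) y) := by
    intro f x y
    conv_lhs => rw [← add_parts (V := V) f, hc.adjoint_add, _root_.add_apply]
    rw [hc.annihilation_particle hΩ]
    exact congrArg _ (hc.annihilation_sea (holePart V f) x y)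
  refine ⟨fun x y x' y' => hc.inner_productState hΩ h1 x x' y y', ?_, hcr, han⟩
  set S := Submodule.span ℂ {Φ | ∃ x y, Φ = hc.productState V Ω x y}
  set M := S.topologicalClosure with hM
  have hMc : CompleteSpace M := S.isClosed_topologicalClosure.completeSpace_coe
  have hmem : ∀ x y, hc.productState V Ω x y ∈ S := fun x y => Submodule.subset_span ⟨x, y, rfl⟩
  have hinv : ∀ A : E →L[ℂ] E, (∀ x y, A (hc.productState V Ω x y) ∈ S) →
      ∀ Φ ∈ M, A Φ ∈ M := fun A hA Φ hΦ => by
    have hS : ∀ Φ ∈ S, A Φ ∈ S := fun Φ hΦ => by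
      have : S ≤ S.comap (A : E →ₗ[ℂ] E) := by
        rw [Submodule.span_le]
        rintro _ ⟨x, y, rfl⟩
        exact hA x y
      exact this hΦ
    exact map_mem_closure A.continuous hΦ hS
  have hcM : ∀ f, ∀ Φ ∈ M, c f Φ ∈ M := fun f =>
    hinv _ fun x y => by rw [hcr]; exact add_mem (hmem _ _) (hmem _ _)
  have haM : ∀ f, ∀ Φ ∈ M, adjoint (c f) Φ ∈ M := fun f =>
    hinv _ fun x y => by rw [han]; exact add_mem (hmem _ _) (hmem _ _)
  have hcomm : ∀ A : E →L[ℂ] E, (∀ Φ ∈ M, A Φ ∈ M) → (∀ Φ ∈ M, adjoint A Φ ∈ M) →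
      ∀ Φ, M.starProjection (A Φ) = A (M.starProjection Φ) := fun A hA hA' Φ => by
    refine Submodule.eq_starProjection_of_mem_orthogonal
      (hA _ (Submodule.starProjection_apply_mem _ _)) ?_
    rw [← map_sub]
    intro Ψ hΨ
    rw [← adjoint_inner_left]
    exact Submodule.sub_starProjection_mem_orthogonal Φ _ (hA' _ hΨ)
  obtain ⟨z, hz⟩ := hirr M.starProjection (fun f => hcomm _ (hcM f) (haM f))
    (fun f => hcomm _ (haM f) (by rw [adjoint_adjoint]; exact hcM f))
  have hΩM : Ω ∈ M := by
    rw [← hc.productState_vac_vac (V := V) Ω]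
    exact S.le_topologicalClosure (hmem _ _)
  have hΩ0 : Ω ≠ 0 := by rintro rfl; simp at h1
  have hz1 : z = 1 := by
    have := hz Ω
    rw [Submodule.starProjection_eq_self_iff.2 hΩM] at this
    have h2 : (z - 1) • Ω = 0 := by rw [sub_smul, one_smul, ← this, sub_self]
    rcases smul_eq_zero.1 h2 with h | h
    · exact sub_eq_zero.1 h
    · exact absurd h hΩ0
  rw [Submodule.eq_top_iff']
  intro Φ
  rw [← Submodule.starProjection_eq_self_iff, hz, hz1, one_smul]

end IsCAR

end Models

/-! ### Existence of vacuum vectors -/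

section Vacuum

open ContinuousLinearMap

variable {E : Type*} [NormedAddCommGroup E] [InnerProductSpace ℂ E] [CompleteSpace E]

open Classical in
/-- The operators `D i` are fermionic annihilation operators of orthonormal modes. -/
structure IsFermionic {ι : Type*} (D : ι → E →L[ℂ] E) : Prop where
  anticomm : ∀ i j Φ, D i (D j Φ) = - D j (D i Φ)
  car : ∀ i j Φ, D i (adjoint (D j) Φ) = (if i = j then Φ else 0) - adjoint (D j) (D i Φ)

namespace IsFermionic

variable {ι : Type*} {D : ι → E →L[ℂ] E} (hD : IsFermionic D)
include hD

theorem restrict (p : ι → Prop) : IsFermionic fun i : {i // p i} => D i where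
  anticomm i j Φ := hD.anticomm i j Φ
  car i j Φ := by
    by_cases h : i = j
    · subst h
      rw [hD.car, if_pos rfl, if_pos rfl]
    · rw [hD.car, if_neg h, if_neg fun h' => h (Subtype.ext h')]

theorem norm_sq_add (i : ι) (Φ : E) : ‖adjoint (D i) Φ‖ ^ 2 + ‖D i Φ‖ ^ 2 = ‖Φ‖ ^ 2 := by
  have h1 : inner ℂ (adjoint (D i) Φ) (adjoint (D i) Φ) + inner ℂ (D i Φ) (D i Φ) =
      inner ℂ Φ Φ := by
    rw [adjoint_inner_left, hD.car, if_pos rfl, inner_sub_right, adjoint_inner_right,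
      sub_add_cancel]
  rw [inner_self_eq_norm_sq_to_K (𝕜 := ℂ), inner_self_eq_norm_sq_to_K (𝕜 := ℂ),
    inner_self_eq_norm_sq_to_K (𝕜 := ℂ)] at h1
  exact_mod_cast h1

theorem norm_apply_le (i : ι) (Φ : E) : ‖D i Φ‖ ≤ ‖Φ‖ := by
  have := hD.norm_sq_add i Φ
  exact abs_le_of_sq_le_sq' (by nlinarith [sq_nonneg ‖adjoint (D i) Φ‖]) (norm_nonneg _) |>.2

theorem norm_adjoint_apply_le (i : ι) (Φ : E) : ‖adjoint (D i) Φ‖ ≤ ‖Φ‖ := by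
  have := hD.norm_sq_add i Φ
  exact abs_le_of_sq_le_sq' (by nlinarith [sq_nonneg ‖D i Φ‖]) (norm_nonneg _) |>.2

/-- Projection of `Ω` onto the common kernel of finitely many modes: the operators `D i ∘ (D i)†`
are commuting projections onto the kernels. -/
theorem exists_projection (Ω : E) (s : Finset ι) :
    ∃ Φ, (∀ i ∈ s, D i Φ = 0) ∧ (∀ j ∉ s, ‖D j Φ‖ ≤ ‖D j Ω‖) ∧
      ‖Ω‖ ^ 2 - ∑ i ∈ s, ‖D i Ω‖ ^ 2 ≤ ‖Φ‖ ^ 2 ∧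
      ∀ Ψ, (∀ i ∈ s, D i Ψ = 0) → inner ℂ Ψ Φ = inner ℂ Ψ Ω := by
  classical
  induction s using Finset.induction_on with
  | empty => exact ⟨Ω, by simp, by simp, by simp, by simp⟩
  | insert i s hi ih =>
    obtain ⟨Φ, h1, h2, h3, h4⟩ := ih
    -- The new state is `D i (D i)† Φ`, the projection of `Φ` onto the kernel of `D i`; it does not
    -- increase the occupation of the other modes.
    have e : D i (adjoint (D i) Φ) = Φ - adjoint (D i) (D i Φ) := by rw [hD.car, if_pos rfl]
    have k1 : ∀ j, j ≠ i → D j (D i (adjoint (D i) Φ)) = D i (adjoint (D i) (D j Φ)) := by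
      intro j hj
      rw [hD.anticomm, hD.car, if_neg hj, zero_sub, map_neg, neg_neg]
    have k2 : D i (D i (adjoint (D i) Φ)) = 0 := eq_zero_of_eq_neg_self (hD.anticomm _ _ _)
    have k3 : ∀ Ψ, D i Ψ = 0 → inner ℂ Ψ (D i (adjoint (D i) Φ)) = inner ℂ Ψ Φ := by
      intro Ψ h
      rw [e, inner_sub_right, adjoint_inner_right, h, inner_zero_left, sub_zero]
    refine ⟨D i (adjoint (D i) Φ), ?_, ?_, ?_, ?_⟩
    · intro j hj
      by_cases hji : j = i
      · rw [hji, k2]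
      · rw [k1 j hji, h1 j (Finset.mem_of_mem_insert_of_ne hj hji), map_zero, map_zero]
    · intro j hj
      rw [Finset.mem_insert, not_or] at hj
      rw [k1 j hj.1]
      exact (hD.norm_apply_le _ _).trans ((hD.norm_adjoint_apply_le _ _).trans (h2 j hj.2))
    · rw [Finset.sum_insert hi]
      have a1 := hD.norm_sq_add i Φ
      have a2 := hD.norm_sq_add i (adjoint (D i) Φ)
      have a3 : adjoint (D i) (adjoint (D i) Φ) = 0 := by
        refine ext_inner_left ℂ fun v => ?_
        rw [adjoint_inner_right, adjoint_inner_right,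
          eq_zero_of_eq_neg_self (hD.anticomm i i v), inner_zero_left, inner_zero_right]
      rw [a3, norm_zero] at a2
      have a4 : ‖D i Φ‖ ^ 2 ≤ ‖D i Ω‖ ^ 2 := pow_le_pow_left₀ (norm_nonneg _) (h2 i hi) 2
      linarith
    · intro Ψ hΨ
      rw [k3 Ψ (hΨ i (Finset.mem_insert_self _ _)),
        h4 Ψ fun j hj => hΨ j (Finset.mem_insert_of_mem hj)]

/-- If the total occupation is less than `‖Ω‖²`, the infinitely many modes can be emptied
simultaneously. Were there no common kernel vector, the ranges of the `(D i)†` would span a dense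
subspace, whose elements are orthogonal to the kernels of finitely many `D i`; the projection of `Ω`
onto such a kernel has norm bounded below, a contradiction. -/
theorem exists_common_kernel_of_small {Ω : E} {C : ℝ} (hC : C < ‖Ω‖ ^ 2)
    (hs : ∀ s : Finset ι, ∑ i ∈ s, ‖D i Ω‖ ^ 2 ≤ C) : ∃ Ψ ≠ 0, ∀ i, D i Ψ = 0 := by
  classical
  by_contra! hcon
  let R : Submodule ℂ E := Submodule.span ℂ {Φ | ∃ i Ψ, Φ = adjoint (D i) Ψ}
  have hR : Rᗮ = ⊥ := by
    rw [Submodule.eq_bot_iff]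
    intro Ψ hΨ
    by_contra h0
    obtain ⟨i, hi⟩ := hcon Ψ h0
    refine hi (ext_inner_left ℂ fun v => ?_)
    rw [← adjoint_inner_left, inner_zero_right]
    exact hΨ _ (Submodule.subset_span ⟨i, v, rfl⟩)
  have hdense : Dense (R : Set E) := by
    rw [Submodule.dense_iff_topologicalClosure_eq_top, Submodule.topologicalClosure_eq_top_iff]
    exact hR
  -- Each vector of `R` involves finitely many modes, hence is orthogonal to their common kernel.
  have hRs : ∀ r ∈ R, ∃ s : Finset ι, ∀ Ψ, (∀ i ∈ s, D i Ψ = 0) → inner ℂ Ψ r = 0 := by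
    intro r hr
    induction hr using Submodule.span_induction with
    | mem r h =>
      obtain ⟨i, Φ, rfl⟩ := h
      refine ⟨{i}, fun Ψ h => ?_⟩
      rw [adjoint_inner_right, h i (by simp), inner_zero_left]
    | zero => exact ⟨∅, fun Ψ _ => inner_zero_right _⟩
    | add x y _ _ hx hy =>
      obtain ⟨s, hs⟩ := hx
      obtain ⟨t, ht⟩ := hy
      refine ⟨s ∪ t, fun Ψ h => ?_⟩
      rw [inner_add_right, hs Ψ fun i hi => h i (Finset.mem_union_left _ hi),
        ht Ψ fun i hi => h i (Finset.mem_union_right _ hi), add_zero]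
    | smul z x _ hx =>
      obtain ⟨s, hs⟩ := hx
      exact ⟨s, fun Ψ h => by rw [inner_smul_right, hs Ψ h, mul_zero]⟩
  have hε : 0 < √(‖Ω‖ ^ 2 - C) := Real.sqrt_pos.2 (by linarith)
  obtain ⟨r, hr, hdist⟩ := hdense.exists_dist_lt Ω hε
  obtain ⟨s, hsr⟩ := hRs r hr
  obtain ⟨Φ, h1, -, h3, h4⟩ := hD.exists_projection Ω s
  have e1 : inner ℂ Φ Φ = inner ℂ Φ (Ω - r) := by
    rw [inner_sub_right, hsr Φ h1, sub_zero, h4 Φ h1]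
  have e2 : ‖Φ‖ ^ 2 ≤ ‖Φ‖ * ‖Ω - r‖ := by
    have := norm_inner_le_norm (𝕜 := ℂ) Φ (Ω - r)
    rw [← e1, inner_self_eq_norm_sq_to_K] at this
    simpa using this
  have e3 : ‖Ω‖ ^ 2 - C ≤ ‖Φ‖ ^ 2 := by linarith [hs s]
  have e4 : √(‖Ω‖ ^ 2 - C) ≤ ‖Φ‖ := by
    rw [← Real.sqrt_sq (norm_nonneg Φ)]
    exact Real.sqrt_le_sqrt e3
  rw [dist_eq_norm] at hdist
  nlinarith

/-- Finitely many remaining modes are emptied by applying `D i` to the state wherever this does not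
give zero. -/
theorem exists_common_kernel_of_compl (s : Finset ι)
    (h : ∃ Ψ ≠ 0, ∀ i ∉ s, D i Ψ = 0) : ∃ Ψ ≠ 0, ∀ i, D i Ψ = 0 := by
  classical
  induction s using Finset.induction_on with
  | empty => simpa using h
  | insert i s hi ih =>
    obtain ⟨Ψ, h0, h1⟩ := h
    have key : ∀ j ∉ s, j ≠ i → D j Ψ = 0 := fun j hj hji => h1 j (by simp [hj, hji])
    refine ih ?_
    by_cases h2 : D i Ψ = 0
    · refine ⟨Ψ, h0, fun j hj => ?_⟩
      by_cases hji : j = i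
      · rwa [hji]
      · exact key j hj hji
    · refine ⟨D i Ψ, h2, fun j hj => ?_⟩
      by_cases hji : j = i
      · rw [hji]
        exact eq_zero_of_eq_neg_self (hD.anticomm _ _ _)
      · rw [hD.anticomm, key j hj hji, map_zero, neg_zero]

/-- If the total occupation `∑ ‖D i Ω‖²` of the modes is finite in some state `Ω ≠ 0`, there is a
state in which all modes are empty. Off a finite set of modes the total is small, and the modes in
the finite set can be emptied one by one. -/
theorem exists_common_kernel {Ω : E} (h0 : Ω ≠ 0) (hs : Summable fun i => ‖D i Ω‖ ^ 2) :
    ∃ Ψ ≠ 0, ∀ i, D i Ψ = 0 := by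
  classical
  have hpos : 0 < ‖Ω‖ ^ 2 := by positivity
  obtain ⟨s, hs'⟩ := summable_iff_vanishing_norm.1 hs (‖Ω‖ ^ 2 / 2) (by positivity)
  refine hD.exists_common_kernel_of_compl s ?_
  obtain ⟨Ψ, h1, h2⟩ := (hD.restrict (· ∉ s)).exists_common_kernel_of_small (Ω := Ω)
    (C := ‖Ω‖ ^ 2 / 2) (by linarith) fun t => by
      have hd : Disjoint (t.map (Function.Embedding.subtype _)) s := by
        rw [Finset.disjoint_left]
        intro a ha
        obtain ⟨b, -, rfl⟩ := Finset.mem_map.1 ha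
        exact b.2
      have := hs' _ hd
      rw [Finset.sum_map] at this
      exact (le_abs_self _).trans this.le
  exact ⟨Ψ, h1, fun i hi => h2 ⟨i, hi⟩⟩

end IsFermionic

end Vacuum

/-! ### Hilbert-Schmidt operators -/

section HilbertSchmidt

open ContinuousLinearMap

variable {H H' : Type*} [NormedAddCommGroup H] [InnerProductSpace ℂ H] [CompleteSpace H]
  [NormedAddCommGroup H'] [InnerProductSpace ℂ H'] [CompleteSpace H']

theorem HilbertBasis.hasSum_norm_sq {ι : Type*} (b : HilbertBasis ι ℂ H) (x : H) :
    HasSum (fun i => ‖inner ℂ (b i) x‖ ^ 2) (‖x‖ ^ 2) := by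
  have h := b.hasSum_inner_mul_inner x x
  rw [inner_self_eq_norm_sq_to_K] at h
  have : ∀ i, inner ℂ x (b i) * inner ℂ (b i) x = ((‖inner ℂ (b i) x‖ ^ 2 : ℝ) : ℂ) := fun i => by
    rw [← inner_conj_symm, RCLike.conj_mul]; push_cast; rfl
  simp_rw [this] at h
  exact Complex.hasSum_ofReal.1 (by simpa using h)

/-- Parseval: square summability of an operator along any orthonormal family `e` follows from that
of its adjoint along an orthonormal basis. -/
theorem summable_norm_sq_of_adjoint {ι κ : Type*} {T : H →L[ℂ] H'} {e : ι → H}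
    (he : Orthonormal ℂ e) (d : HilbertBasis κ ℂ H')
    (h : Summable fun k => ‖adjoint T (d k)‖ ^ 2) : Summable fun i => ‖T (e i)‖ ^ 2 := by
  have key : ∀ i k, ‖inner ℂ (e i) (adjoint T (d k))‖ ^ 2 = ‖inner ℂ (d k) (T (e i))‖ ^ 2 :=
    fun i k => by rw [adjoint_inner_right, ← norm_inner_symm]
  have h1 : Summable fun p : κ × ι => ‖inner ℂ (e p.2) (adjoint T (d p.1))‖ ^ 2 := by
    have hnn : 0 ≤ fun p : κ × ι => ‖inner ℂ (e p.2) (adjoint T (d p.1))‖ ^ 2 :=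
      fun p => sq_nonneg _
    refine (summable_prod_of_nonneg hnn).2 ⟨fun k => ?_, ?_⟩
    · exact he.inner_products_summable (adjoint T (d k))
    · refine Summable.of_nonneg_of_le (fun k => ?_) (fun k => ?_) h
      · exact tsum_nonneg fun _ => sq_nonneg _
      · exact he.tsum_inner_products_le (adjoint T (d k))
  have h2 : Summable fun p : ι × κ => ‖inner ℂ (d p.2) (T (e p.1))‖ ^ 2 := by
    rw [← (Equiv.prodComm κ ι).summable_iff]
    refine h1.congr fun p => ?_
    exact key p.2 p.1
  have hnn : 0 ≤ fun p : ι × κ => ‖inner ℂ (d p.2) (T (e p.1))‖ ^ 2 := fun p => sq_nonneg _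
  exact ((summable_prod_of_nonneg hnn).1 h2).2.congr fun i => (d.hasSum_norm_sq (T (e i))).tsum_eq

/-- A Hilbert-Schmidt operator is square summable along every orthonormal family. -/
theorem IsHilbertSchmidt.summable {T : H →L[ℂ] H'} (hT : IsHilbertSchmidt T) {ι : Type*}
    {e : ι → H} (he : Orthonormal ℂ e) : Summable fun i => ‖T (e i)‖ ^ 2 := by
  obtain ⟨w, b, hb⟩ := hT
  obtain ⟨v, d, -⟩ := exists_hilbertBasis ℂ H'
  refine summable_norm_sq_of_adjoint he d (summable_norm_sq_of_adjoint d.orthonormal b ?_)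
  rwa [adjoint_adjoint]

theorem IsHilbertSchmidt.of_summable {T : H →L[ℂ] H'}
    (h : ∀ (w : Set H) (b : HilbertBasis w ℂ H), Summable fun i => ‖T (b i)‖ ^ 2) :
    IsHilbertSchmidt T := by
  obtain ⟨w, b, -⟩ := exists_hilbertBasis ℂ H
  exact ⟨w, b, h w b⟩

theorem IsHilbertSchmidt.sub {S T : H →L[ℂ] H'} (hS : IsHilbertSchmidt S)
    (hT : IsHilbertSchmidt T) : IsHilbertSchmidt (S - T) := .of_summable fun w b => by
  refine Summable.of_nonneg_of_le (fun i => by positivity) (fun i => ?_)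
    (((hS.summable b.orthonormal).add (hT.summable b.orthonormal)).mul_left 2)
  rw [_root_.sub_apply]
  have := norm_sub_le (S (b i)) (T (b i))
  nlinarith [sq_nonneg (‖S (b i)‖ - ‖T (b i)‖), norm_nonneg (S (b i) - T (b i))]

end HilbertSchmidt

/-! ### Lifts of unitary maps to Fock space -/

section Lift

open ContinuousLinearMap UniformSpace

universe u

variable {H : Type u} [NormedAddCommGroup H] [InnerProductSpace ℂ H] [CompleteSpace H]
  {E : Type*} [NormedAddCommGroup E] [InnerProductSpace ℂ E] [CompleteSpace E]

/-- The annihilators of particle states and the creators of sea states are fermionic modes. -/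
def modes (c : H → E →L[ℂ] E) {ι κ : Type*} (e : ι → H) (g : κ → H) : ι ⊕ κ → E →L[ℂ] E :=
  Sum.elim (fun i => adjoint (c (e i))) (fun k => c (g k))

theorem IsCAR.isFermionic_modes {c : H → E →L[ℂ] E} (hc : IsCAR c) {ι κ : Type*} {e : ι → H}
    {g : κ → H} (he : Orthonormal ℂ e) (hg : Orthonormal ℂ g)
    (heg : ∀ i k, inner ℂ (e i) (g k) = 0) :
    IsFermionic (modes c e g) := by
  classical
  have h1 : ∀ i k Φ, adjoint (c (e i)) (c (g k) Φ) = - c (g k) (adjoint (c (e i)) Φ) :=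
    fun i k Φ => by rw [hc.car, heg, zero_smul, zero_sub]
  constructor
  · rintro (i | k) (j | l) Φ
    · exact hc.adjoint_anticomm _ _ _
    · exact h1 _ _ _
    · change c (g k) (adjoint (c (e j)) Φ) = - adjoint (c (e j)) (c (g k) Φ)
      rw [h1, neg_neg]
    · exact hc.anticomm _ _ _
  · rintro (i | k) (j | l) Φ
    · change adjoint (c (e i)) (adjoint (adjoint (c (e j))) Φ) =
        _ - adjoint (adjoint (c (e j))) (adjoint (c (e i)) Φ)
      rw [adjoint_adjoint, hc.car, orthonormal_iff_ite.1 he]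
      by_cases h : i = j
      · simp [h]
      · simp [h]
    · change adjoint (c (e i)) (adjoint (c (g l)) Φ) =
        _ - adjoint (c (g l)) (adjoint (c (e i)) Φ)
      rw [hc.adjoint_anticomm, if_neg (by simp), zero_sub]
    · change c (g k) (adjoint (adjoint (c (e j))) Φ) =
        _ - adjoint (adjoint (c (e j))) (c (g k) Φ)
      rw [adjoint_adjoint, hc.anticomm, if_neg (by simp), zero_sub]
    · change c (g k) (adjoint (c (g l)) Φ) = _ - adjoint (c (g l)) (c (g k) Φ)
      rw [hc.car, orthonormal_iff_ite.1 hg]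
      by_cases h : k = l
      · simp [h]
      · simp [h, Ne.symm h]

theorem summable_sum_elim {ι κ : Type*} {f : ι ⊕ κ → ℝ} (h1 : Summable fun i => f (Sum.inl i))
    (h2 : Summable fun k => f (Sum.inr k)) : Summable f :=
  (HasSum.sum h1.hasSum h2.hasSum).summable

theorem HilbertBasis.eq_top_of_mem {W : Submodule ℂ H} {ι : Type*} (b : HilbertBasis ι ℂ W)
    {M : Submodule ℂ H} (hM : IsClosed (M : Set H)) (hb : ∀ i, (b i : H) ∈ M) : W ≤ M := by
  intro x hx
  have h := b.hasSum_repr ⟨x, hx⟩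
  have h2 : HasSum (fun i => (b.repr ⟨x, hx⟩ i • b i : H)) x := by
    simpa using h.mapL W.subtypeL
  exact hM.mem_of_tendsto h2 (Filter.Eventually.of_forall fun s =>
    sum_mem fun i _ => M.smul_mem _ (hb i))

/-- A vacuum vector of `V` exists if some state contains finitely many particles and holes with
respect to `V`, in the sense of the total occupation of orthonormal modes. -/
theorem IsCAR.exists_vacuum {c : H → E →L[ℂ] E} (hc : IsCAR c) (V : ClosedSubmodule ℂ H)
    {Ω : E} (h0 : Ω ≠ 0)
    (h1 : ∀ (ι : Type u) (e : ι → H), Orthonormal ℂ e → (∀ i, e i ∈ V.toSubmoduleᗮ) →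
      Summable fun i => ‖adjoint (c (e i)) Ω‖ ^ 2)
    (h2 : ∀ (ι : Type u) (e : ι → H), Orthonormal ℂ e → (∀ i, e i ∈ V.toSubmodule) →
      Summable fun i => ‖c (e i) Ω‖ ^ 2) :
    ∃ Ψ, inner ℂ Ψ Ψ = (1 : ℂ) ∧ IsVacuum c V.toSubmodule Ψ := by
  have : CompleteSpace V.toSubmodule := V.isClosed.completeSpace_coe
  obtain ⟨w, b, -⟩ := exists_hilbertBasis ℂ V.toSubmoduleᗮ
  obtain ⟨v, d, -⟩ := exists_hilbertBasis ℂ V.toSubmodule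
  have hb : Orthonormal ℂ fun i => (b i : H) :=
    b.orthonormal.comp_linearIsometry V.toSubmoduleᗮ.subtypeₗᵢ
  have hd : Orthonormal ℂ fun i => (d i : H) :=
    d.orthonormal.comp_linearIsometry V.toSubmodule.subtypeₗᵢ
  have hF := hc.isFermionic_modes hb hd fun i k =>
    Submodule.inner_left_of_mem_orthogonal (d k).2 (b i).2
  obtain ⟨Ψ, hΨ0, hΨ⟩ := hF.exists_common_kernel h0 (summable_sum_elim
    (h1 _ _ hb fun i => (b i).2) (h2 _ _ hd fun i => (d i).2))
  have hvac : IsVacuum c V.toSubmodule Ψ :=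
    ⟨b.eq_top_of_mem (hc.isClosed_killAnnihilation Ψ) fun i => hΨ (Sum.inl i),
      d.eq_top_of_mem (hc.isClosed_killCreation Ψ) fun i => hΨ (Sum.inr i)⟩
  have hn : (‖Ψ‖ : ℂ) ≠ 0 := by simpa using hΨ0
  refine ⟨(‖Ψ‖⁻¹ : ℂ) • Ψ, ?_, fun f hf => ?_, fun f hf => ?_⟩
  · rw [inner_smul_left, inner_smul_right, inner_self_eq_norm_sq_to_K]
    simp
    field_simp
  · rw [map_smul, hvac.particle f hf, smul_zero]
  · rw [map_smul, hvac.sea f hf, smul_zero]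

/-- The product vectors in Fock space. -/
def fockTensor (V : ClosedSubmodule ℂ H) : WedgeSpace V.toSubmoduleᗮ →ₗ[ℂ]
    WedgeSpace (ConjSpace V.toSubmodule) →ₗ[ℂ] FockSpace V :=
  (TensorProduct.mk ℂ _ _).compr₂ (Completion.toComplL (𝕜 := ℂ)).toLinearMap

/-- The annihilation operators on Fock space. -/
def annihilation (V : ClosedSubmodule ℂ H) (f : H) : FockSpace V →L[ℂ] FockSpace V :=
  ContinuousLinearMap.completion
    (TensorProduct.mapL (WedgeSpace.contraction (particlePart V f))
        (ContinuousLinearMap.id ℂ (WedgeSpace (ConjSpace V.toSubmodule))) +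
      TensorProduct.mapL (WedgeSpace.sign (K := V.toSubmoduleᗮ))
        (WedgeSpace.wedge (holePart V f)))

/-- The completed tensor product `⋀(Vᗮ) ⊗ ⋀(V̄)` is a Fock model. -/
theorem isFockModel_fockSpace (V : ClosedSubmodule ℂ H) :
    IsFockModel (fockTensor V) (creation V) (annihilation V) where
  inner_tmul x y x' y' := by
    change inner ℂ ((x ⊗ₜ[ℂ] y :
        WedgeSpace V.toSubmoduleᗮ ⊗[ℂ] WedgeSpace (ConjSpace V.toSubmodule)) : FockSpace V)
      ((x' ⊗ₜ[ℂ] y' :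
        WedgeSpace V.toSubmoduleᗮ ⊗[ℂ] WedgeSpace (ConjSpace V.toSubmodule)) : FockSpace V) = _
    rw [Completion.inner_coe, TensorProduct.inner_tmul]
  dense := by
    rw [← Submodule.dense_iff_topologicalClosure_eq_top]
    refine Completion.denseRange_coe.mono ?_
    rintro _ ⟨p, rfl⟩
    induction p using TensorProduct.induction_on with
    | zero => exact Submodule.zero_mem _
    | tmul x y => exact Submodule.subset_span ⟨x, y, rfl⟩
    | add p q hp hq =>
      rw [Completion.coe_add]
      exact Submodule.add_mem _ hp hq
  creation_tmul f x y := by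
    refine (ContinuousLinearMap.completion_apply_coe _ _).trans ?_
    rw [_root_.add_apply, Completion.coe_add]
    rfl
  annihilation_tmul f x y := by
    refine (ContinuousLinearMap.completion_apply_coe _ _).trans ?_
    rw [_root_.add_apply, Completion.coe_add]
    rfl

variable {H' : Type*} [NormedAddCommGroup H'] [InnerProductSpace ℂ H'] [CompleteSpace H']
  {E' : Type*} [NormedAddCommGroup E'] [InnerProductSpace ℂ E'] [CompleteSpace E']

/-- The Shale-Stinespring criterion. The vacuum of `W` has finite total occupation with respect to
`U V`, by the Hilbert-Schmidt condition; so the representation `c' ∘ U` has a vacuum vector for `V`,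
and by irreducibility this vector generates a Fock model of `V`. -/
theorem IsFockModel.exists_lift {V : ClosedSubmodule ℂ H} {W : ClosedSubmodule ℂ H'}
    {T : WedgeSpace V.toSubmoduleᗮ →ₗ[ℂ] WedgeSpace (ConjSpace V.toSubmodule) →ₗ[ℂ] E}
    {c a : H → E →L[ℂ] E} (hT : IsFockModel T c a)
    {T' : WedgeSpace W.toSubmoduleᗮ →ₗ[ℂ] WedgeSpace (ConjSpace W.toSubmodule) →ₗ[ℂ] E'}
    {c' a' : H' → E' →L[ℂ] E'} (hT' : IsFockModel T' c' a') (U : H ≃ₗᵢ[ℂ] H')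
    (hHS : IsHilbertSchmidt ((W.toSubmodule.starProjection).comp (U : H →L[ℂ] H') -
      (U : H →L[ℂ] H').comp V.toSubmodule.starProjection)) :
    ∃ L : E ≃ₗᵢ[ℂ] E', ∀ f Φ, L (c f Φ) = c' (U f) (L Φ) := by
  have hc : IsCAR fun f => c' (U f) := hT'.isCAR.comp U.toLinearIsometry
  have h0 : T' WedgeSpace.vac WedgeSpace.vac ≠ 0 := fun h => by
    have := hT'.norm_vacuum
    rw [h, norm_zero] at this
    exact zero_ne_one this
  obtain ⟨Ψ, h1, h2⟩ := hc.exists_vacuum V h0 (fun ι e he hV => by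
      -- On `Vᗮ` the Hilbert-Schmidt operator is `P^W U`.
      refine (hHS.summable he).congr fun i => ?_
      rw [hT'.adjoint_creation, hT'.norm_annihilation_vacuum]
      have : V.toSubmodule.starProjection (e i) = 0 := by
        rw [Submodule.starProjection_apply_eq_zero_iff]; exact hV i
      simp [this])
    (fun ι e he hV => by
      -- On `V` it is `P^W U - U`, which is minus the component along `Wᗮ`.
      refine (hHS.summable he).congr fun i => ?_
      rw [hT'.norm_creation_vacuum]
      have : V.toSubmodule.starProjection (e i) = e i :=
        Submodule.starProjection_eq_self_iff.2 (hV i)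
      have e2 := W.toSubmodule.starProjection_add_starProjection_orthogonal (U (e i))
      rw [← norm_neg]
      congr 2
      rw [← sub_eq_iff_eq_add'.2 e2.symm]
      simp [this])
  have hM := hc.isFockModel_productState h2 h1 fun B hB hB' =>
    hT'.eq_smul_of_commute B (fun f Φ => by
      have := hB (U.symm f) Φ
      simpa using this) (fun f Φ => by
      have := hB' (U.symm f) Φ
      simp only [U.apply_symm_apply, hT'.adjoint_creation] at this
      exact this)
  exact hT.exists_intertwiner hM

/-- Two lifts differ by a unitary operator which commutes with the creation operators, a phase by
Schur's lemma. -/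
theorem IsFockModel.lift_unique {V : ClosedSubmodule ℂ H}
    {T : WedgeSpace V.toSubmoduleᗮ →ₗ[ℂ] WedgeSpace (ConjSpace V.toSubmodule) →ₗ[ℂ] E}
    {c a : H → E →L[ℂ] E} (hT : IsFockModel T c a) {c' : H → E' →L[ℂ] E'} {L L' : E ≃ₗᵢ[ℂ] E'}
    (hL : ∀ f Φ, L (c f Φ) = c' f (L Φ)) :
    (∀ f Φ, L' (c f Φ) = c' f (L' Φ)) ↔
      ∃ θ : ℝ, ∀ Φ, L' Φ = Complex.exp (θ * Complex.I) • L Φ := by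
  constructor
  · intro hL'
    let B : E ≃ₗᵢ[ℂ] E := L'.trans L.symm
    have hB : ∀ f Φ, B (c f Φ) = c f (B Φ) := fun f Φ => by
      change L.symm (L' (c f Φ)) = c f (L.symm (L' Φ))
      rw [hL', L.symm_apply_eq, hL, L.apply_symm_apply]
    obtain ⟨z, hz⟩ := hT.eq_smul_of_commute (B : E →L[ℂ] E) hB fun f Φ => by
      change B (a f Φ) = a f (B Φ)
      refine ext_inner_right ℂ fun v => ?_
      obtain ⟨v, rfl⟩ := B.surjective v
      rw [B.inner_map_map, hT.inner_annihilation_left, hT.inner_annihilation_left, ← hB,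
        B.inner_map_map]
    have hz1 : ‖z‖ = 1 := by
      have h := hz (T WedgeSpace.vac WedgeSpace.vac)
      have h2 := congrArg norm h
      rw [norm_smul, hT.norm_vacuum, mul_one] at h2
      rw [← h2]
      exact (B.norm_map _).trans hT.norm_vacuum
    refine ⟨z.arg, fun Φ => ?_⟩
    have e : Complex.exp (z.arg * Complex.I) = z := by
      have := Complex.norm_mul_exp_arg_mul_I z
      rwa [hz1, Complex.ofReal_one, one_mul] at this
    rw [e, ← map_smul, ← L.symm_apply_eq]
    exact hz Φ
  · rintro ⟨θ, h⟩ f Φ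
    rw [h, h, hL, map_smul]

/-- Existence and uniqueness of the lift of `U`, under the Shale-Stinespring condition that `U V`
and `W` are Hilbert-Schmidt close. -/
theorem exists_lift_unique (V : ClosedSubmodule ℂ H) (W : ClosedSubmodule ℂ H') (U : H ≃ₗᵢ[ℂ] H')
    (hHS : IsHilbertSchmidt ((W.toSubmodule.starProjection).comp (U : H →L[ℂ] H') -
      (U : H →L[ℂ] H').comp V.toSubmodule.starProjection)) :
    ∃ L : FockSpace V ≃ₗᵢ[ℂ] FockSpace W, IsLift V W (U : H →L[ℂ] H') L ∧
      ∀ L' : FockSpace V ≃ₗᵢ[ℂ] FockSpace W, IsLift V W (U : H →L[ℂ] H') L' ↔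
        ∃ θ : ℝ, ∀ Φ : FockSpace V, L' Φ = Complex.exp (θ * Complex.I) • L Φ := by
  have key : ∀ L : FockSpace V ≃ₗᵢ[ℂ] FockSpace W, IsLift V W (U : H →L[ℂ] H') L ↔
      ∀ f Φ, L (creation V f Φ) = creation W (U f) (L Φ) := fun L =>
    ⟨fun h f Φ => by
      have := h f (L Φ)
      rwa [L.symm_apply_apply] at this, fun h f Φ => by
      have := h f (L.symm Φ)
      rwa [L.apply_symm_apply] at this⟩
  obtain ⟨L, hL⟩ := (isFockModel_fockSpace V).exists_lift (isFockModel_fockSpace W) U hHS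
  refine ⟨L, (key L).2 hL, fun L' => (key L').trans ?_⟩
  exact (isFockModel_fockSpace V).lift_unique (c' := fun f => creation W (U f)) hL

end Lift

/-! ### Cauchy surfaces as graphs -/

section Graphs

open Filter Topology

/-- Space-time as the product of time and space. -/
def eventEquiv : (ℝ × Space) ≃L[ℝ] Spacetime :=
  LinearEquiv.toContinuousLinearEquiv
    { toFun := fun p => eventAt p.1 p.2
      invFun := fun z => (z 0, WithLp.toLp 2 ![z 1, z 2, z 3])
      map_add' := fun p q => by ext i; fin_cases i <;> simp [eventAt]
      map_smul' := fun z p => by ext i; fin_cases i <;> simp [eventAt]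
      left_inv := fun p => by
        refine Prod.ext rfl ?_
        ext i; fin_cases i <;> simp [eventAt]
      right_inv := fun z => by ext i; fin_cases i <;> simp [eventAt] }

/-- The position of an event. -/
def position (z : Spacetime) : Space := (eventEquiv.symm z).2

@[simp] theorem eventAt_position (z : Spacetime) : eventAt (z 0) (position z) = z :=
  eventEquiv.apply_symm_apply z

@[simp] theorem position_eventAt (t : ℝ) (x : Space) : position (eventAt t x) = x :=
  congrArg Prod.snd (eventEquiv.symm_apply_apply (t, x))

@[simp] theorem eventAt_zero (t : ℝ) (x : Space) : eventAt t x 0 = t := rfl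

theorem eventAt_add (t s : ℝ) (x y : Space) :
    eventAt (t + s) (x + y) = eventAt t x + eventAt s y := map_add eventEquiv (t, x) (s, y)

theorem eventAt_sub (t s : ℝ) (x y : Space) :
    eventAt (t - s) (x - y) = eventAt t x - eventAt s y := map_sub eventEquiv (t, x) (s, y)

theorem eventAt_smul (c t : ℝ) (x : Space) : eventAt (c * t) (c • x) = c • eventAt t x :=
  map_smul eventEquiv c (t, x)

theorem continuous_position : Continuous position :=
  continuous_snd.comp eventEquiv.symm.continuous

theorem Continuous.eventAt {X : Type*} [TopologicalSpace X] {f : X → ℝ} {g : X → Space}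
    (hf : Continuous f) (hg : Continuous g) : Continuous fun x => eventAt (f x) (g x) :=
  eventEquiv.continuous.comp (hf.prodMk hg)

theorem minkowskiSq_eventAt (t : ℝ) (x : Space) : minkowskiSq (eventAt t x) = t ^ 2 - ‖x‖ ^ 2 := by
  rw [EuclideanSpace.norm_sq_eq]
  simp [minkowskiSq, eventAt, Fin.sum_univ_three]
  ring

namespace CauchySurface

variable (S : CauchySurface)

theorem chart_sub (x y : Space) : S.chart y - S.chart x = eventAt (S.height y - S.height x) (y - x) :=
  (eventAt_sub _ _ _ _).symm

theorem mem_iff (t : ℝ) (x : Space) : eventAt t x ∈ S.carrier ↔ t = S.height x := by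
  constructor
  · intro h
    have := congrFun (S.eq_chart h) 0
    have e : (WithLp.toLp 2 ![eventAt t x 1, eventAt t x 2, eventAt t x 3] : Space) = x :=
      position_eventAt t x
    rw [e] at this
    exact this
  · rintro rfl
    exact S.chart_mem x

theorem height_sub_lt_of_ne {x y : Space} (hxy : x ≠ y) :
    S.height y - S.height x < ‖y - x‖ := by
  have hpos : 0 < ‖y - x‖ := norm_pos_iff.2 (sub_ne_zero.2 hxy.symm)
  by_contra! h
  have h0 : 0 < (S.chart y - S.chart x) 0 := by
    rw [chart_sub, eventAt_zero]; linarith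
  have := S.mem_unique (S.chart_mem x) (S.chart_mem y) h0
  rw [chart_sub, minkowskiSq_eventAt] at this
  nlinarith

theorem height_sub_le (x y : Space) : S.height y - S.height x ≤ ‖y - x‖ := by
  by_cases h : x = y
  · simp [h]
  · exact (S.height_sub_lt_of_ne h).le

theorem abs_height_sub_le (x y : Space) : |S.height y - S.height x| ≤ ‖y - x‖ := by
  rw [abs_le]
  have := S.height_sub_le y x
  rw [norm_sub_rev] at this
  exact ⟨by linarith, S.height_sub_le x y⟩

theorem lipschitzWith_height : LipschitzWith 1 S.height :=
  LipschitzWith.of_dist_le_mul fun x y => by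
    rw [NNReal.coe_one, one_mul, Real.dist_eq, dist_eq_norm]
    exact S.abs_height_sub_le y x

theorem continuous_height : Continuous S.height := S.lipschitzWith_height.continuous

theorem continuous_chart : Continuous S.chart := S.continuous_height.eventAt continuous_id

theorem norm_chart_sub_isBigO (x : Space) :
    (fun y => S.chart y - S.chart x) =O[𝓝 x] fun y => y - x := by
  have h1 : (fun y => S.chart y - S.chart x) =
      fun y => eventEquiv (S.height y - S.height x, y - x) := funext fun y => S.chart_sub x y
  rw [h1]
  refine (eventEquiv.toContinuousLinearMap.isBigO_comp _ _).trans
    (Asymptotics.IsBigO.of_bound 1 (Eventually.of_forall fun y => ?_))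
  rw [Prod.norm_mk, one_mul]
  exact max_le (S.abs_height_sub_le x y) le_rfl

/-- The inclusion of space in space-time at time zero. -/
def spaceIncl : Space →L[ℝ] Spacetime :=
  eventEquiv.toContinuousLinearMap.comp (ContinuousLinearMap.inr ℝ ℝ Space)

theorem eventAt_eq (t : ℝ) (x : Space) :
    eventAt t x = t • (Pi.single 0 1 : Spacetime) + spaceIncl x := by
  ext i; fin_cases i <;> simp [eventAt, spaceIncl, eventEquiv]

/-- Implicit differentiation of `g (S.chart y) = 0`; the Lipschitz bound on the height function
makes the remainder small. -/
theorem isLittleO_height {g : Spacetime → ℝ} {x : Space} (hg : DifferentiableAt ℝ g (S.chart x))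
    (hz : ∀ᶠ y in 𝓝 x, g (S.chart y) = 0) :
    (fun y => (S.height y - S.height x) * fderiv ℝ g (S.chart x) (Pi.single 0 1) +
      fderiv ℝ g (S.chart x) (spaceIncl (y - x))) =o[𝓝 x] fun y => y - x := by
  have h1 := (hg.hasFDerivAt.isLittleO.comp_tendsto (S.continuous_chart.tendsto x)).trans_isBigO
    (S.norm_chart_sub_isBigO x)
  refine (h1.neg_left).congr' ?_ EventuallyEq.rfl
  filter_upwards [hz] with y hy
  simp only [Function.comp_apply]
  rw [hy, hz.self_of_nhds, chart_sub, eventAt_eq, map_add, map_smul, smul_eq_mul]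
  ring

/-- A defining function of the surface has a nonvanishing time derivative: the surface is a graph,
so that a defining function without time derivative would have vanishing differential. -/
theorem fderiv_time_ne_zero {g : Spacetime → ℝ} {x : Space} (hg : DifferentiableAt ℝ g (S.chart x))
    (hz : ∀ᶠ y in 𝓝 x, g (S.chart y) = 0) (hne : fderiv ℝ g (S.chart x) ≠ 0) :
    fderiv ℝ g (S.chart x) (Pi.single 0 1) ≠ 0 := by
  intro h0
  have h1 := S.isLittleO_height hg hz
  rw [h0] at h1
  simp only [mul_zero, zero_add] at h1
  have h2 : HasFDerivAt (fun _ : Space => (0 : ℝ)) ((fderiv ℝ g (S.chart x)).comp spaceIncl) x := by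
    refine HasFDerivAt.of_isLittleO (h1.neg_left.congr_left fun y => ?_)
    simp
  have h3 := h2.unique (hasFDerivAt_const (0 : ℝ) x)
  refine hne (ContinuousLinearMap.ext fun z => ?_)
  rw [← eventAt_position z, eventAt_eq, map_add, map_smul, h0, smul_zero, zero_add]
  exact DFunLike.congr_fun h3 _

theorem hasFDerivAt_height {g : Spacetime → ℝ} {x : Space} (hg : DifferentiableAt ℝ g (S.chart x))
    (hz : ∀ᶠ y in 𝓝 x, g (S.chart y) = 0) (hne : fderiv ℝ g (S.chart x) (Pi.single 0 1) ≠ 0) :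
    HasFDerivAt S.height (-(fderiv ℝ g (S.chart x) (Pi.single 0 1))⁻¹ •
      (fderiv ℝ g (S.chart x)).comp spaceIncl) x := by
  refine HasFDerivAt.of_isLittleO (((S.isLittleO_height hg hz).const_mul_left
    (fderiv ℝ g (S.chart x) (Pi.single 0 1))⁻¹).congr_left fun y => ?_)
  simp
  field_simp

/-- Near every point, the differential of the height function is given by that of a smooth local
defining function. -/
theorem exists_local_function (x : Space) : ∃ g : Spacetime → ℝ, ∃ O : Set Space, IsOpen O ∧
    x ∈ O ∧ ∀ y ∈ O, HasFDerivAt S.height (-(fderiv ℝ g (S.chart y) (Pi.single 0 1))⁻¹ •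
      (fderiv ℝ g (S.chart y)).comp spaceIncl) y ∧
      fderiv ℝ g (S.chart y) (Pi.single 0 1) ≠ 0 ∧ ContinuousAt (fderiv ℝ g) (S.chart y) := by
  obtain ⟨O, hO, hx, g, hg, hne, hz⟩ := S.smooth _ (S.chart_mem x)
  refine ⟨g, S.chart ⁻¹' O, hO.preimage S.continuous_chart, hx, fun y hy => ?_⟩
  have hd : ContDiffAt ℝ ∞ g (S.chart y) := hg.contDiffAt (hO.mem_nhds hy)
  have h1 : DifferentiableAt ℝ g (S.chart y) := hd.differentiableAt (by simp)
  have h2 : ∀ᶠ y' in 𝓝 y, g (S.chart y') = 0 := by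
    filter_upwards [(hO.preimage S.continuous_chart).mem_nhds hy] with y' hy'
    exact (hz _ hy').1 (S.chart_mem y')
  have h3 := S.fderiv_time_ne_zero h1 h2 (hne _ hy)
  exact ⟨S.hasFDerivAt_height h1 h2 h3, h3,
    (hd.fderiv_right (m := 0) (by simp)).continuousAt⟩

theorem contDiff_height : ContDiff ℝ 1 S.height := by
  rw [contDiff_one_iff_fderiv]
  refine ⟨fun x => ?_, continuous_iff_continuousAt.2 fun x => ?_⟩
  · obtain ⟨g, O, -, hx, h⟩ := S.exists_local_function x
    exact (h x hx).1.differentiableAt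
  · obtain ⟨g, O, hO, hx, h⟩ := S.exists_local_function x
    have hc : ContinuousAt (fun y => fderiv ℝ g (S.chart y)) x :=
      (h x hx).2.2.comp S.continuous_chart.continuousAt
    have h1 : ContinuousAt (fun y => -(fderiv ℝ g (S.chart y) (Pi.single 0 1))⁻¹ •
        (fderiv ℝ g (S.chart y)).comp spaceIncl) x := by
      have hc0 : ContinuousAt (fun y => fderiv ℝ g (S.chart y) (Pi.single 0 1)) x :=
        hc.clm_apply continuousAt_const
      exact (hc0.inv₀ (h x hx).2.1).neg.smul (hc.clm_comp continuousAt_const)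
    refine h1.congr ?_
    filter_upwards [hO.mem_nhds hx] with y hy
    exact (h y hy).1.fderiv.symm

/-- A null line meets the Cauchy surface. -/
theorem exists_height_ray (t : ℝ) {w : Space} (hw : ‖w‖ = 1) : ∃ r : ℝ, S.height (r • w) = t + r := by
  obtain ⟨p, ⟨⟨s, hs⟩, hp⟩, -⟩ := S.existsUnique_mem _
    (isInextensibleCausalPath_line (eventAt t 0) (eventAt 1 w) (by simp)
      (by rw [minkowskiSq_eventAt, hw]; simp))
  refine ⟨s, ?_⟩
  have : eventAt (t + s) (s • w) = p := by
    rw [← hs]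
    have := eventAt_smul s 1 w
    rw [mul_one] at this
    simp only
    rw [← this, ← eventAt_add, zero_add]
  rw [← this] at hp
  exact ((S.mem_iff _ _).1 hp).symm

/-- For `ε = 1` and `ε = -1` these are the parts of the surface in the causal future and past of a
ball. If such a part were unbounded, compactness of the sphere would give a direction `w` along
which the surface stays on one side of a null line. -/
theorem isBounded_cone_of_sign {ε : ℝ} (hε : ε * ε = 1) (R : ℝ) :
    Bornology.IsBounded {x | ‖x‖ ≤ R + ε * S.height x} := by
  have habs : |ε| = 1 := by
    have : |ε| * |ε| = 1 := by rw [← abs_mul, hε, abs_one]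
    nlinarith [abs_nonneg ε]
  have hmono : ∀ x y, ε * S.height x ≤ ε * S.height y + ‖x - y‖ := fun x y => by
    have h := S.abs_height_sub_le y x
    have : ε * (S.height x - S.height y) ≤ |S.height x - S.height y| := by
      refine (le_abs_self _).trans ?_
      rw [abs_mul, habs, one_mul]
    linarith
  by_contra hcon
  let K : ℕ → Set Space := fun n =>
    Metric.sphere 0 1 ∩ {w | (n : ℝ) - R ≤ ε * S.height ((n : ℝ) • w)}
  have hclosed : ∀ n : ℕ, IsClosed {w : Space | (n : ℝ) - R ≤ ε * S.height ((n : ℝ) • w)} := fun n =>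
    isClosed_le continuous_const (continuous_const.mul (S.continuous_height.comp (by fun_prop)))
  -- If the surface is above the null line at distance `b`, it is so at every smaller distance, by
  -- the Lipschitz bound.
  have hstep : ∀ (a b : ℝ) (w : Space), ‖w‖ = 1 → a ≤ b → b - R ≤ ε * S.height (b • w) →
      a - R ≤ ε * S.height (a • w) := fun a b w hw hab h => by
    have := hmono (b • w) (a • w)
    rw [← sub_smul, norm_smul, hw, mul_one, Real.norm_of_nonneg (by linarith)] at this
    linarith
  obtain ⟨w, hw⟩ := IsCompact.nonempty_iInter_of_sequence_nonempty_isCompact_isClosed K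
    (fun n w hw => ⟨hw.1, hstep n (n + 1 : ℕ) w (by simpa using hw.1) (by push_cast; linarith) hw.2⟩)
    (fun n => by
      by_contra hemp
      refine hcon ((Metric.isBounded_closedBall (x := (0 : Space)) (r := n)).subset fun x hx => ?_)
      by_contra hxn
      rw [mem_closedBall_zero_iff, not_le] at hxn
      have hx0 : 0 < ‖x‖ := lt_of_le_of_lt (Nat.cast_nonneg n) hxn
      have hu : ‖‖x‖⁻¹ • x‖ = 1 := by
        rw [norm_smul, norm_inv, norm_norm, inv_mul_cancel₀ hx0.ne']
      refine hemp ⟨‖x‖⁻¹ • x, by simpa using hu, hstep n ‖x‖ _ hu hxn.le ?_⟩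
      rw [smul_smul, mul_inv_cancel₀ hx0.ne', one_smul]
      simp only [Set.mem_ofPred_eq] at hx
      linarith)
    ((isCompact_sphere 0 1).inter_right (hclosed 0))
    (fun n => Metric.isClosed_sphere.inter (hclosed n))
  rw [Set.mem_iInter] at hw
  have hw1 : ‖w‖ = 1 := by simpa using (hw 0).1
  -- For `ε = 1`, the null line through the event `(-(R + 1), 0)` in the direction `w` runs strictly
  -- below the surface, which lies above the parallel line through `(-R, 0)`.
  obtain ⟨r, hr⟩ := S.exists_height_ray (-ε * (R + 1)) (w := ε • w)
    (by rw [norm_smul, Real.norm_eq_abs, habs, hw1, one_mul])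
  obtain ⟨n, hn⟩ := exists_nat_ge (r * ε)
  have h1 := hstep (r * ε) n w hw1 hn (hw n).2
  rw [mul_smul, hr] at h1
  have : ε * (-ε * (R + 1) + r) = -(ε * ε) * (R + 1) + r * ε := by ring
  rw [this, hε] at h1
  linarith

/-- The part of a Cauchy surface in the domain of influence of a ball is bounded: otherwise a null
line would miss the surface. -/
theorem isBounded_cone (R : ℝ) : Bornology.IsBounded {x | ‖x‖ ≤ R + |S.height x|} := by
  refine ((S.isBounded_cone_of_sign (ε := 1) (by norm_num) R).union
    (S.isBounded_cone_of_sign (ε := -1) (by norm_num) R)).subset fun x hx => ?_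
  simp only [Set.mem_ofPred_eq, Set.mem_union] at hx ⊢
  rcases abs_choice (S.height x) with h | h <;> rw [h] at hx
  · left; linarith
  · right; linarith

theorem height_flatSurface (x : Space) : flatSurface.height x = 0 := flatSurface.chart_mem x

end CauchySurface

end Graphs

/-! ### The divergence theorem between graphs -/

section Gauss

open Filter Topology

theorem spaceIncl_single (i : Fin 3) :
    CauchySurface.spaceIncl (EuclideanSpace.single i 1) = (Pi.single i.succ 1 : Spacetime) := by
  rw [show CauchySurface.spaceIncl (EuclideanSpace.single i 1) =
    eventAt 0 (EuclideanSpace.single i 1) from rfl]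
  ext j; fin_cases i <;> fin_cases j <;> simp [eventAt]

/-- The partial derivative `∂_μ f` on space-time. -/
def pd {F : Type*} [NormedAddCommGroup F] [NormedSpace ℝ F] (μ : Fin 4) (f : Spacetime → F)
    (z : Spacetime) : F := fderiv ℝ f z (Pi.single μ 1)

/-- The partial derivative `∂_i f` on space. -/
def sd {F : Type*} [NormedAddCommGroup F] [NormedSpace ℝ F] (i : Fin 3) (f : Space → F)
    (x : Space) : F := fderiv ℝ f x (EuclideanSpace.single i 1)

theorem continuous_pd {F : Type*} [NormedAddCommGroup F] [NormedSpace ℝ F] {f : Spacetime → F}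
    (hf : ContDiff ℝ 1 f) (μ : Fin 4) : Continuous (pd μ f) :=
  (hf.continuous_fderiv (by simp)).clm_apply continuous_const

theorem continuous_sd {F : Type*} [NormedAddCommGroup F] [NormedSpace ℝ F] {f : Space → F}
    (hf : ContDiff ℝ 1 f) (i : Fin 3) : Continuous (sd i f) :=
  (hf.continuous_fderiv (by simp)).clm_apply continuous_const

theorem contDiff_graph {h : Space → ℝ} (hh : ContDiff ℝ 1 h) :
    ContDiff ℝ 1 fun x => eventAt (h x) x :=
  eventEquiv.contDiff.comp (hh.prodMk contDiff_id)

/-- The chain rule for the restriction of `f` to the graph of `h`. -/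
theorem sd_comp_graph {f : Spacetime → ℝ} (hf : ContDiff ℝ 1 f) {h : Space → ℝ}
    (hh : ContDiff ℝ 1 h) (i : Fin 3) (x : Space) :
    sd i (fun y => f (eventAt (h y) y)) x =
      sd i h x * pd 0 f (eventAt (h x) x) + pd i.succ f (eventAt (h x) x) := by
  have h1 : HasFDerivAt h (fderiv ℝ h x) x := (hh.differentiable (by simp) x).hasFDerivAt
  have h2 : HasFDerivAt (fun y => eventAt (h y) y) (eventEquiv.toContinuousLinearMap.comp
      ((fderiv ℝ h x).prod (ContinuousLinearMap.id ℝ Space))) x :=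
    eventEquiv.toContinuousLinearMap.hasFDerivAt.comp x (h1.prodMk (hasFDerivAt_id x))
  have h3 : HasFDerivAt f (fderiv ℝ f (eventAt (h x) x)) (eventAt (h x) x) :=
    (hf.differentiable (by simp) _).hasFDerivAt
  have h4 : HasFDerivAt (fun y => f (eventAt (h y) y)) _ x := HasFDerivAt.comp
    (f := fun y => eventAt (h y) y) x h3 h2
  rw [sd, h4.fderiv]
  change fderiv ℝ f (eventAt (h x) x)
    (eventAt (fderiv ℝ h x (EuclideanSpace.single i 1)) (EuclideanSpace.single i 1)) = _
  rw [CauchySurface.eventAt_eq (fderiv ℝ h x _), map_add, map_smul, spaceIncl_single]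
  rfl

theorem hasDerivAt_graph {f : Spacetime → ℝ} (hf : ContDiff ℝ 1 f) (a b τ : ℝ) (x : Space) :
    HasDerivAt (fun τ => f (eventAt (a + τ * b) x)) (b * pd 0 f (eventAt (a + τ * b) x)) τ := by
  have h1 : HasDerivAt (fun τ => eventAt (a + τ * b) x) (b • Pi.single 0 1) τ := by
    have : (fun τ => eventAt (a + τ * b) x) =
        fun τ : ℝ => (a + τ * b) • (Pi.single 0 1 : Spacetime) + CauchySurface.spaceIncl x :=
      funext fun τ => CauchySurface.eventAt_eq _ _
    rw [this]
    refine HasDerivAt.add_const _ (HasDerivAt.smul_const ?_ _)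
    simpa using ((hasDerivAt_id τ).mul_const b).const_add a
  have h3 : HasFDerivAt f (fderiv ℝ f (eventAt (a + τ * b) x)) (eventAt (a + τ * b) x) :=
    (hf.differentiable (by simp) _).hasFDerivAt
  have := h3.comp_hasDerivAt τ h1
  rwa [map_smul] at this

theorem integral_sd_eq_zero {f : Space → ℝ} (hf : ContDiff ℝ 1 f) (hc : HasCompactSupport f)
    (i : Fin 3) : ∫ x, sd i f x = 0 := by
  have hc' : HasCompactSupport (sd i f) := hc.fderiv_apply (𝕜 := ℝ) _
  have h := integral_mul_fderiv_eq_neg_fderiv_mul_of_integrable (μ := (volume : Measure Space))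
    (f := fun _ => (1 : ℝ)) (g := f) (v := EuclideanSpace.single i 1) (by simp)
    (by
      simp only [one_mul]
      exact (continuous_sd hf i).integrable_of_hasCompactSupport hc')
    (by simpa using hf.continuous.integrable_of_hasCompactSupport hc)
    (fun x _ => differentiableAt_const _) (fun x _ => hf.differentiable (by simp) x)
  simpa [sd] using h

/-- The flux of the vector field `J` through the graph of `h`. -/
def flux (J : Fin 4 → Spacetime → ℝ) (h : Space → ℝ) : ℝ :=
  ∫ x, (J 0 (eventAt (h x) x) - ∑ i : Fin 3, sd i h x * J i.succ (eventAt (h x) x))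

/-- The divergence `∂_μ J^μ`. -/
def divergence (J : Fin 4 → Spacetime → ℝ) (z : Spacetime) : ℝ := ∑ μ, pd μ (J μ) z

theorem divergence_eq (J : Fin 4 → Spacetime → ℝ) (z : Spacetime) :
    divergence J z = pd 0 (J 0) z + ∑ i : Fin 3, pd i.succ (J i.succ) z := Fin.sum_univ_succ _

/-- The derivative of the flux through a moving graph is the integral of the divergence over it. -/
theorem hasDerivAt_flux {J : Fin 4 → Spacetime → ℝ} (hJ : ∀ μ, ContDiff ℝ 1 (J μ))
    {h k : Space → ℝ} (hh : ContDiff ℝ 1 h) (hk : ContDiff ℝ 1 k) {K : Set Space}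
    (hK : IsCompact K) {τ₀ δ : ℝ} (hδ : 0 < δ)
    (hJK : ∀ τ ∈ Metric.ball τ₀ δ, ∀ x ∉ K, ∀ μ, J μ (eventAt (h x + τ * k x) x) = 0) :
    HasDerivAt (fun τ => flux J fun x => h x + τ * k x)
      (∫ x, k x * divergence J (eventAt (h x + τ₀ * k x) x)) τ₀ := by
  have hH : ∀ τ : ℝ, ContDiff ℝ 1 fun x => h x + τ * k x := fun τ => hh.add (contDiff_const.mul hk)
  have hsd : ∀ (τ : ℝ) i x, sd i (fun x => h x + τ * k x) x = sd i h x + τ * sd i k x := by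
    intro τ i x
    have h1 : HasFDerivAt h (fderiv ℝ h x) x := (hh.differentiable (by simp) x).hasFDerivAt
    have h2 : HasFDerivAt k (fderiv ℝ k x) x := (hk.differentiable (by simp) x).hasFDerivAt
    have h3 : HasFDerivAt (fun x => h x + τ * k x) _ x := h1.add (h2.const_mul τ)
    rw [sd, h3.fderiv]
    rfl
  let F : ℝ → Space → ℝ := fun τ x => J 0 (eventAt (h x + τ * k x) x) -
    ∑ i : Fin 3, sd i (fun x => h x + τ * k x) x * J i.succ (eventAt (h x + τ * k x) x)
  let F' : ℝ → Space → ℝ := fun τ x => k x * pd 0 (J 0) (eventAt (h x + τ * k x) x) -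
    ∑ i : Fin 3, (sd i k x * J i.succ (eventAt (h x + τ * k x) x) +
      sd i (fun x => h x + τ * k x) x * (k x * pd 0 (J i.succ) (eventAt (h x + τ * k x) x)))
  have hev : Continuous fun p : ℝ × Space => eventAt (h p.2 + p.1 * k p.2) p.2 := by
    have := hh.continuous
    have := hk.continuous
    exact Continuous.eventAt (by fun_prop) continuous_snd
  have hJc : ∀ μ, Continuous fun p : ℝ × Space => J μ (eventAt (h p.2 + p.1 * k p.2) p.2) :=
    fun μ => (hJ μ).continuous.comp hev
  have hpc : ∀ μ, Continuous fun p : ℝ × Space => pd 0 (J μ) (eventAt (h p.2 + p.1 * k p.2) p.2) :=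
    fun μ => (continuous_pd (hJ μ) 0).comp hev
  have hkc : Continuous fun p : ℝ × Space => k p.2 := hk.continuous.comp continuous_snd
  have hskc : ∀ i, Continuous fun p : ℝ × Space => sd i k p.2 :=
    fun i => (continuous_sd hk i).comp continuous_snd
  have hshc : ∀ i, Continuous fun p : ℝ × Space => sd i h p.2 :=
    fun i => (continuous_sd hh i).comp continuous_snd
  have hsc : ∀ i, Continuous fun p : ℝ × Space => sd i (fun x => h x + p.1 * k x) p.2 := fun i => by
    simp_rw [hsd]
    exact (hshc i).add (continuous_fst.mul (hskc i))
  have hFc : Continuous fun p : ℝ × Space => F p.1 p.2 :=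
    (hJc 0).sub (continuous_finsetSum _ fun i _ => (hsc i).mul (hJc _))
  have hFc' : Continuous fun p : ℝ × Space => F' p.1 p.2 :=
    (hkc.mul (hpc 0)).sub (continuous_finsetSum _ fun i _ =>
      ((hskc i).mul (hJc _)).add ((hsc i).mul (hkc.mul (hpc _))))
  have hFτ : ∀ τ, Continuous (F τ) := fun τ => hFc.comp (continuous_const.prodMk continuous_id)
  have hFτ' : ∀ τ, Continuous (F' τ) := fun τ => hFc'.comp (continuous_const.prodMk continuous_id)
  have hF0 : ∀ τ ∈ Metric.ball τ₀ δ, ∀ x ∉ K, F τ x = 0 := fun τ hτ x hx => by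
    simp only [F, hJK τ hτ x hx, mul_zero, Finset.sum_const_zero, sub_zero]
  have hdiff : ∀ x τ, HasDerivAt (fun τ => F τ x) (F' τ x) τ := by
    intro x τ
    have e : (fun τ => F τ x) = fun τ => J 0 (eventAt (h x + τ * k x) x) -
        ∑ i : Fin 3, (sd i h x + τ * sd i k x) * J i.succ (eventAt (h x + τ * k x) x) := by
      funext τ; simp only [F, hsd]
    rw [e]
    simp only [F', hsd]
    refine (hasDerivAt_graph (hJ 0) _ _ _ _).sub (HasDerivAt.fun_sum fun i _ => ?_)
    refine HasDerivAt.mul ?_ (hasDerivAt_graph (hJ _) _ _ _ _)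
    simpa using ((hasDerivAt_id τ).mul_const (sd i k x)).const_add (sd i h x)
  have hF0' : ∀ τ ∈ Metric.ball τ₀ δ, ∀ x ∉ K, F' τ x = 0 := fun τ hτ x hx => by
    refine (hdiff x τ).unique ((hasDerivAt_const τ (0 : ℝ)).congr_of_eventuallyEq ?_)
    filter_upwards [Metric.isOpen_ball.mem_nhds hτ] with σ hσ
    exact hF0 σ hσ x hx
  obtain ⟨C, hC⟩ := ((isCompact_closedBall τ₀ δ).prod hK).exists_bound_of_continuousOn
    hFc'.continuousOn
  have hτ₀ : τ₀ ∈ Metric.ball τ₀ δ := Metric.mem_ball_self hδ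
  have main := hasDerivAt_integral_of_dominated_loc_of_deriv_le (μ := (volume : Measure Space))
    (F := F) (F' := F') (bound := K.indicator fun _ => C) (Metric.ball_mem_nhds τ₀ hδ)
    (Eventually.of_forall fun τ => (hFτ τ).aestronglyMeasurable)
    ((hFτ τ₀).integrable_of_hasCompactSupport (HasCompactSupport.intro hK (hF0 τ₀ hτ₀)))
    (hFτ' τ₀).aestronglyMeasurable
    (Eventually.of_forall fun x τ hτ => by
      by_cases hx : x ∈ K
      · rw [Set.indicator_of_mem hx]
        exact hC (τ, x) ⟨Metric.ball_subset_closedBall hτ, hx⟩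
      · rw [Set.indicator_of_notMem hx, hF0' τ hτ x hx, norm_zero])
    ((integrable_indicator_iff hK.measurableSet).2 (integrableOn_const hK.measure_lt_top.ne))
    (Eventually.of_forall fun x τ _ => hdiff x τ)
  have hint : ∫ x, F' τ₀ x = ∫ x, k x * divergence J (eventAt (h x + τ₀ * k x) x) := by
    let D : Fin 3 → Space → ℝ := fun i x => k x * J i.succ (eventAt (h x + τ₀ * k x) x)
    have hcomp : ∀ i : Fin 3, ContDiff ℝ 1 fun x => J i.succ (eventAt (h x + τ₀ * k x) x) :=
      fun i => (hJ _).comp (contDiff_graph (hH τ₀))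
    have hD : ∀ i, ContDiff ℝ 1 (D i) := fun i => hk.mul (hcomp i)
    have hDc : ∀ i, HasCompactSupport (D i) := fun i => HasCompactSupport.intro hK fun x hx => by
      simp only [D, hJK τ₀ hτ₀ x hx, mul_zero]
    have hsD : ∀ i x, sd i (D i) x = sd i k x * J i.succ (eventAt (h x + τ₀ * k x) x) +
        k x * (sd i (fun x => h x + τ₀ * k x) x * pd 0 (J i.succ) (eventAt (h x + τ₀ * k x) x) +
          pd i.succ (J i.succ) (eventAt (h x + τ₀ * k x) x)) := by
      intro i x
      rw [← sd_comp_graph (hJ _) (hH τ₀)]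
      have h1 := (hk.differentiable (by simp) x).hasFDerivAt
      have h2 := ((hcomp i).differentiable (by simp) x).hasFDerivAt
      have h3 : HasFDerivAt (D i) _ x := h1.mul h2
      rw [sd, h3.fderiv]
      simp only [_root_.add_apply, _root_.smul_apply, smul_eq_mul, sd]
      ring
    have e : ∀ x, F' τ₀ x = k x * divergence J (eventAt (h x + τ₀ * k x) x) -
        ∑ i, sd i (D i) x := by
      intro x
      rw [divergence_eq]
      simp only [F', hsD, Fin.sum_univ_three]
      ring
    have hi : ∀ i, Integrable (sd i (D i)) := fun i =>
      (continuous_sd (hD i) i).integrable_of_hasCompactSupport ((hDc i).fderiv_apply (𝕜 := ℝ) _)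
    have hi' : Integrable fun x => ∑ i, sd i (D i) x := integrable_finsetSum _ fun i _ => hi i
    have hsum : ∫ x, ∑ i, sd i (D i) x = 0 := by
      rw [integral_finsetSum _ fun i _ => hi i]
      exact Finset.sum_eq_zero fun i _ => integral_sd_eq_zero (hD i) (hDc i) i
    have e2 : (fun x => k x * divergence J (eventAt (h x + τ₀ * k x) x)) =
        fun x => F' τ₀ x + ∑ i, sd i (D i) x := funext fun x => by rw [e]; ring
    rw [e2, integral_add main.1 hi', hsum, add_zero]
  rw [← hint]
  exact main.2

end Gauss

/-! ### The Dirac operator in symmetric hyperbolic form -/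

section DiracOperator

open Filter Topology

/-- A matrix as a bounded operator on spinors. -/
def spinL (M : Matrix (Fin 4) (Fin 4) ℂ) : Spinor →L[ℂ] Spinor := Matrix.toEuclideanCLM (𝕜 := ℂ) M

theorem spinL_apply (M : Matrix (Fin 4) (Fin 4) ℂ) (a : Spinor) : spinL M a = spinAct M a := rfl

theorem spinL_mul (M N : Matrix (Fin 4) (Fin 4) ℂ) (a : Spinor) :
    spinL (M * N) a = spinL M (spinL N a) := spinAct_mul M N a

theorem spinL_add (M N : Matrix (Fin 4) (Fin 4) ℂ) (a : Spinor) :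
    spinL (M + N) a = spinL M a + spinL N a := by
  rw [spinL, map_add]; rfl

theorem spinL_smul (z : ℂ) (M : Matrix (Fin 4) (Fin 4) ℂ) (a : Spinor) :
    spinL (z • M) a = z • spinL M a := by
  rw [spinL, map_smul]; rfl

theorem spinL_one (a : Spinor) : spinL 1 a = a := spinAct_one a

theorem spinL_neg (M : Matrix (Fin 4) (Fin 4) ℂ) (a : Spinor) : spinL (-M) a = - spinL M a := by
  rw [spinL, map_neg]; rfl

/-- The matrices `α^μ = γ⁰γ^μ`. -/
def alphaMat (μ : Fin 4) : Matrix (Fin 4) (Fin 4) ℂ := gammaMat 0 * gammaMat μ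

theorem gammaMat_zero_sq : gammaMat 0 * gammaMat 0 = 1 := by
  ext i j
  fin_cases i <;> fin_cases j <;> simp [gammaMat, Matrix.mul_apply, Fin.sum_univ_four]

theorem alphaMat_zero : alphaMat 0 = 1 := gammaMat_zero_sq

theorem alphaMat_isHermitian (μ : Fin 4) : (alphaMat μ).IsHermitian := by
  ext i j
  fin_cases μ <;> fin_cases i <;> fin_cases j <;>
    simp [alphaMat, gammaMat, Matrix.conjTranspose_apply, Matrix.mul_apply, Fin.sum_univ_four]

theorem gammaMat_zero_isHermitian : (gammaMat 0).IsHermitian := by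
  ext i j
  fin_cases i <;> fin_cases j <;> simp [gammaMat, Matrix.conjTranspose_apply]

/-- `γ⁵`. -/
def gammaFive : Matrix (Fin 4) (Fin 4) ℂ :=
  !![0, 0, 1, 0; 0, 0, 0, 1; 1, 0, 0, 0; 0, 1, 0, 0]

theorem gammaFive_sq : gammaFive * gammaFive = 1 := by
  ext i j
  fin_cases i <;> fin_cases j <;> simp [gammaFive, Matrix.mul_apply, Fin.sum_univ_four]

theorem alphaMat_mul_gammaFive (μ : Fin 4) : alphaMat μ * gammaFive = gammaFive * alphaMat μ := by
  ext i j
  fin_cases μ <;> fin_cases i <;> fin_cases j <;>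
    simp [alphaMat, gammaMat, gammaFive, Matrix.mul_apply, Fin.sum_univ_four]

theorem gammaMat_zero_mul_gammaFive : gammaMat 0 * gammaFive = -(gammaFive * gammaMat 0) := by
  ext i j
  fin_cases i <;> fin_cases j <;>
    simp [gammaMat, gammaFive, Matrix.mul_apply, Fin.sum_univ_four]

theorem re_inner_spinL_I {M : Matrix (Fin 4) (Fin 4) ℂ} (hM : M.IsHermitian) (r : ℝ) (a : Spinor) :
    (inner ℂ a ((Complex.I * r) • spinL M a) : ℂ).re = 0 := by
  have h : conj (inner ℂ a (spinL M a)) = inner ℂ a (spinL M a) := by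
    rw [inner_conj_symm, spinL_apply, inner_spinAct hM]
  have h2 : (inner ℂ a (spinL M a) : ℂ).im = 0 := Complex.conj_eq_iff_im.1 h
  rw [inner_smul_right]
  simp [Complex.mul_re, h2]

theorem alphaDot_eq_sum (p : Fin 3 → ℝ) : alphaDot p = ∑ i : Fin 3, (p i : ℂ) • alphaMat i.succ := by
  rw [Fin.sum_univ_three]; rfl

/-- `α · p` is `‖p‖` times a unitary matrix, since `(α · p)² = ‖p‖²`. -/
theorem norm_spinL_alphaDot (p : Space) (a : Spinor) : ‖spinL (alphaDot p) a‖ = ‖p‖ * ‖a‖ := by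
  have h : inner ℂ (spinL (alphaDot p) a) (spinL (alphaDot p) a) =
      ((‖p‖ ^ 2 : ℝ) : ℂ) * inner ℂ a a := by
    rw [spinL_apply, ← inner_spinAct (alphaDot_isHermitian _), ← spinL_apply, ← spinL_apply,
      ← spinL_mul, alphaDot_mul_self, spinL_smul, spinL_one, inner_smul_right,
      EuclideanSpace.norm_sq_eq]
    simp [Fin.sum_univ_three]
  rw [inner_self_eq_norm_sq_to_K, inner_self_eq_norm_sq_to_K] at h
  have h2 : ‖spinL (alphaDot p) a‖ ^ 2 = (‖p‖ * ‖a‖) ^ 2 := by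
    rw [mul_pow]
    apply Complex.ofReal_injective
    push_cast at h ⊢
    simpa using h
  exact (pow_left_inj₀ (norm_nonneg _) (by positivity) two_ne_zero).1 h2

/-- The Dirac current `ψ̄ γ^μ ψ`. -/
def current (u : Spacetime → Spinor) (μ : Fin 4) (z : Spacetime) : ℝ :=
  (inner ℂ (u z) (spinL (alphaMat μ) (u z)) : ℂ).re

theorem current_zero (u : Spacetime → Spinor) (z : Spacetime) : current u 0 z = ‖u z‖ ^ 2 := by
  rw [current, alphaMat_zero, spinL_one, inner_self_eq_norm_sq_to_K]
  norm_cast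

theorem sum_current (u : Spacetime → Spinor) (z : Spacetime) (p : Fin 3 → ℝ) :
    ∑ i : Fin 3, p i * current u i.succ z = (inner ℂ (u z) (spinL (alphaDot p) (u z)) : ℂ).re := by
  rw [alphaDot_eq_sum, Fin.sum_univ_three, Fin.sum_univ_three, spinL_add, spinL_add, spinL_smul,
    spinL_smul, spinL_smul]
  simp [current]

/-- The Dirac current is causal: the spatial current is bounded by the density. -/
theorem abs_sum_current_le (u : Spacetime → Spinor) (z : Spacetime) (p : Space) :
    |∑ i : Fin 3, p i * current u i.succ z| ≤ ‖p‖ * ‖u z‖ ^ 2 := by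
  rw [sum_current]
  refine (Complex.abs_re_le_norm _).trans ((norm_inner_le_norm _ _).trans ?_)
  rw [norm_spinL_alphaDot]
  exact le_of_eq (by ring)

theorem current_eq_zero {u : Spacetime → Spinor} {z : Spacetime} (h : u z = 0) (μ : Fin 4) :
    current u μ z = 0 := by
  rw [current, h, inner_zero_left, Complex.zero_re]

theorem contDiff_current {u : Spacetime → Spinor} (hu : ContDiff ℝ 1 u) (μ : Fin 4) :
    ContDiff ℝ 1 (current u μ) :=
  Complex.reCLM.contDiff.comp (hu.inner ℂ
    (((spinL (alphaMat μ)).restrictScalars ℝ).contDiff.comp hu))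

theorem pd_current {u : Spacetime → Spinor} (hu : ContDiff ℝ 1 u) (μ ν : Fin 4) (z : Spacetime) :
    pd μ (current u ν) z = 2 * (inner ℂ (u z) (spinL (alphaMat ν) (pd μ u z)) : ℂ).re := by
  have h1 := (hu.differentiable (by simp) z).hasFDerivAt
  have h2 := ((spinL (alphaMat ν)).restrictScalars ℝ).hasFDerivAt.comp z h1
  have h3 : HasFDerivAt (current u ν) _ z :=
    Complex.reCLM.hasFDerivAt.comp z (h1.inner ℂ h2)
  rw [pd, h3.fderiv]
  simp only [ContinuousLinearMap.comp_apply, ContinuousLinearMap.prod_apply, fderivInnerCLM_apply,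
    Complex.reCLM_apply, Complex.add_re, ContinuousLinearMap.coe_restrictScalars', Function.comp_apply]
  have e : (inner ℂ (fderiv ℝ u z (Pi.single μ 1)) (spinL (alphaMat ν) (u z)) : ℂ).re =
      (inner ℂ (u z) (spinL (alphaMat ν) (pd μ u z)) : ℂ).re := by
    rw [← inner_conj_symm, Complex.conj_re, spinL_apply, ← inner_spinAct (alphaMat_isHermitian ν)]
    rfl
  rw [e, pd, two_mul]

/-- The zeroth-order part of the Dirac operator, without the factor `i`. -/
def potentialMat (m : ℝ) (a : Fin 4 → ℝ) : Matrix (Fin 4) (Fin 4) ℂ :=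
  (m : ℂ) • gammaMat 0 + ∑ μ, (a μ : ℂ) • alphaMat μ

theorem potentialMat_isHermitian (m : ℝ) (a : Fin 4 → ℝ) : (potentialMat m a).IsHermitian := by
  have h : ∀ (r : ℝ) {M : Matrix (Fin 4) (Fin 4) ℂ}, M.IsHermitian → ((r : ℂ) • M).IsHermitian :=
    fun r M hM => by
      rw [Matrix.IsHermitian, Matrix.conjTranspose_smul, hM.eq]
      simp
  rw [potentialMat, Fin.sum_univ_four]
  exact (h _ gammaMat_zero_isHermitian).add ((((h _ (alphaMat_isHermitian 0)).add
    (h _ (alphaMat_isHermitian 1))).add (h _ (alphaMat_isHermitian 2))).add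
    (h _ (alphaMat_isHermitian 3)))

/-- The Dirac operator, multiplied by `-iγ⁰`: `∂₀ + αⁱ∂ᵢ + i(mγ⁰ + A_μ α^μ)`. -/
def diracOp (m : ℝ) (A : Spacetime → Fin 4 → ℝ) (u : Spacetime → Spinor) (z : Spacetime) : Spinor :=
  ∑ μ, spinL (alphaMat μ) (pd μ u z) + Complex.I • spinL (potentialMat m (A z)) (u z)

/-- The Dirac current is conserved up to the source: the mass and the potential drop out because
their matrices are Hermitian. -/
theorem divergence_current {u : Spacetime → Spinor} (hu : ContDiff ℝ 1 u) (m : ℝ)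
    (A : Spacetime → Fin 4 → ℝ) (z : Spacetime) :
    divergence (current u) z = 2 * (inner ℂ (u z) (diracOp m A u z) : ℂ).re := by
  have h := re_inner_spinL_I (potentialMat_isHermitian m (A z)) 1 (u z)
  rw [Complex.ofReal_one, mul_one] at h
  rw [diracOp, inner_add_right, Complex.add_re, h, add_zero, inner_sum, Complex.re_sum,
    Finset.mul_sum]
  exact Finset.sum_congr rfl fun μ _ => pd_current hu μ μ z

theorem pd_add {u v : Spacetime → Spinor} (hu : ContDiff ℝ 1 u) (hv : ContDiff ℝ 1 v) (μ : Fin 4)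
    (z : Spacetime) : pd μ (u + v) z = pd μ u z + pd μ v z := by
  rw [pd, fderiv_add (hu.differentiable (by simp) z) (hv.differentiable (by simp) z)]
  rfl

theorem pd_smul {u : Spacetime → Spinor} (hu : ContDiff ℝ 1 u) (c : ℂ) (μ : Fin 4)
    (z : Spacetime) : pd μ (c • u) z = c • pd μ u z := by
  rw [pd, fderiv_const_smul (hu.differentiable (by simp) z)]
  rfl

theorem diracOp_add {m : ℝ} {A : Spacetime → Fin 4 → ℝ} {u v : Spacetime → Spinor}
    (hu : ContDiff ℝ 1 u) (hv : ContDiff ℝ 1 v) (z : Spacetime) :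
    diracOp m A (u + v) z = diracOp m A u z + diracOp m A v z := by
  simp only [diracOp, pd_add hu hv, map_add, Finset.sum_add_distrib, Pi.add_apply, smul_add]
  abel

theorem diracOp_smul {m : ℝ} {A : Spacetime → Fin 4 → ℝ} {u : Spacetime → Spinor}
    (hu : ContDiff ℝ 1 u) (c : ℂ) (z : Spacetime) :
    diracOp m A (c • u) z = c • diracOp m A u z := by
  simp only [diracOp, pd_smul hu, map_smul, Pi.smul_apply, smul_add, Finset.smul_sum]
  rw [smul_comm]

theorem diracOp_sub {m : ℝ} {A : Spacetime → Fin 4 → ℝ} {u v : Spacetime → Spinor}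
    (hu : ContDiff ℝ 1 u) (hv : ContDiff ℝ 1 v) (z : Spacetime) :
    diracOp m A (u - v) z = diracOp m A u z - diracOp m A v z := by
  have e : u - v = u + (-1 : ℂ) • v := by simp [sub_eq_add_neg]
  have hv' : ContDiff ℝ 1 ((-1 : ℂ) • v) := hv.const_smul (-1 : ℂ)
  rw [e, diracOp_add hu hv', diracOp_smul hv]
  simp [sub_eq_add_neg]

/-- Multiplication with `-iγ⁰` turns the Dirac equation into a symmetric hyperbolic system. -/
theorem dirac_equation_iff (m e : ℝ) (A : Spacetime → Fin 4 → ℝ) (ψ : Spacetime → Spinor)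
    (z : Spacetime) :
    (∑ μ : Fin 4, Complex.I • spinAct (gammaMat μ) (fderiv ℝ ψ z (Pi.single μ 1)) -
      (m : ℂ) • ψ z = (e : ℂ) • spinAct (∑ μ : Fin 4, (A z μ : ℂ) • gammaMat μ) (ψ z)) ↔
      diracOp m (e • A) ψ z = 0 := by
  have key : diracOp m (e • A) ψ z = -Complex.I • spinL (gammaMat 0)
      (∑ μ : Fin 4, Complex.I • spinAct (gammaMat μ) (fderiv ℝ ψ z (Pi.single μ 1)) -
      (m : ℂ) • ψ z - (e : ℂ) • spinAct (∑ μ : Fin 4, (A z μ : ℂ) • gammaMat μ) (ψ z)) := by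
    simp only [diracOp, potentialMat, map_sub, map_smul, ← spinL_apply, pd, alphaMat,
      Fin.sum_univ_four, spinL_add, spinL_smul, map_add, spinL_mul, Pi.smul_apply, smul_eq_mul,
      Complex.ofReal_mul]
    simp only [smul_sub, smul_add, smul_smul, neg_mul, Complex.I_mul_I, neg_neg, one_smul]
    module
  rw [key, ← sub_eq_zero]
  constructor
  · intro h
    rw [h, map_zero, smul_zero]
  · intro h
    have h2 := (smul_eq_zero.1 h).resolve_left (by simp)
    have h3 := congrArg (spinL (gammaMat 0)) h2
    rwa [← spinL_mul, gammaMat_zero_sq, spinL_one, map_zero] at h3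

/-- The space-time reflection `u ↦ γ⁵ u(-·)`. -/
def reflect (u : Spacetime → Spinor) (z : Spacetime) : Spinor := spinL gammaFive (u (-z))

/-- The reflected potential. -/
def reflectPotential (A : Spacetime → Fin 4 → ℝ) (z : Spacetime) : Fin 4 → ℝ := -A (-z)

theorem contDiff_reflect {n : WithTop ℕ∞} {u : Spacetime → Spinor} (hu : ContDiff ℝ n u) :
    ContDiff ℝ n (reflect u) :=
  ((spinL gammaFive).restrictScalars ℝ).contDiff.comp (hu.comp contDiff_neg)

theorem reflect_reflect (u : Spacetime → Spinor) : reflect (reflect u) = u := by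
  funext z
  rw [reflect, reflect, ← spinL_mul, gammaFive_sq, spinL_one, neg_neg]

theorem reflectPotential_reflectPotential (A : Spacetime → Fin 4 → ℝ) :
    reflectPotential (reflectPotential A) = A := by
  funext z
  simp [reflectPotential]

theorem reflect_eq_zero {u : Spacetime → Spinor} {z : Spacetime} (h : u (-z) = 0) :
    reflect u z = 0 := by rw [reflect, h, map_zero]

theorem pd_reflect {u : Spacetime → Spinor} (hu : ContDiff ℝ 1 u) (μ : Fin 4) (z : Spacetime) :
    pd μ (reflect u) z = - spinL gammaFive (pd μ u (-z)) := by
  have h1 := (hu.differentiable (by simp) (-z)).hasFDerivAt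
  have h2 : HasFDerivAt (fun z : Spacetime => -z) (-ContinuousLinearMap.id ℝ Spacetime) z :=
    (hasFDerivAt_id z).neg
  have h3 : HasFDerivAt (reflect u) _ z :=
    ((spinL gammaFive).restrictScalars ℝ).hasFDerivAt.comp z (h1.comp z h2)
  rw [pd, h3.fderiv]
  simp [pd]

/-- The Dirac equation is invariant under space-time reflection. -/
theorem diracOp_reflect {u : Spacetime → Spinor} (hu : ContDiff ℝ 1 u) (m : ℝ)
    (A : Spacetime → Fin 4 → ℝ) (z : Spacetime) :
    diracOp m (reflectPotential A) (reflect u) z = - reflect (diracOp m A u) z := by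
  have h1 : ∀ μ a, spinL (alphaMat μ) (spinL gammaFive a) = spinL gammaFive (spinL (alphaMat μ) a) :=
    fun μ a => by rw [← spinL_mul, alphaMat_mul_gammaFive, spinL_mul]
  have h2 : ∀ a, spinL (gammaMat 0) (spinL gammaFive a) = - spinL gammaFive (spinL (gammaMat 0) a) :=
    fun a => by rw [← spinL_mul, gammaMat_zero_mul_gammaFive, spinL_neg, spinL_mul]
  simp only [diracOp, pd_reflect hu, reflect, reflectPotential, potentialMat, map_neg, h1,
    Finset.sum_neg_distrib, map_add, spinL_add, spinL_smul, Fin.sum_univ_four, h2,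
    Pi.neg_apply, Complex.ofReal_neg, map_smul]
  module

end DiracOperator

/-! ### Energy estimates and finite speed of propagation -/

section Energy

open Filter Topology

theorem hasDerivAt_max_zero_sq (s : ℝ) : HasDerivAt (fun s : ℝ => max s 0 ^ 2) (2 * max s 0) s := by
  rcases lt_trichotomy s 0 with h | rfl | h
  · rw [max_eq_right h.le, mul_zero]
    refine (hasDerivAt_const s (0 : ℝ)).congr_of_eventuallyEq ?_
    filter_upwards [Iio_mem_nhds h] with r hr
    rw [max_eq_right (le_of_lt hr)]; simp
  · rw [max_self, mul_zero, hasDerivAt_iff_isLittleO]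
    have : (fun x : ℝ => max x 0 ^ 2 - max 0 0 ^ 2 - (x - 0) • (0 : ℝ)) = fun x => max x 0 ^ 2 := by
      funext x; simp
    rw [this]
    have h2 : (fun x : ℝ => x ^ 2) =o[𝓝 0] fun x : ℝ => x - 0 := by
      simpa using Asymptotics.isLittleO_pow_id (𝕜 := ℝ) (one_lt_two)
    refine (Asymptotics.IsBigO.of_bound 1 (Eventually.of_forall fun x => ?_)).trans_isLittleO h2
    rw [one_mul, norm_pow, norm_pow, Real.norm_eq_abs, Real.norm_eq_abs]
    refine pow_le_pow_left₀ (abs_nonneg _) ?_ 2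
    rw [abs_of_nonneg (le_max_right _ _)]
    exact max_le (le_abs_self _) (abs_nonneg _)
  · rw [max_eq_left h.le]
    refine HasDerivAt.congr_of_eventuallyEq (f := fun s : ℝ => s ^ 2)
      (by simpa using hasDerivAt_pow 2 s) ?_
    filter_upwards [Ioi_mem_nhds h] with r hr
    rw [max_eq_left (le_of_lt hr)]

theorem contDiff_max_zero_sq : ContDiff ℝ 1 fun s : ℝ => max s 0 ^ 2 := by
  rw [contDiff_one_iff_deriv]
  refine ⟨fun s => (hasDerivAt_max_zero_sq s).differentiableAt, ?_⟩
  have : deriv (fun s : ℝ => max s 0 ^ 2) = fun s => 2 * max s 0 :=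
    funext fun s => (hasDerivAt_max_zero_sq s).deriv
  rw [this]
  fun_prop

/-- The Minkowski square of the separation from the event `(T, x₁)`. -/
def coneSq (T : ℝ) (x₁ : Space) (z : Spacetime) : ℝ :=
  (T - z 0) ^ 2 - ∑ i : Fin 3, (z i.succ - x₁ i) ^ 2

theorem coneSq_eq (T : ℝ) (x₁ : Space) (z : Spacetime) :
    coneSq T x₁ z = (T - z 0) ^ 2 - ‖position z - x₁‖ ^ 2 := by
  rw [coneSq, EuclideanSpace.norm_sq_eq]
  congr 1
  refine Finset.sum_congr rfl fun i _ => ?_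
  rw [Real.norm_eq_abs, sq_abs]
  fin_cases i <;> rfl

theorem contDiff_coneSq (T : ℝ) (x₁ : Space) : ContDiff ℝ 1 (coneSq T x₁) := by
  unfold coneSq; fun_prop

theorem pd_zero_coneSq (T : ℝ) (x₁ : Space) (z : Spacetime) :
    pd 0 (coneSq T x₁) z = -2 * (T - z 0) := by
  have h1 : HasDerivAt (fun s : ℝ => coneSq T x₁ (z + s • Pi.single 0 1)) (-2 * (T - z 0)) 0 := by
    have e : (fun s : ℝ => coneSq T x₁ (z + s • Pi.single 0 1)) =
        fun s => (T - z 0 - s) ^ 2 - ∑ i : Fin 3, (z i.succ - x₁ i) ^ 2 := by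
      funext s; simp [coneSq]; ring
    rw [e]
    have : HasDerivAt (fun s : ℝ => (T - z 0 - s) ^ 2 - ∑ i : Fin 3, (z i.succ - x₁ i) ^ 2) _ 0 :=
      (((hasDerivAt_id (0 : ℝ)).const_sub (T - z 0)).pow 2).sub_const
        (∑ i : Fin 3, (z i.succ - x₁ i) ^ 2)
    exact this.congr_deriv (by simp)
  have h2 := ((contDiff_coneSq T x₁).differentiable (by simp) z).hasFDerivAt.hasLineDerivAt
    (Pi.single 0 1)
  exact HasDerivAt.unique h2 h1

theorem pd_succ_coneSq (T : ℝ) (x₁ : Space) (z : Spacetime) (i : Fin 3) :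
    pd i.succ (coneSq T x₁) z = -2 * (z i.succ - x₁ i) := by
  have h1 : HasDerivAt (fun s : ℝ => coneSq T x₁ (z + s • Pi.single i.succ 1))
      (-2 * (z i.succ - x₁ i)) 0 := by
    have e : (fun s : ℝ => coneSq T x₁ (z + s • Pi.single i.succ 1)) =
        fun s => coneSq T x₁ z - 2 * (z i.succ - x₁ i) * s - s ^ 2 := by
      funext s
      fin_cases i <;> simp [coneSq, Fin.sum_univ_three] <;> ring
    rw [e]
    have : HasDerivAt (fun s : ℝ => coneSq T x₁ z - 2 * (z i.succ - x₁ i) * s - s ^ 2) _ 0 :=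
      (((hasDerivAt_id (0 : ℝ)).const_mul (2 * (z i.succ - x₁ i))).const_sub
        (coneSq T x₁ z)).sub ((hasDerivAt_id (0 : ℝ)).pow 2)
    exact this.congr_deriv (by simp)
  have h2 := ((contDiff_coneSq T x₁).differentiable (by simp) z).hasFDerivAt.hasLineDerivAt
    (Pi.single i.succ 1)
  exact HasDerivAt.unique h2 h1

/-- A weight of class `C¹`, positive in the backward cone of `(T, x₁)` and zero outside of the light
cone. -/
def coneWeight (T : ℝ) (x₁ : Space) (z : Spacetime) : ℝ := max (coneSq T x₁ z) 0 ^ 2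

theorem contDiff_coneWeight (T : ℝ) (x₁ : Space) : ContDiff ℝ 1 (coneWeight T x₁) :=
  contDiff_max_zero_sq.comp (contDiff_coneSq T x₁)

theorem pd_coneWeight (T : ℝ) (x₁ : Space) (z : Spacetime) (μ : Fin 4) :
    pd μ (coneWeight T x₁) z = 2 * max (coneSq T x₁ z) 0 * pd μ (coneSq T x₁) z := by
  have h := (hasDerivAt_max_zero_sq (coneSq T x₁ z)).comp_hasFDerivAt z
    ((contDiff_coneSq T x₁).differentiable (by simp) z).hasFDerivAt
  have h' : HasFDerivAt (coneWeight T x₁) _ z := h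
  rw [pd, h'.fderiv]
  rfl

theorem coneWeight_nonneg (T : ℝ) (x₁ : Space) (z : Spacetime) : 0 ≤ coneWeight T x₁ z :=
  sq_nonneg _

theorem coneWeight_eq_zero {T : ℝ} {x₁ : Space} {z : Spacetime}
    (h : |T - z 0| ≤ ‖position z - x₁‖) : coneWeight T x₁ z = 0 := by
  rw [coneWeight, max_eq_right, zero_pow two_ne_zero]
  rw [coneSq_eq, ← sq_abs (T - z 0)]
  have := pow_le_pow_left₀ (abs_nonneg _) h 2
  linarith

theorem coneWeight_pos {T : ℝ} {x₁ : Space} {z : Spacetime}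
    (h : ‖position z - x₁‖ < T - z 0) : 0 < coneWeight T x₁ z := by
  have : 0 < coneSq T x₁ z := by
    rw [coneSq_eq]
    have := pow_lt_pow_left₀ h (norm_nonneg _) two_ne_zero
    linarith
  rw [coneWeight, max_eq_left this.le]
  positivity

theorem coneWeight_le (T : ℝ) (x₁ : Space) (z : Spacetime) :
    coneWeight T x₁ z ≤ (T - z 0) ^ 4 := by
  have : max (coneSq T x₁ z) 0 ≤ (T - z 0) ^ 2 := by
    refine max_le ?_ (sq_nonneg _)
    rw [coneSq_eq]
    nlinarith [sq_nonneg ‖position z - x₁‖]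
  calc coneWeight T x₁ z ≤ ((T - z 0) ^ 2) ^ 2 := pow_le_pow_left₀ (le_max_right _ _) this 2
    _ = _ := by ring

/-- The weighted current. -/
def coneCurrent (u : Spacetime → Spinor) (T : ℝ) (x₁ : Space) (μ : Fin 4) (z : Spacetime) : ℝ :=
  coneWeight T x₁ z * current u μ z

theorem contDiff_coneCurrent {u : Spacetime → Spinor} (hu : ContDiff ℝ 1 u) (T : ℝ) (x₁ : Space)
    (μ : Fin 4) : ContDiff ℝ 1 (coneCurrent u T x₁ μ) :=
  (contDiff_coneWeight T x₁).mul (contDiff_current hu μ)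

/-- In the backward cone the weight decreases along future directed causal vectors, such as the Dirac
current. -/
theorem divergence_coneCurrent_nonpos {u : Spacetime → Spinor} (hu : ContDiff ℝ 1 u) {m : ℝ}
    {A : Spacetime → Fin 4 → ℝ} {T : ℝ} {x₁ : Space} {z : Spacetime} (hz : z 0 < T)
    (h0 : ‖position z - x₁‖ < T - z 0 → diracOp m A u z = 0) :
    divergence (coneCurrent u T x₁) z ≤ 0 := by
  have hp : ∀ μ, pd μ (coneCurrent u T x₁ μ) z = coneWeight T x₁ z * pd μ (current u μ) z +
      pd μ (coneWeight T x₁) z * current u μ z := by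
    intro μ
    have h1 := ((contDiff_coneWeight T x₁).differentiable (by simp) z).hasFDerivAt
    have h2 := ((contDiff_current hu μ).differentiable (by simp) z).hasFDerivAt
    have h3 : HasFDerivAt (coneCurrent u T x₁ μ) _ z := h1.mul h2
    rw [pd, h3.fderiv]
    simp only [_root_.add_apply, _root_.smul_apply, smul_eq_mul, pd]
    ring
  have e : divergence (coneCurrent u T x₁) z = coneWeight T x₁ z * divergence (current u) z +
      ∑ μ, pd μ (coneWeight T x₁) z * current u μ z := by
    simp only [divergence, hp, Finset.sum_add_distrib, Finset.mul_sum]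
  have e1 : coneWeight T x₁ z * divergence (current u) z = 0 := by
    rw [divergence_current hu m A]
    by_cases h : ‖position z - x₁‖ < T - z 0
    · rw [h0 h, inner_zero_right]; simp
    · rw [coneWeight_eq_zero, zero_mul]
      rw [abs_of_pos (by linarith)]
      linarith
  rw [e, e1, zero_add, Fin.sum_univ_succ, pd_coneWeight, pd_zero_coneSq, current_zero]
  have e2 : ∑ i : Fin 3, pd i.succ (coneWeight T x₁) z * current u i.succ z =
      -4 * max (coneSq T x₁ z) 0 * ∑ i : Fin 3, (position z - x₁) i * current u i.succ z := by
    rw [Finset.mul_sum]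
    refine Finset.sum_congr rfl fun i _ => ?_
    rw [pd_coneWeight, pd_succ_coneSq]
    have : (position z - x₁) i = z i.succ - x₁ i := by fin_cases i <;> rfl
    rw [this]; ring
  rw [e2]
  have h1 := abs_sum_current_le u z (position z - x₁)
  have h2 := neg_le_of_abs_le h1
  rcases le_or_gt (coneSq T x₁ z) 0 with h | h
  · rw [max_eq_right h]; simp
  · have h3 : ‖position z - x₁‖ ≤ T - z 0 := by
      rw [coneSq_eq] at h
      exact (abs_le_of_sq_le_sq' (by linarith) (by linarith)).2
    have h4 := mul_le_mul_of_nonneg_right h3 (sq_nonneg ‖u z‖)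
    have h5 := le_max_right (coneSq T x₁ z) 0
    have h6 : 0 ≤ (T - z 0) * ‖u z‖ ^ 2 +
        ∑ i : Fin 3, (position z - x₁) i * current u i.succ z := by linarith
    nlinarith [mul_nonneg h5 h6]

/-- The weighted energy at time `t`. -/
def coneEnergy (u : Spacetime → Spinor) (T : ℝ) (x₁ : Space) (t : ℝ) : ℝ :=
  ∫ x, coneWeight T x₁ (eventAt t x) * ‖u (eventAt t x)‖ ^ 2

theorem sd_const (c : ℝ) (i : Fin 3) (x : Space) : sd i (fun _ => c) x = 0 := by
  rw [sd, fderiv_const_apply]; rfl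

theorem coneEnergy_eq_flux (u : Spacetime → Spinor) (T : ℝ) (x₁ : Space) (t : ℝ) :
    coneEnergy u T x₁ t = flux (coneCurrent u T x₁) fun _ => 0 + t * 1 := by
  simp only [coneEnergy, flux, sd_const, zero_mul, Finset.sum_const_zero, sub_zero, coneCurrent,
    current_zero, mul_one, zero_add]

theorem coneEnergy_nonneg (u : Spacetime → Spinor) (T : ℝ) (x₁ : Space) (t : ℝ) :
    0 ≤ coneEnergy u T x₁ t :=
  integral_nonneg fun _ => mul_nonneg (coneWeight_nonneg _ _ _) (sq_nonneg _)

theorem coneCurrent_eq_zero (u : Spacetime → Spinor) {T t : ℝ} {x x₁ : Space} (μ : Fin 4)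
    (h : |T - t| ≤ ‖x - x₁‖) : coneCurrent u T x₁ μ (eventAt t x) = 0 := by
  rw [coneCurrent, coneWeight_eq_zero (by simpa using h), zero_mul]

/-- The divergence theorem between time slices; the weight makes the current compactly supported. -/
theorem hasDerivAt_coneEnergy {u : Spacetime → Spinor} (hu : ContDiff ℝ 1 u) (T : ℝ) (x₁ : Space)
    (t : ℝ) : HasDerivAt (coneEnergy u T x₁)
      (∫ x, divergence (coneCurrent u T x₁) (eventAt t x)) t := by
  have h := hasDerivAt_flux (J := coneCurrent u T x₁) (contDiff_coneCurrent hu T x₁)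
    (h := fun _ => 0) (k := fun _ => 1) contDiff_const contDiff_const
    (isCompact_closedBall x₁ (|T - t| + 1)) (τ₀ := t) one_pos fun τ hτ x hx μ => by
      refine coneCurrent_eq_zero u μ ?_
      rw [mem_closedBall_iff_norm, not_le] at hx
      rw [Metric.mem_ball, Real.dist_eq] at hτ
      have : T - (0 + τ * 1) = (T - t) - (τ - t) := by ring
      rw [this]
      exact (abs_sub _ _).trans (by linarith)
  simp only [one_mul, mul_one, zero_add] at h
  have e : coneEnergy u T x₁ = fun τ => flux (coneCurrent u T x₁) fun _ => τ := by
    funext τ; rw [coneEnergy_eq_flux]; simp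
  rw [e]
  exact h

/-- Energy inequality in a backward light cone. -/
theorem antitoneOn_coneEnergy {u : Spacetime → Spinor} (hu : ContDiff ℝ 1 u) {m : ℝ}
    {A : Spacetime → Fin 4 → ℝ} {T : ℝ} {x₁ : Space} {D : Set ℝ} (hD : Convex ℝ D)
    (hDT : ∀ t ∈ interior D, t < T)
    (h0 : ∀ t ∈ interior D, ∀ x, ‖x - x₁‖ < T - t → diracOp m A u (eventAt t x) = 0) :
    AntitoneOn (coneEnergy u T x₁) D := by
  refine antitoneOn_of_deriv_nonpos hD
    (fun t _ => (hasDerivAt_coneEnergy hu T x₁ t).continuousAt.continuousWithinAt)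
    (fun t _ => (hasDerivAt_coneEnergy hu T x₁ t).differentiableAt.differentiableWithinAt)
    fun t ht => ?_
  rw [(hasDerivAt_coneEnergy hu T x₁ t).deriv]
  refine integral_nonpos fun x => ?_
  refine divergence_coneCurrent_nonpos (m := m) (A := A) hu (hDT t ht) fun h => h0 t ht x ?_
  simpa using h

/-- The weight is positive inside of the cone. -/
theorem eq_zero_of_coneEnergy_nonpos {u : Spacetime → Spinor} (hu : Continuous u) {T t : ℝ}
    {x₁ : Space} (h : coneEnergy u T x₁ t ≤ 0) {x : Space} (hx : ‖x - x₁‖ < T - t) :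
    u (eventAt t x) = 0 := by
  have hc : Continuous fun x => coneWeight T x₁ (eventAt t x) * ‖u (eventAt t x)‖ ^ 2 := by
    have he : Continuous fun x => eventAt t x := continuous_const.eventAt continuous_id
    exact ((contDiff_coneWeight T x₁).continuous.comp he).mul ((hu.comp he).norm.pow 2)
  have hs : HasCompactSupport fun x => coneWeight T x₁ (eventAt t x) * ‖u (eventAt t x)‖ ^ 2 :=
    HasCompactSupport.intro (isCompact_closedBall x₁ |T - t|) fun x hx => by
      rw [mem_closedBall_iff_norm, not_le] at hx
      rw [coneWeight_eq_zero (by simpa using hx.le), zero_mul]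
  have hnn : 0 ≤ fun x => coneWeight T x₁ (eventAt t x) * ‖u (eventAt t x)‖ ^ 2 :=
    fun x => mul_nonneg (coneWeight_nonneg _ _ _) (sq_nonneg _)
  have h0 := (integral_eq_zero_iff_of_nonneg hnn (hc.integrable_of_hasCompactSupport hs)).1
    (le_antisymm h (coneEnergy_nonneg u T x₁ t))
  have h1 := congrFun ((hc.ae_eq_iff_eq volume continuous_const).1 h0) x
  have h2 := coneWeight_pos (T := T) (x₁ := x₁) (z := eventAt t x) (by simpa using hx)
  have h3 := (mul_eq_zero.1 h1).resolve_left h2.ne'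
  simpa using h3

/-- Uniqueness for the Cauchy problem in a light cone. -/
theorem eq_zero_of_cauchy_data {u : Spacetime → Spinor} (hu : ContDiff ℝ 1 u) {m : ℝ}
    {A : Spacetime → Fin 4 → ℝ} {t₀ T : ℝ} {x₁ : Space}
    (h0 : ∀ t x, t₀ < t → ‖x - x₁‖ < T - t → diracOp m A u (eventAt t x) = 0)
    (hd : ∀ x, ‖x - x₁‖ < T - t₀ → u (eventAt t₀ x) = 0) {t : ℝ} {x : Space} (ht : t₀ ≤ t)
    (hx : ‖x - x₁‖ < T - t) : u (eventAt t x) = 0 := by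
  have htT : t < T := by linarith [norm_nonneg (x - x₁)]
  refine eq_zero_of_coneEnergy_nonpos hu.continuous (T := T) (x₁ := x₁) ?_ hx
  have hanti := antitoneOn_coneEnergy hu (m := m) (A := A) (T := T) (x₁ := x₁)
    (convex_Icc t₀ t) (fun s hs => by rw [interior_Icc] at hs; linarith [hs.2])
    (fun s hs x hx => by rw [interior_Icc] at hs; exact h0 s x hs.1 hx)
  refine (hanti ⟨le_rfl, ht⟩ ⟨ht, le_rfl⟩ ht).trans (le_of_eq ?_)
  refine integral_eq_zero_of_ae (Eventually.of_forall fun y => ?_)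
  simp only [Pi.zero_apply]
  by_cases hy : ‖y - x₁‖ < T - t₀
  · rw [hd y hy]; simp
  · rw [coneWeight_eq_zero, zero_mul]
    rw [eventAt_zero, position_eventAt, abs_of_nonneg (by linarith)]
    linarith

/-- A crude bound: the weight and the volume of the cone grow polynomially towards the past. -/
theorem coneEnergy_le {u : Spacetime → Spinor} {T t : ℝ} {x₁ : Space} {M : ℝ} (ht : t ≤ T)
    (hM : ∀ x, ‖u (eventAt t x)‖ ^ 2 ≤ M) :
    coneEnergy u T x₁ t ≤ (T - t) ^ 4 * M * ((T - t) ^ 3 * volume.real (Metric.ball (0 : Space) 1)) := by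
  have hM0 : 0 ≤ M := (sq_nonneg _).trans (hM 0)
  have hball := Measure.addHaar_real_closedBall (volume : Measure Space) x₁ (sub_nonneg.2 ht)
  have hfin : Module.finrank ℝ Space = 3 := by simp
  rw [hfin] at hball
  have hint : Integrable ((Metric.closedBall x₁ (T - t)).indicator fun _ => (T - t) ^ 4 * M)
      (volume : Measure Space) :=
    (integrable_indicator_iff measurableSet_closedBall).2
      (integrableOn_const measure_closedBall_lt_top.ne)
  refine (integral_mono_of_nonneg (Eventually.of_forall fun x =>
    mul_nonneg (coneWeight_nonneg _ _ _) (sq_nonneg _)) hint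
      (Eventually.of_forall fun x => ?_)).trans ?_
  · simp only
    by_cases hx : x ∈ Metric.closedBall x₁ (T - t)
    · rw [Set.indicator_of_mem hx]
      exact mul_le_mul (coneWeight_le _ _ _) (hM x) (sq_nonneg _) (by positivity)
    · rw [Set.indicator_of_notMem hx, coneWeight_eq_zero, zero_mul]
      rw [mem_closedBall_iff_norm, not_le] at hx
      rw [eventAt_zero, position_eventAt, abs_of_nonneg (by linarith)]
      exact hx.le
  · rw [integral_indicator_const _ measurableSet_closedBall, hball, smul_eq_mul, mul_comm]

/-- A solution that decays exponentially in the remote past vanishes in every backward light cone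
without sources. -/
theorem eq_zero_of_decay {u : Spacetime → Spinor} (hu : ContDiff ℝ 1 u) {m : ℝ}
    {A : Spacetime → Fin 4 → ℝ} {C l : ℝ} (hl : 0 < l)
    (hdec : ∀ z, ‖u z‖ ≤ C * Real.exp (l * z 0)) {T : ℝ} {x₁ : Space}
    (h0 : ∀ t x, ‖x - x₁‖ < T - t → diracOp m A u (eventAt t x) = 0) {t : ℝ} {x : Space}
    (hx : ‖x - x₁‖ < T - t) : u (eventAt t x) = 0 := by
  have htT : t < T := by linarith [norm_nonneg (x - x₁)]
  refine eq_zero_of_coneEnergy_nonpos hu.continuous (T := T) (x₁ := x₁) ?_ hx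
  have hanti := antitoneOn_coneEnergy hu (m := m) (A := A) (T := T) (x₁ := x₁)
    (convex_Iic t) (fun s hs => by rw [interior_Iic] at hs; exact lt_trans hs htT)
    (fun s _ x hx => h0 s x hx)
  set V := volume.real (Metric.ball (0 : Space) 1)
  -- The energy at time `T - r` is at most polynomial in `r` times `exp (-2lr)`, and it bounds the
  -- energy at time `t`.
  have hlim : Tendsto (fun r : ℝ => V * C ^ 2 * Real.exp (2 * l * T) / (2 * l) ^ 7 *
      ((2 * l * r) ^ 7 * Real.exp (-(2 * l * r)))) atTop (𝓝 0) := by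
    have := ((Real.tendsto_pow_mul_exp_neg_atTop_nhds_zero 7).comp
      (tendsto_id.const_mul_atTop (by positivity : 0 < 2 * l))).const_mul
      (V * C ^ 2 * Real.exp (2 * l * T) / (2 * l) ^ 7)
    rw [mul_zero] at this
    exact this
  refine ge_of_tendsto hlim ?_
  filter_upwards [eventually_ge_atTop (T - t)] with r hr
  have h1 : coneEnergy u T x₁ t ≤ coneEnergy u T x₁ (T - r) :=
    hanti (show T - r ∈ Set.Iic t from by rw [Set.mem_Iic]; linarith)
      Set.self_mem_Iic (by linarith)
  refine h1.trans ((coneEnergy_le (M := (C * Real.exp (l * (T - r))) ^ 2) (by linarith)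
    fun y => pow_le_pow_left₀ (norm_nonneg _) (hdec _) 2).trans (le_of_eq ?_))
  have e : Real.exp (l * (T - r)) ^ 2 = Real.exp (2 * l * T) * Real.exp (-(2 * l * r)) := by
    rw [← Real.exp_nat_mul, ← Real.exp_add]
    congr 1
    push_cast; ring
  rw [mul_pow, e, sub_sub_cancel]
  field_simp
  rfl

end Energy

/-! ### Spatially compact solutions and charge conservation -/

section Propagation

open Filter Topology

theorem neg_eventAt (t : ℝ) (x : Space) : -eventAt t x = eventAt (-t) (-x) :=
  (map_neg eventEquiv (t, x)).symm

/-- `u` vanishes outside of the domain of influence of the ball of radius `R` at time zero. -/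
def SpatiallyBounded (R : ℝ) (u : Spacetime → Spinor) : Prop :=
  ∀ t x, R + |t| < ‖x‖ → u (eventAt t x) = 0

theorem SpatiallyBounded.reflect {R : ℝ} {u : Spacetime → Spinor} (h : SpatiallyBounded R u) :
    SpatiallyBounded R (reflect u) := fun t x hx => by
  refine reflect_eq_zero ?_
  rw [neg_eventAt]
  exact h _ _ (by rwa [abs_neg, norm_neg])

theorem SpatiallyBounded.sub {R : ℝ} {u v : Spacetime → Spinor} (hu : SpatiallyBounded R u)
    (hv : SpatiallyBounded R v) : SpatiallyBounded R (u - v) := fun t x hx => by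
  rw [Pi.sub_apply, hu t x hx, hv t x hx, sub_zero]

theorem SpatiallyBounded.mono {R R' : ℝ} {u : Spacetime → Spinor} (hu : SpatiallyBounded R u)
    (hR : R ≤ R') : SpatiallyBounded R' u := fun t x hx => hu t x (by linarith)

/-- Solutions propagate at most with the speed of light. -/
theorem spatiallyBounded_of_data {u : Spacetime → Spinor} (hu : ContDiff ℝ 1 u) {m : ℝ}
    {A : Spacetime → Fin 4 → ℝ} (h0 : ∀ z, diracOp m A u z = 0) {R : ℝ}
    (hd : ∀ x, R < ‖x‖ → u (eventAt 0 x) = 0) : SpatiallyBounded R u := by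
  -- The claim for positive times; negative times follow by reflection.
  have key : ∀ (v : Spacetime → Spinor) (B : Spacetime → Fin 4 → ℝ), ContDiff ℝ 1 v →
      (∀ z, diracOp m B v z = 0) → (∀ x, R < ‖x‖ → v (eventAt 0 x) = 0) → ∀ t x, 0 ≤ t →
      R + t < ‖x‖ → v (eventAt t x) = 0 := by
    intro v B hv h0 hd t x ht hx
    refine eq_zero_of_cauchy_data hv (m := m) (A := B) (t₀ := 0) (T := ‖x‖ - R) (x₁ := x)
      (fun _ _ _ _ => h0 _) (fun y hy => hd y ?_) ht (by rw [sub_self, norm_zero]; linarith)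
    have := norm_sub_norm_le x y
    rw [norm_sub_rev] at this
    linarith
  intro t x hx
  rcases le_or_gt 0 t with ht | ht
  · exact key u A hu h0 hd t x ht (by rwa [abs_of_nonneg ht] at hx)
  · have h1 := key (reflect u) (reflectPotential A) (contDiff_reflect hu)
      (fun z => by rw [diracOp_reflect hu, reflect_eq_zero (h0 _), neg_zero])
      (fun x hx => reflect_eq_zero (by
        rw [neg_eventAt, neg_zero]; exact hd _ (by rwa [norm_neg]))) (-t) (-x) (by linarith)
      (by rwa [abs_of_neg ht, ← norm_neg] at hx)
    rw [← reflect_reflect u]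
    refine reflect_eq_zero ?_
    rwa [neg_eventAt]

theorem CauchySurface.isClosed_carrier (S : CauchySurface) : IsClosed S.carrier := by
  have : S.carrier = {z | z 0 = S.height (position z)} := by
    ext z
    rw [← eventAt_position z, S.mem_iff]
    simp
  rw [this]
  exact isClosed_eq (continuous_apply 0) (S.continuous_height.comp continuous_position)

/-- The domain of influence of a ball meets a Cauchy surface in a compact set. -/
theorem SpatiallyBounded.isCompact {R : ℝ} {u : Spacetime → Spinor} (h : SpatiallyBounded R u)
    (S : CauchySurface) : IsCompact (tsupport u ∩ S.carrier) := by
  have hcl : IsClosed {x | ‖x‖ ≤ R + |S.height x|} :=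
    isClosed_le continuous_norm (continuous_const.add S.continuous_height.abs)
  have hK := (Metric.isCompact_of_isClosed_isBounded hcl (S.isBounded_cone R)).image
    S.continuous_chart
  refine hK.of_isClosed_subset ((isClosed_tsupport u).inter S.isClosed_carrier) ?_
  rintro z ⟨hz, hzS⟩
  have hz' : z ∈ {z | ‖position z‖ ≤ R + |z 0|} := by
    refine closure_minimal (fun z hz => ?_) (isClosed_le continuous_position.norm
      (continuous_const.add (continuous_apply 0).abs)) hz
    by_contra hcon
    simp only [Set.mem_ofPred_eq, not_le] at hcon
    refine hz ?_
    rw [← eventAt_position z]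
    exact h _ _ hcon
  rw [← eventAt_position z, S.mem_iff] at hzS
  refine ⟨position z, ?_, ?_⟩
  · simp only [Set.mem_ofPred_eq] at hz' ⊢
    rwa [← hzS]
  · rw [CauchySurface.chart, ← hzS, eventAt_position]

/-- The flux through the graphs of `τ k` depends continuously on `τ`. -/
theorem continuousOn_flux {J : Fin 4 → Spacetime → ℝ} (hJ : ∀ μ, ContDiff ℝ 1 (J μ))
    {k : Space → ℝ} (hk : ContDiff ℝ 1 k) {K : Set Space} (hK : IsCompact K) {s : Set ℝ}
    (hJK : ∀ τ ∈ s, ∀ x ∉ K, ∀ μ, J μ (eventAt (0 + τ * k x) x) = 0) :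
    ContinuousOn (fun τ => flux J fun x => 0 + τ * k x) s := by
  refine continuousOn_integral_of_compact_support (k := K) hK (Continuous.continuousOn ?_)
    fun τ x hτ hx => ?_
  · have hsd : ∀ (τ : ℝ) i x, sd i (fun x => 0 + τ * k x) x = τ * sd i k x := by
      intro τ i x
      have h2 : HasFDerivAt k (fderiv ℝ k x) x := (hk.differentiable (by simp) x).hasFDerivAt
      have h3 : HasFDerivAt (fun x => 0 + τ * k x) _ x := (h2.const_mul τ).const_add 0
      rw [sd, h3.fderiv]
      rfl
    simp only [Function.uncurry_def, hsd]
    have hkc := hk.continuous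
    have hev : Continuous fun p : ℝ × Space => eventAt (0 + p.1 * k p.2) p.2 :=
      Continuous.eventAt (by fun_prop) continuous_snd
    exact ((hJ 0).continuous.comp hev).sub (continuous_finsetSum _ fun i _ =>
      (continuous_fst.mul ((continuous_sd hk i).comp continuous_snd)).mul
        ((hJ _).continuous.comp hev))
  · simp only [hJK τ hτ x hx, mul_zero, Finset.sum_const_zero, sub_zero]

/-- Conservation of the total charge: a divergence free, spatially compact current has the same flux
through every Cauchy surface. -/
theorem flux_height_eq {J : Fin 4 → Spacetime → ℝ} (hJ : ∀ μ, ContDiff ℝ 1 (J μ))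
    (hdiv : ∀ z, divergence J z = 0) {R : ℝ}
    (hR : ∀ μ t x, R + |t| < ‖x‖ → J μ (eventAt t x) = 0) (S : CauchySurface) :
    flux J S.height = flux J fun _ => 0 := by
  have hcl : IsClosed {x | ‖x‖ ≤ R + |S.height x|} :=
    isClosed_le continuous_norm (continuous_const.add S.continuous_height.abs)
  have hK := Metric.isCompact_of_isClosed_isBounded hcl (S.isBounded_cone R)
  have hJK : ∀ τ ∈ Set.Icc (0 : ℝ) 1, ∀ x ∉ {x | ‖x‖ ≤ R + |S.height x|}, ∀ μ,
      J μ (eventAt (0 + τ * S.height x) x) = 0 := by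
    intro τ hτ x hx μ
    simp only [Set.mem_ofPred_eq, not_le] at hx
    refine hR _ _ _ (lt_of_le_of_lt ?_ hx)
    rw [zero_add, abs_mul, abs_of_nonneg hτ.1]
    have := mul_le_mul_of_nonneg_right hτ.2 (abs_nonneg (S.height x))
    linarith
  -- The surfaces `x⁰ = τ h(x)`, `0 ≤ τ ≤ 1`, interpolate between `{x⁰ = 0}` and `Σ`. At the end
  -- points only continuity in `τ` is available.
  have hcont := continuousOn_flux hJ S.contDiff_height hK hJK
  have hder : ∀ τ ∈ interior (Set.Icc (0 : ℝ) 1),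
      HasDerivAt (fun τ => flux J fun x => 0 + τ * S.height x) 0 τ := by
    intro τ hτ
    rw [interior_Icc] at hτ
    obtain ⟨δ, hδ, hball⟩ := Metric.isOpen_iff.1 isOpen_Ioo τ hτ
    have := hasDerivAt_flux hJ (h := fun _ => 0) contDiff_const S.contDiff_height hK hδ
      fun σ hσ => hJK σ (Set.Ioo_subset_Icc_self (hball hσ))
    simpa [hdiv] using this
  have hdiff : DifferentiableOn ℝ (fun τ => flux J fun x => 0 + τ * S.height x)
      (interior (Set.Icc (0 : ℝ) 1)) :=
    fun τ hτ => (hder τ hτ).differentiableAt.differentiableWithinAt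
  have h1 := antitoneOn_of_deriv_nonpos (convex_Icc 0 1) hcont hdiff
    fun τ hτ => (hder τ hτ).deriv.le
  have h2 := monotoneOn_of_deriv_nonneg (convex_Icc 0 1) hcont hdiff
    fun τ hτ => (hder τ hτ).deriv.ge
  have hl : (0 : ℝ) ∈ Set.Icc (0 : ℝ) 1 := ⟨le_rfl, zero_le_one⟩
  have hr : (1 : ℝ) ∈ Set.Icc (0 : ℝ) 1 := ⟨zero_le_one, le_rfl⟩
  have := le_antisymm (h1 hl hr zero_le_one) (h2 hl hr zero_le_one)
  simpa using this

end Propagation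

/-! ### Weighted integrability and convolutions -/

section Weights

open Filter Topology
open scoped Convolution FourierTransform

variable {V : Type*} [NormedAddCommGroup V] [InnerProductSpace ℝ V] [FiniteDimensional ℝ V]
  [MeasurableSpace V] [BorelSpace V] {F : Type*} [NormedAddCommGroup F] [NormedSpace ℂ F]

/-- The submultiplicative weight `(1 + ε|ξ|)^k`. -/
def polyWeight (ε : ℝ) (k : ℕ) (ξ : V) : ℝ := (1 + ε * ‖ξ‖) ^ k

theorem continuous_polyWeight (ε : ℝ) (k : ℕ) : Continuous (polyWeight ε k : V → ℝ) := by
  unfold polyWeight; fun_prop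

theorem one_le_polyWeight {ε : ℝ} (hε : 0 ≤ ε) (k : ℕ) (ξ : V) : 1 ≤ polyWeight ε k ξ :=
  one_le_pow₀ (by have := mul_nonneg hε (norm_nonneg ξ); linarith)

theorem polyWeight_nonneg {ε : ℝ} (hε : 0 ≤ ε) (k : ℕ) (ξ : V) : 0 ≤ polyWeight ε k ξ :=
  zero_le_one.trans (one_le_polyWeight hε k ξ)

/-- The weight is submultiplicative. -/
theorem polyWeight_le {ε : ℝ} (hε : 0 ≤ ε) (k : ℕ) (ξ η : V) :
    polyWeight ε k ξ ≤ polyWeight ε k η * polyWeight ε k (ξ - η) := by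
  rw [polyWeight, polyWeight, polyWeight, ← mul_pow]
  refine pow_le_pow_left₀ (by positivity) ?_ k
  have h1 : ‖ξ‖ ≤ ‖η‖ + ‖ξ - η‖ := by
    have := norm_add_le η (ξ - η)
    rwa [add_sub_cancel] at this
  have h2 := mul_le_mul_of_nonneg_left h1 hε
  have h3 : 0 ≤ ε * ‖η‖ * (ε * ‖ξ - η‖) := by positivity
  nlinarith

/-- The weighted `L¹`-norm of `f`. -/
def weightNorm (ε : ℝ) (k : ℕ) (f : V → F) : ℝ := ∫ ξ, polyWeight ε k ξ * ‖f ξ‖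

theorem weightNorm_nonneg {ε : ℝ} (hε : 0 ≤ ε) (k : ℕ) (f : V → F) : 0 ≤ weightNorm ε k f :=
  integral_nonneg fun ξ => mul_nonneg (polyWeight_nonneg hε k ξ) (norm_nonneg _)

/-- `f` is integrable against all polynomials. -/
structure RapidlyIntegrable (f : V → F) : Prop where
  measurable : AEStronglyMeasurable f volume
  integrable : ∀ ε, 0 ≤ ε → ∀ k, Integrable fun ξ => polyWeight ε k ξ * ‖f ξ‖

namespace RapidlyIntegrable

variable {f : V → F} (hf : RapidlyIntegrable f)
include hf

theorem integrable_self : Integrable f := by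
  have := hf.integrable 0 le_rfl 0
  simp only [polyWeight, pow_zero, one_mul] at this
  exact (integrable_norm_iff hf.measurable).1 this

theorem integrable_pow (k : ℕ) : Integrable fun ξ => ‖ξ‖ ^ k * ‖f ξ‖ := by
  refine (hf.integrable 1 zero_le_one k).mono
    ((continuous_norm.pow k).aestronglyMeasurable.mul hf.measurable.norm)
    (Eventually.of_forall fun ξ => ?_)
  rw [norm_mul, norm_mul, norm_norm, polyWeight, norm_pow, norm_pow, norm_norm]
  refine mul_le_mul_of_nonneg_right (pow_le_pow_left₀ (norm_nonneg _) ?_ k) (norm_nonneg _)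
  rw [one_mul, Real.norm_of_nonneg (by positivity)]
  linarith

theorem integral_pow_le {ε : ℝ} (hε : 0 < ε) (k : ℕ) :
    ∫ ξ, ‖ξ‖ ^ k * ‖f ξ‖ ≤ (ε⁻¹) ^ k * weightNorm ε k f := by
  rw [weightNorm, ← integral_const_mul]
  refine integral_mono (hf.integrable_pow k) ((hf.integrable ε hε.le k).const_mul _) fun ξ => ?_
  simp only
  rw [← mul_assoc]
  refine mul_le_mul_of_nonneg_right ?_ (norm_nonneg _)
  rw [polyWeight, ← mul_pow]
  refine pow_le_pow_left₀ (norm_nonneg _) ?_ k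
  have : ε⁻¹ * (1 + ε * ‖ξ‖) = ε⁻¹ + ‖ξ‖ := by field_simp
  rw [this]
  have := inv_pos.2 hε
  linarith

theorem aestronglyMeasurable_multiplier {G : Type*} [NormedAddCommGroup G] [NormedSpace ℂ G]
    {R : V → F →L[ℂ] G} (hR : Continuous R) :
    AEStronglyMeasurable (fun ξ => R ξ (f ξ)) volume :=
  Continuous.comp_aestronglyMeasurable (g := fun p : (F →L[ℂ] G) × F => p.1 p.2)
    (isBoundedBilinearMap_apply (𝕜 := ℂ)).continuous (hR.aestronglyMeasurable.prodMk hf.measurable)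

theorem multiplier {G : Type*} [NormedAddCommGroup G] [NormedSpace ℂ G] {R : V → F →L[ℂ] G}
    (hR : Continuous R) {c : ℝ} (hRc : ∀ ξ v, ‖R ξ v‖ ≤ c * ‖v‖) :
    RapidlyIntegrable fun ξ => R ξ (f ξ) where
  measurable := hf.aestronglyMeasurable_multiplier hR
  integrable ε hε k := by
    refine ((hf.integrable ε hε k).const_mul c).mono
      ((continuous_polyWeight ε k).aestronglyMeasurable.mul
        (hf.aestronglyMeasurable_multiplier hR).norm) (Eventually.of_forall fun ξ => ?_)
    have h1 := polyWeight_nonneg hε k ξ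
    rw [Real.norm_of_nonneg (mul_nonneg h1 (norm_nonneg _))]
    refine le_trans ?_ (le_abs_self _)
    have := mul_le_mul_of_nonneg_left (hRc ξ (f ξ)) h1
    linarith

theorem weightNorm_multiplier_le {G : Type*} [NormedAddCommGroup G] [NormedSpace ℂ G]
    {R : V → F →L[ℂ] G} (hR : Continuous R) {c : ℝ} (hRc : ∀ ξ v, ‖R ξ v‖ ≤ c * ‖v‖) {ε : ℝ}
    (hε : 0 ≤ ε) (k : ℕ) :
    weightNorm ε k (fun ξ => R ξ (f ξ)) ≤ c * weightNorm ε k f := by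
  rw [weightNorm, weightNorm, ← integral_const_mul]
  refine integral_mono ((hf.multiplier hR hRc).integrable ε hε k)
    ((hf.integrable ε hε k).const_mul c) fun ξ => ?_
  have := mul_le_mul_of_nonneg_left (hRc ξ (f ξ)) (polyWeight_nonneg hε k ξ)
  simp only
  linarith

end RapidlyIntegrable

section Convolution

variable [CompleteSpace F] {N : V → F →L[ℂ] F} {f : V → F}

/-- The convolution of an operator valued function with a vector valued function. -/
def opConvolution (N : V → F →L[ℂ] F) (f : V → F) : V → F :=
  N ⋆[ContinuousLinearMap.id ℂ (F →L[ℂ] F)] f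

theorem integrable_opConvolution (hN : Integrable N) (hf : Integrable f) :
    Integrable (opConvolution N f) := hN.integrable_convolution _ hf

theorem norm_opConvolution_le (hN : RapidlyIntegrable N) (hf : RapidlyIntegrable f) {ε : ℝ}
    (hε : 0 ≤ ε) (k : ℕ) : ∀ᵐ ξ, polyWeight ε k ξ * ‖opConvolution N f ξ‖ ≤
      ((fun ξ => polyWeight ε k ξ * ‖N ξ‖) ⋆[ContinuousLinearMap.mul ℝ ℝ]
        fun ξ => polyWeight ε k ξ * ‖f ξ‖) ξ := by
  filter_upwards [(hN.integrable ε hε k).ae_convolution_exists (ContinuousLinearMap.mul ℝ ℝ)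
    (hf.integrable ε hε k)] with ξ hξ
  rw [opConvolution, convolution, convolution]
  have h1 := polyWeight_nonneg hε k ξ
  calc polyWeight ε k ξ * ‖∫ η, (ContinuousLinearMap.id ℂ (F →L[ℂ] F) (N η)) (f (ξ - η))‖
      ≤ polyWeight ε k ξ * ∫ η, ‖(ContinuousLinearMap.id ℂ (F →L[ℂ] F) (N η)) (f (ξ - η))‖ :=
        mul_le_mul_of_nonneg_left (norm_integral_le_integral_norm _) h1
    _ = ∫ η, polyWeight ε k ξ * ‖N η (f (ξ - η))‖ := (integral_const_mul _ _).symm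
    _ ≤ _ := by
        refine integral_mono_of_nonneg (Eventually.of_forall fun η =>
          mul_nonneg h1 (norm_nonneg _)) hξ (Eventually.of_forall fun η => ?_)
        simp only [ContinuousLinearMap.mul_apply']
        have h2 := (N η).le_opNorm (f (ξ - η))
        have h3 := polyWeight_le hε k ξ η
        have h4 : 0 ≤ ‖N η‖ * ‖f (ξ - η)‖ := by positivity
        calc polyWeight ε k ξ * ‖N η (f (ξ - η))‖ ≤ polyWeight ε k ξ * (‖N η‖ * ‖f (ξ - η)‖) :=
              mul_le_mul_of_nonneg_left h2 h1
          _ ≤ (polyWeight ε k η * polyWeight ε k (ξ - η)) * (‖N η‖ * ‖f (ξ - η)‖) :=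
              mul_le_mul_of_nonneg_right h3 h4
          _ = _ := by ring

theorem RapidlyIntegrable.opConvolution (hN : RapidlyIntegrable N) (hf : RapidlyIntegrable f) :
    RapidlyIntegrable (opConvolution N f) := by
  have hm := (integrable_opConvolution hN.integrable_self hf.integrable_self).aestronglyMeasurable
  refine ⟨hm, fun ε hε k => ?_⟩
  refine ((hN.integrable ε hε k).integrable_convolution (ContinuousLinearMap.mul ℝ ℝ)
    (hf.integrable ε hε k)).mono
    ((continuous_polyWeight ε k).aestronglyMeasurable.mul hm.norm) ?_
  filter_upwards [norm_opConvolution_le hN hf hε k] with ξ h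
  rw [Real.norm_of_nonneg (mul_nonneg (polyWeight_nonneg hε k ξ) (norm_nonneg _))]
  exact h.trans (le_abs_self _)

/-- By submultiplicativity of the weight, the weighted `L¹`-spaces form a convolution algebra. -/
theorem weightNorm_opConvolution_le (hN : RapidlyIntegrable N) (hf : RapidlyIntegrable f) {ε : ℝ}
    (hε : 0 ≤ ε) (k : ℕ) :
    weightNorm ε k (_root_.opConvolution N f) ≤ weightNorm ε k N * weightNorm ε k f := by
  have h := integral_convolution (ContinuousLinearMap.mul ℝ ℝ) (hN.integrable ε hε k)
    (hf.integrable ε hε k)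
  rw [ContinuousLinearMap.mul_apply'] at h
  rw [weightNorm, weightNorm, weightNorm, ← h]
  exact integral_mono_ae ((hN.opConvolution hf).integrable ε hε k)
    ((hN.integrable ε hε k).integrable_convolution _ (hf.integrable ε hε k))
    (norm_opConvolution_le hN hf hε k)

/-- The Fourier transform turns the convolution into a pointwise product. -/
theorem fourier_opConvolution (hN : Integrable N) (hf : Integrable f) (x : V) :
    𝓕 (_root_.opConvolution N f) x = 𝓕 N x (𝓕 f x) :=
  Real.fourier_bilin_convolution_eq (ContinuousLinearMap.id ℂ (F →L[ℂ] F)) hN hf x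

end Convolution

theorem SchwartzMap.rapidlyIntegrable (f : SchwartzMap V F) : RapidlyIntegrable (f : V → F) where
  measurable := f.continuous.aestronglyMeasurable
  integrable ε hε k := by
    have e : (fun ξ => polyWeight ε k ξ * ‖f ξ‖) = fun ξ =>
        ∑ j ∈ Finset.range (k + 1), (ε ^ j * (k.choose j : ℝ)) * (‖ξ‖ ^ j * ‖f ξ‖) := by
      funext ξ
      rw [polyWeight, add_comm, add_pow, Finset.sum_mul]
      refine Finset.sum_congr rfl fun j _ => ?_
      rw [one_pow, mul_pow]; ring
    rw [e]
    exact integrable_finsetSum _ fun j _ => (f.integrable_pow_mul volume j).const_mul _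

/-- Small weights do not increase the weighted norm by much. -/
theorem RapidlyIntegrable.exists_weightNorm_lt {f : V → F} (hf : RapidlyIntegrable f) {l : ℝ}
    (hl : ∫ ξ, ‖f ξ‖ < l) (k : ℕ) : ∃ ε > 0, weightNorm ε k f < l := by
  have hlim : Tendsto (fun ε : ℝ => weightNorm ε k f) (𝓝[>] 0) (𝓝 (∫ ξ, ‖f ξ‖)) := by
    refine tendsto_integral_filter_of_dominated_convergence
      (fun ξ => polyWeight 1 k ξ * ‖f ξ‖) ?_ ?_ (hf.integrable 1 zero_le_one k) ?_
    · exact Eventually.of_forall fun ε =>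
        (continuous_polyWeight ε k).aestronglyMeasurable.mul hf.measurable.norm
    · filter_upwards [self_mem_nhdsWithin, mem_nhdsWithin_of_mem_nhds (Iio_mem_nhds one_pos)]
        with ε h0 h1
      refine Eventually.of_forall fun ξ => ?_
      have h0' : 0 ≤ ε := le_of_lt h0
      rw [Real.norm_of_nonneg (mul_nonneg (polyWeight_nonneg h0' k ξ) (norm_nonneg _))]
      refine mul_le_mul_of_nonneg_right (pow_le_pow_left₀ (by positivity) ?_ k) (norm_nonneg _)
      have := mul_le_mul_of_nonneg_right (le_of_lt (Set.mem_Iio.1 h1)) (norm_nonneg ξ)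
      linarith
    · refine Eventually.of_forall fun ξ => ?_
      have hc : Continuous fun ε : ℝ => polyWeight ε k ξ * ‖f ξ‖ := by
        unfold polyWeight; fun_prop
      have := hc.tendsto 0
      simp only [polyWeight, zero_mul, add_zero, one_pow, one_mul] at this
      exact this.mono_left nhdsWithin_le_nhds
  obtain ⟨ε, h1, h2⟩ := ((hlim.eventually (gt_mem_nhds hl)).and self_mem_nhdsWithin).exists
  exact ⟨ε, h2, h1⟩

end Weights

/-! ### Neumann series in Fourier space -/

section NeumannSeries

open Filter Topology
open scoped FourierTransform

variable {V : Type*} [NormedAddCommGroup V] [InnerProductSpace ℝ V] [FiniteDimensional ℝ V]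
  [MeasurableSpace V] [BorelSpace V] {F : Type*} [NormedAddCommGroup F] [NormedSpace ℂ F]
  [CompleteSpace F]

theorem RapidlyIntegrable.contDiff_fourier {f : V → F} (hf : RapidlyIntegrable f) :
    ContDiff ℝ ∞ (𝓕 f) :=
  Real.contDiff_fourier (N := ⊤) fun n _ => hf.integrable_pow n

theorem RapidlyIntegrable.norm_iteratedFDeriv_fourier_le {f : V → F} (hf : RapidlyIntegrable f)
    (k : ℕ) (x : V) : ‖iteratedFDeriv ℝ k (𝓕 f) x‖ ≤
      (2 * Real.pi * ‖(innerSL ℝ : V →L[ℝ] V →L[ℝ] ℝ)‖) ^ k * ∫ ξ, ‖ξ‖ ^ k * ‖f ξ‖ := by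
  rw [Real.iteratedFDeriv_fourier (N := ⊤) (fun n _ => hf.integrable_pow n) hf.measurable le_top,
    Real.fourier_eq, ← integral_const_mul]
  refine norm_integral_le_of_norm_le ((hf.integrable_pow k).const_mul _)
    (Eventually.of_forall fun ξ => ?_)
  rw [Circle.norm_smul, ← mul_assoc]
  exact VectorFourier.norm_fourierPowSMulRight_le _ _ _ _

theorem RapidlyIntegrable.fderiv_fourier_apply {f : V → F} (hf : RapidlyIntegrable f) (x w : V) :
    fderiv ℝ (𝓕 f) x w =
      𝓕 (fun ξ => (-(2 * Real.pi * Complex.I) * (inner ℝ ξ w : ℝ) : ℂ) • f ξ) x := by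
  have h1 : Integrable fun ξ => ‖ξ‖ * ‖f ξ‖ := by simpa using hf.integrable_pow 1
  rw [Real.fderiv_fourier hf.integrable_self h1, Real.fourier_eq, Real.fourier_eq,
    ContinuousLinearMap.integral_apply]
  · refine integral_congr_ae (Eventually.of_forall fun ξ => ?_)
    simp only [_root_.smul_apply, VectorFourier.fourierSMulRight_apply, Circle.smul_def]
    rw [innerSL_apply_apply, mul_smul]
    simp
  · refine (h1.const_mul (2 * Real.pi * ‖(innerSL ℝ : V →L[ℝ] V →L[ℝ] ℝ)‖)).mono'
      ?_ (Eventually.of_forall fun ξ => ?_)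
    · refine Continuous.aestronglyMeasurable (by fun_prop) |>.smul ?_
      exact hf.measurable.fourierSMulRight
    · rw [Circle.norm_smul]
      refine (VectorFourier.norm_fourierSMulRight_le _ _ _).trans (le_of_eq (by ring))

/-- The summands of the Neumann series `∑ₙ (R (N ⋆ ·))ⁿ f`. -/
def neumannTerm (N R : V → F →L[ℂ] F) (f : V → F) : ℕ → V → F
  | 0 => f
  | n + 1 => fun ξ => R ξ (opConvolution N (neumannTerm N R f n) ξ)

variable {N R : V → F →L[ℂ] F} {f : V → F} (hN : RapidlyIntegrable N) (hR : Continuous R) {l : ℝ}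
  (hRc : ∀ ξ v, ‖R ξ v‖ ≤ l⁻¹ * ‖v‖) (hl : ∫ ξ, ‖N ξ‖ < l) (hf : RapidlyIntegrable f)
include hN hR hRc hf

theorem rapidlyIntegrable_neumannTerm (n : ℕ) : RapidlyIntegrable (neumannTerm N R f n) := by
  induction n with
  | zero => exact hf
  | succ n ih => exact (hN.opConvolution ih).multiplier hR hRc

include hl

/-- The key estimate: for a suitable weight, the Neumann series is dominated by a geometric one. -/
theorem summable_integral_pow_neumannTerm (k : ℕ) :
    Summable fun n => ∫ ξ, ‖ξ‖ ^ k * ‖neumannTerm N R f n ξ‖ := by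
  -- Only the unweighted norm of `N` is less than `l`; a small `ε` preserves this for the weighted
  -- norm of every order `k`.
  obtain ⟨ε, hε, hlt⟩ := hN.exists_weightNorm_lt hl k
  have h0 : 0 ≤ weightNorm ε k N := weightNorm_nonneg hε.le k N
  have hl0 : 0 < l := h0.trans_lt hlt
  have hI := rapidlyIntegrable_neumannTerm hN hR hRc hf
  have hb : ∀ n, weightNorm ε k (neumannTerm N R f n) ≤
      (l⁻¹ * weightNorm ε k N) ^ n * weightNorm ε k f := by
    intro n
    induction n with
    | zero => simp [neumannTerm]
    | succ n ih =>
      calc weightNorm ε k (neumannTerm N R f (n + 1))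
          ≤ l⁻¹ * weightNorm ε k (opConvolution N (neumannTerm N R f n)) :=
            (hN.opConvolution (hI n)).weightNorm_multiplier_le hR hRc hε.le k
        _ ≤ l⁻¹ * (weightNorm ε k N * weightNorm ε k (neumannTerm N R f n)) :=
            mul_le_mul_of_nonneg_left (weightNorm_opConvolution_le hN (hI n) hε.le k)
              (inv_nonneg.2 hl0.le)
        _ ≤ l⁻¹ * (weightNorm ε k N * ((l⁻¹ * weightNorm ε k N) ^ n * weightNorm ε k f)) := by
            gcongr
        _ = _ := by ring
  have hq : l⁻¹ * weightNorm ε k N < 1 := by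
    rw [inv_mul_lt_iff₀ hl0, mul_one]; exact hlt
  refine Summable.of_nonneg_of_le (fun n => integral_nonneg fun ξ => by positivity)
    (fun n => ((hI n).integral_pow_le hε k).trans
      (mul_le_mul_of_nonneg_left (hb n) (by positivity))) ?_
  exact ((summable_geometric_of_lt_one (by positivity) hq).mul_right _).mul_left _

theorem summable_norm_fourier_neumannTerm (k : ℕ) :
    ∃ v : ℕ → ℝ, Summable v ∧ ∀ n x, ‖iteratedFDeriv ℝ k (𝓕 (neumannTerm N R f n)) x‖ ≤ v n :=
  ⟨_, (summable_integral_pow_neumannTerm hN hR hRc hl hf k).mul_left _, fun n x =>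
    (rapidlyIntegrable_neumannTerm hN hR hRc hf n).norm_iteratedFDeriv_fourier_le k x⟩

/-- The Neumann series converges, together with all derivatives, to a bounded smooth function. -/
theorem exists_neumannSeries : ∃ φ : V → F, ContDiff ℝ ∞ φ ∧ (∃ C, ∀ x, ‖φ x‖ ≤ C) ∧
    (∀ x, HasSum (fun n => 𝓕 (neumannTerm N R f n) x) (φ x)) ∧
    ∀ x, HasSum (fun n => fderiv ℝ (𝓕 (neumannTerm N R f n)) x) (fderiv ℝ φ x) := by
  choose v hv hvb using summable_norm_fourier_neumannTerm hN hR hRc hl hf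
  have hC : ∀ n, ContDiff ℝ ∞ (𝓕 (neumannTerm N R f n)) := fun n =>
    (rapidlyIntegrable_neumannTerm hN hR hRc hf n).contDiff_fourier
  have hb0 : ∀ n x, ‖𝓕 (neumannTerm N R f n) x‖ ≤ v 0 n := fun n x => by
    have := hvb 0 n x
    rwa [norm_iteratedFDeriv_zero] at this
  have hb1 : ∀ n x, ‖fderiv ℝ (𝓕 (neumannTerm N R f n)) x‖ ≤ v 1 n := fun n x => by
    have := hvb 1 n x
    rwa [norm_iteratedFDeriv_one] at this
  have hs0 : ∀ x, Summable fun n => 𝓕 (neumannTerm N R f n) x := fun x =>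
    Summable.of_norm_bounded (hv 0) fun n => hb0 n x
  refine ⟨fun x => ∑' n, 𝓕 (neumannTerm N R f n) x, ?_, ⟨∑' n, v 0 n, fun x => ?_⟩,
    fun x => (hs0 x).hasSum, fun x => ?_⟩
  · exact contDiff_tsum (N := ⊤) hC (fun k _ => hv k) fun k n x _ => hvb k n x
  · exact tsum_of_norm_bounded (hv 0).hasSum fun n => hb0 n x
  · rw [fderiv_tsum_apply (hv 1) (fun n => (hC n).differentiable (by simp)) hb1 (hs0 0) x]
    exact (Summable.of_norm_bounded (hv 1) fun n => hb1 n x).hasSum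

end NeumannSeries

/-! ### The inhomogeneous Dirac equation -/

section Inhomogeneous

open Filter Topology
open scoped FourierTransform

/-- Space-time with a Euclidean norm, the domain of the Fourier transform. -/
abbrev EuclideanSpacetime : Type := EuclideanSpace ℝ (Fin 4)

theorem integrable_circle_smul {f : EuclideanSpacetime → Spinor} (hf : Integrable f)
    (x : EuclideanSpacetime) : Integrable fun ξ => Real.fourierChar (-inner ℝ ξ x) • f ξ :=
  (Real.fourierIntegral_convergent_iff x).2 hf

theorem fourier_clm_apply (T : Spinor →L[ℂ] Spinor) {f : EuclideanSpacetime → Spinor}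
    (hf : Integrable f) (x : EuclideanSpacetime) : 𝓕 (fun ξ => T (f ξ)) x = T (𝓕 f x) := by
  rw [Real.fourier_eq, Real.fourier_eq, ← T.integral_comp_comm (integrable_circle_smul hf x)]
  refine integral_congr_ae (Eventually.of_forall fun ξ => ?_)
  simp only [Circle.smul_def, map_smul]

theorem fourier_add_apply {f g : EuclideanSpacetime → Spinor} (hf : Integrable f)
    (hg : Integrable g) (x : EuclideanSpacetime) :
    𝓕 (fun ξ => f ξ + g ξ) x = 𝓕 f x + 𝓕 g x := by
  rw [Real.fourier_eq, Real.fourier_eq, Real.fourier_eq,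
    ← integral_add (integrable_circle_smul hf x) (integrable_circle_smul hg x)]
  simp only [smul_add]

theorem fourier_sum_apply {f : Fin 4 → EuclideanSpacetime → Spinor} (hf : ∀ μ, Integrable (f μ))
    (x : EuclideanSpacetime) : 𝓕 (fun ξ => ∑ μ, f μ ξ) x = ∑ μ, 𝓕 (f μ) x := by
  simp only [Real.fourier_eq]
  rw [← integral_finsetSum _ fun μ _ => integrable_circle_smul (hf μ) x]
  simp only [Finset.smul_sum]

/-- The Fourier symbol of `∂₀ + αⁱ∂ᵢ + imγ⁰ + l`. -/
def diracSymbol (m l : ℝ) (ξ : EuclideanSpacetime) : Spinor →L[ℂ] Spinor :=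
  ∑ μ, (-(2 * Real.pi * Complex.I) * (ξ μ : ℝ) : ℂ) • spinL (alphaMat μ) +
    ((l : ℂ) • ContinuousLinearMap.id ℂ Spinor + (Complex.I * m) • spinL (gammaMat 0))

theorem continuous_diracSymbol (m l : ℝ) : Continuous (diracSymbol m l) := by
  unfold diracSymbol
  fun_prop

theorem diracSymbol_apply (m l : ℝ) (ξ : EuclideanSpacetime) (v : Spinor) :
    diracSymbol m l ξ v =
      ∑ μ, spinL (alphaMat μ) ((-(2 * Real.pi * Complex.I) * (ξ μ : ℝ) : ℂ) • v) +
        ((l : ℂ) • v + (Complex.I * m) • spinL (gammaMat 0) v) := by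
  simp [diracSymbol]

/-- All terms of the symbol but `l` are skew-adjoint. -/
theorem re_inner_diracSymbol (m l : ℝ) (ξ : EuclideanSpacetime) (v : Spinor) :
    (inner ℂ v (diracSymbol m l ξ v) : ℂ).re = l * ‖v‖ ^ 2 := by
  have h1 : ∀ μ, (inner ℂ v (spinL (alphaMat μ)
      ((-(2 * Real.pi * Complex.I) * (ξ μ : ℝ) : ℂ) • v)) : ℂ).re = 0 := fun μ => by
    have := re_inner_spinL_I (alphaMat_isHermitian μ) (-(2 * Real.pi) * ξ μ) v
    rw [← this, map_smul]
    push_cast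
    ring_nf
  have h2 : (inner ℂ v v : ℂ) = ((‖v‖ ^ 2 : ℝ) : ℂ) := by
    rw [inner_self_eq_norm_sq_to_K]; norm_cast
  rw [diracSymbol_apply, inner_add_right, inner_add_right, inner_sum, Complex.add_re,
    Complex.add_re, Complex.re_sum, Finset.sum_eq_zero fun μ _ => h1 μ,
    re_inner_spinL_I gammaMat_zero_isHermitian, inner_smul_right, h2, zero_add, add_zero,
    ← Complex.ofReal_mul, Complex.ofReal_re]

/-- The symbol is accretive, hence invertible with an inverse bounded by `l⁻¹`. -/
theorem exists_diracSymbol_inverse (m : ℝ) {l : ℝ} (hl : 0 < l) :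
    ∃ R : EuclideanSpacetime → Spinor →L[ℂ] Spinor, Continuous R ∧
      (∀ ξ v, ‖R ξ v‖ ≤ l⁻¹ * ‖v‖) ∧ ∀ ξ v, diracSymbol m l ξ (R ξ v) = v := by
  have hu : ∀ ξ, IsUnit (diracSymbol m l ξ) := fun ξ => by
    refine ContinuousLinearMap.isUnit_of_forall_le_norm_inner_map _ (c := ⟨l, hl.le⟩) hl fun v => ?_
    rw [← inner_conj_symm, RCLike.norm_conj]
    refine le_trans (le_of_eq ?_) (Complex.re_le_norm _)
    rw [re_inner_diracSymbol, mul_comm]; rfl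
  have hinv : ∀ ξ v, diracSymbol m l ξ (Ring.inverse (diracSymbol m l ξ) v) = v := fun ξ v => by
    have := Ring.mul_inverse_cancel _ (hu ξ)
    exact congrArg (fun T : Spinor →L[ℂ] Spinor => T v) this
  refine ⟨fun ξ => Ring.inverse (diracSymbol m l ξ), ?_, fun ξ v => ?_, hinv⟩
  · rw [continuous_iff_continuousAt]
    intro ξ
    obtain ⟨w, hw⟩ := hu ξ
    have h1 := NormedRing.inverse_continuousAt w
    rw [hw] at h1
    exact ContinuousAt.comp h1 (continuous_diracSymbol m l).continuousAt
  · set w := Ring.inverse (diracSymbol m l ξ) v with hw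
    have h1 := re_inner_diracSymbol m l ξ w
    rw [hinv] at h1
    have h2 : l * ‖w‖ ^ 2 ≤ ‖w‖ * ‖v‖ := by
      rw [← h1]
      exact (Complex.re_le_norm _).trans (norm_inner_le_norm _ _)
    rcases eq_or_lt_of_le (norm_nonneg w) with h0 | h0
    · rw [← h0]; positivity
    · rw [le_inv_mul_iff₀ hl]
      nlinarith

/-- The symbol is the Dirac operator in Fourier space. -/
theorem fourier_diracSymbol (m l : ℝ) {f : EuclideanSpacetime → Spinor} (hf : RapidlyIntegrable f)
    (x : EuclideanSpacetime) : 𝓕 (fun ξ => diracSymbol m l ξ (f ξ)) x =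
      ∑ μ, spinL (alphaMat μ) (fderiv ℝ (𝓕 f) x (EuclideanSpace.single μ 1)) +
        ((l : ℂ) • 𝓕 f x + (Complex.I * m) • spinL (gammaMat 0) (𝓕 f x)) := by
  have h1 : ∀ μ : Fin 4, Integrable fun ξ : EuclideanSpacetime =>
      (-(2 * Real.pi * Complex.I) * (ξ μ : ℝ) : ℂ) • f ξ := fun μ => by
    refine ((hf.integrable_pow 1).const_mul (2 * Real.pi)).mono'
      ((by fun_prop : Continuous fun ξ : EuclideanSpacetime =>
        (-(2 * Real.pi * Complex.I) * (ξ μ : ℝ) : ℂ)).aestronglyMeasurable.smul hf.measurable)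
      (Eventually.of_forall fun ξ => ?_)
    rw [norm_smul]
    have h2 : ‖(-(2 * Real.pi * Complex.I) * (ξ μ : ℝ) : ℂ)‖ = 2 * Real.pi * ‖ξ μ‖ := by
      simp [abs_of_pos Real.pi_pos]
    rw [h2, pow_one]
    have h3 := mul_le_mul_of_nonneg_right (PiLp.norm_apply_le ξ μ) (norm_nonneg (f ξ))
    have := mul_le_mul_of_nonneg_left h3 Real.two_pi_pos.le
    linarith
  have h2 : ∀ μ, Integrable fun ξ : EuclideanSpacetime => spinL (alphaMat μ)
      ((-(2 * Real.pi * Complex.I) * (ξ μ : ℝ) : ℂ) • f ξ) := fun μ =>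
    (spinL (alphaMat μ)).integrable_comp (h1 μ)
  have h3 : Integrable fun ξ => (l : ℂ) • f ξ := hf.integrable_self.smul (l : ℂ)
  have h4 : Integrable fun ξ => (Complex.I * m : ℂ) • spinL (gammaMat 0) (f ξ) :=
    ((spinL (gammaMat 0)).integrable_comp hf.integrable_self).smul (Complex.I * m : ℂ)
  have e : (fun ξ => diracSymbol m l ξ (f ξ)) = fun ξ => (∑ μ, spinL (alphaMat μ)
      ((-(2 * Real.pi * Complex.I) * (ξ μ : ℝ) : ℂ) • f ξ)) +
        ((l : ℂ) • f ξ + (Complex.I * m : ℂ) • spinL (gammaMat 0) (f ξ)) := by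
    funext ξ; rw [diracSymbol_apply]
  have h34 : Integrable fun ξ => (l : ℂ) • f ξ + (Complex.I * m : ℂ) • spinL (gammaMat 0) (f ξ) :=
    h3.add h4
  rw [e, fourier_add_apply (integrable_finsetSum _ fun μ _ => h2 μ) h34,
    fourier_sum_apply h2, fourier_add_apply h3 h4]
  have h5 := fourier_clm_apply ((l : ℂ) • ContinuousLinearMap.id ℂ Spinor) hf.integrable_self x
  have h6 := fourier_clm_apply ((Complex.I * m : ℂ) • spinL (gammaMat 0)) hf.integrable_self x
  simp only [_root_.smul_apply, ContinuousLinearMap.id_apply] at h5 h6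
  rw [h5, h6]
  congr 1
  refine Finset.sum_congr rfl fun μ _ => ?_
  rw [fourier_clm_apply _ (h1 μ), hf.fderiv_fourier_apply]
  simp [EuclideanSpace.inner_single_right]

/-- For `l` large compared with the potential `N₀`, the equation
`(∂₀ + αⁱ∂ᵢ + l + imγ⁰ + N₀) φ = g₀` is solved by a Neumann series in Fourier space. -/
theorem exists_bounded_solution (m : ℝ) {N₀ : EuclideanSpacetime → Spinor →L[ℂ] Spinor}
    (hN₀ : ContDiff ℝ ∞ N₀) (hN₀' : HasCompactSupport N₀) : ∃ l : ℝ, 0 < l ∧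
      ∀ g₀ : EuclideanSpacetime → Spinor, ContDiff ℝ ∞ g₀ → HasCompactSupport g₀ →
      ∃ φ : EuclideanSpacetime → Spinor, ContDiff ℝ ∞ φ ∧ (∃ C, ∀ x, ‖φ x‖ ≤ C) ∧
        ∀ x, ∑ μ, spinL (alphaMat μ) (fderiv ℝ φ x (EuclideanSpace.single μ 1)) +
          ((l : ℂ) • φ x + (Complex.I * m) • spinL (gammaMat 0) (φ x)) = g₀ x - N₀ x (φ x) := by
  let NS := hN₀'.toSchwartzMap hN₀
  let N : SchwartzMap EuclideanSpacetime (Spinor →L[ℂ] Spinor) := 𝓕⁻ NS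
  have hN : RapidlyIntegrable (N : EuclideanSpacetime → Spinor →L[ℂ] Spinor) := N.rapidlyIntegrable
  have hNF : ∀ x, 𝓕 (N : EuclideanSpacetime → Spinor →L[ℂ] Spinor) x = N₀ x := fun x => by
    have : 𝓕 N = NS := FourierTransform.fourier_fourierInv_eq NS
    rw [← SchwartzMap.fourier_coe, this]
    rfl
  -- The Neumann series converges if the resolvent bound `l⁻¹` beats the norm of the convolution
  -- with `N`.
  obtain ⟨l, hl⟩ := exists_gt (∫ ξ, ‖N ξ‖)
  have hl0 : 0 < l := (integral_nonneg fun ξ => norm_nonneg _).trans_lt hl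
  obtain ⟨R, hR, hRc, hRi⟩ := exists_diracSymbol_inverse m hl0
  refine ⟨l, hl0, fun g₀ hg₀ hg₀' => ?_⟩
  let gS := hg₀'.toSchwartzMap hg₀
  let g : SchwartzMap EuclideanSpacetime Spinor := 𝓕⁻ gS
  have hgF : ∀ x, 𝓕 (g : EuclideanSpacetime → Spinor) x = g₀ x := fun x => by
    have : 𝓕 g = gS := FourierTransform.fourier_fourierInv_eq gS
    rw [← SchwartzMap.fourier_coe, this]
    rfl
  clear_value N g
  let R' : EuclideanSpacetime → Spinor →L[ℂ] Spinor := fun ξ => -R ξ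
  have hR' : Continuous R' := hR.neg
  have hRc' : ∀ ξ v, ‖R' ξ v‖ ≤ l⁻¹ * ‖v‖ := fun ξ v => by
    have := hRc ξ v
    simpa [R'] using this
  have hf := g.rapidlyIntegrable.multiplier hR hRc
  set f := neumannTerm N R' (fun ξ => R ξ (g ξ)) with hfdef
  have hfI : ∀ n, RapidlyIntegrable (f n) := rapidlyIntegrable_neumannTerm hN hR' hRc' hf
  have hf0 : ∀ ξ, f 0 ξ = R ξ (g ξ) := fun ξ => rfl
  have hfs : ∀ n ξ, f (n + 1) ξ = -(R ξ (opConvolution N (f n) ξ)) := fun n ξ => rfl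
  obtain ⟨φ, hφ, hC, hs, hs'⟩ := exists_neumannSeries hN hR' hRc' hl hf
  rw [← hfdef] at hs hs'
  clear_value f
  refine ⟨φ, hφ, hC, fun x => ?_⟩
  -- The equation is summed term by term.
  have hD0 := fourier_diracSymbol m l (hfI 0) x
  have e0 : (fun ξ => diracSymbol m l ξ (f 0 ξ)) = g := by
    funext ξ
    rw [hf0, hRi]
  rw [e0, hgF] at hD0
  have hDs : ∀ n, ∑ μ, spinL (alphaMat μ)
      (fderiv ℝ (𝓕 (f (n + 1))) x (EuclideanSpace.single μ 1)) + ((l : ℂ) • 𝓕 (f (n + 1)) x +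
        (Complex.I * m) • spinL (gammaMat 0) (𝓕 (f (n + 1)) x)) = -(N₀ x (𝓕 (f n) x)) := by
    intro n
    have e : (fun ξ => diracSymbol m l ξ (f (n + 1) ξ)) =
        fun ξ => (-ContinuousLinearMap.id ℂ Spinor) (opConvolution N (f n) ξ) := by
      funext ξ
      rw [hfs, map_neg, hRi]; rfl
    rw [← fourier_diracSymbol m l (hfI (n + 1)) x, e,
      fourier_clm_apply _ (integrable_opConvolution hN.integrable_self (hfI n).integrable_self),
      fourier_opConvolution hN.integrable_self (hfI n).integrable_self, hNF]
    rfl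
  have a1 : HasSum (fun n => ∑ μ, spinL (alphaMat μ)
      (fderiv ℝ (𝓕 (f n)) x (EuclideanSpace.single μ 1)) + ((l : ℂ) • 𝓕 (f n) x +
        (Complex.I * m) • spinL (gammaMat 0) (𝓕 (f n) x)))
      (∑ μ, spinL (alphaMat μ) (fderiv ℝ φ x (EuclideanSpace.single μ 1)) +
          ((l : ℂ) • φ x + (Complex.I * m) • spinL (gammaMat 0) (φ x))) := by
    refine HasSum.add (hasSum_sum fun μ _ => ?_) (HasSum.add ?_ ?_)
    · exact (spinL (alphaMat μ)).hasSum ((ContinuousLinearMap.apply ℝ Spinor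
        (EuclideanSpace.single μ (1 : ℝ))).hasSum (hs' x))
    · exact (hs x).const_smul _
    · exact ((spinL (gammaMat 0)).hasSum (hs x)).const_smul _
  have a2 := ((N₀ x).hasSum (hs x)).neg
  simp only [← hDs] at a2
  have a3 := (hasSum_nat_add_iff (f := fun n => ∑ μ, spinL (alphaMat μ)
      (fderiv ℝ (𝓕 (f n)) x (EuclideanSpace.single μ 1)) + ((l : ℂ) • 𝓕 (f n) x +
        (Complex.I * m) • spinL (gammaMat 0) (𝓕 (f n) x))) 1).1 a2
  rw [Finset.sum_range_one, ← hD0] at a3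
  rw [a1.unique a3]; abel

/-- The inhomogeneous Dirac equation with a compactly supported potential and source has a smooth
solution which decays exponentially towards the past. -/
theorem exists_decaying_solution (m : ℝ) {A : Spacetime → Fin 4 → ℝ} (hA : ContDiff ℝ ∞ A)
    (hA' : HasCompactSupport A) {G : Spacetime → Spinor} (hG : ContDiff ℝ ∞ G)
    (hG' : HasCompactSupport G) : ∃ u : Spacetime → Spinor, ContDiff ℝ ∞ u ∧
      (∀ z, diracOp m A u z = G z) ∧ ∃ C l : ℝ, 0 < l ∧ ∀ z, ‖u z‖ ≤ C * Real.exp (l * z 0) := by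
  let P : EuclideanSpacetime ≃L[ℝ] Spacetime := EuclideanSpace.equiv (Fin 4) ℝ
  have hT : ∀ μ, ContDiff ℝ ∞ fun x : EuclideanSpacetime => ((A (P x) μ : ℝ) : ℂ) := fun μ =>
    Complex.ofRealCLM.contDiff.comp ((contDiff_pi.1 hA μ).comp P.contDiff)
  have hPc : ∀ {α : Type} [Zero α] {f : Spacetime → α}, HasCompactSupport f →
      HasCompactSupport fun x => f (P x) := fun hf =>
    hf.comp_homeomorph P.toHomeomorph
  have hP0 : ContDiff ℝ ∞ fun x : EuclideanSpacetime => P x 0 :=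
    (contDiff_pi.1 P.contDiff 0)
  obtain ⟨T, hTa⟩ : ∃ T : Fin 4 → Spinor →L[ℂ] Spinor,
      ∀ μ v, T μ v = Complex.I • spinL (alphaMat μ) v :=
    ⟨fun μ => Complex.I • spinL (alphaMat μ), fun _ _ => rfl⟩
  let N₀ : EuclideanSpacetime → Spinor →L[ℂ] Spinor := fun x => ∑ μ, ((A (P x) μ : ℝ) : ℂ) • T μ
  have hN₀ : ContDiff ℝ ∞ N₀ := ContDiff.sum fun μ _ => (hT μ).smul contDiff_const
  have hN₀' : HasCompactSupport N₀ := by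
    refine (hPc hA').mono fun x hx => ?_
    rw [Function.mem_support] at hx ⊢
    intro h
    refine hx (Finset.sum_eq_zero fun μ _ => ?_)
    ext1 v
    rw [_root_.smul_apply, h, Pi.zero_apply, Complex.ofReal_zero, zero_smul]; rfl
  obtain ⟨l, hl, hsol⟩ := exists_bounded_solution m hN₀ hN₀'
  have hG₁ : ContDiff ℝ ∞ fun x : EuclideanSpacetime => G (P x) := hG.comp P.contDiff
  have hG₁' : HasCompactSupport fun x : EuclideanSpacetime => G (P x) := hPc hG'
  have hE : ContDiff ℝ ∞ fun x : EuclideanSpacetime => Real.exp (-l * P x 0) :=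
    (contDiff_const.mul hP0).exp
  have hg₀ : ContDiff ℝ ∞ fun x : EuclideanSpacetime => Real.exp (-l * P x 0) • G (P x) :=
    hE.smul hG₁
  have hg₀' : HasCompactSupport fun x : EuclideanSpacetime => Real.exp (-l * P x 0) • G (P x) :=
    HasCompactSupport.smul_left (f := fun x : EuclideanSpacetime => Real.exp (-l * P x 0)) hG₁'
  obtain ⟨φ, hφ, ⟨C, hC⟩, heq⟩ := hsol _ hg₀ hg₀'
  -- Conjugation by `exp (l x⁰)` adds `l` to the Dirac operator, because `α⁰ = 1`.
  refine ⟨fun z => Real.exp (l * z 0) • φ (P.symm z), ?_, fun z => ?_, C, l, hl, fun z => ?_⟩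
  · exact ((contDiff_const.mul (contDiff_apply ℝ ℝ (0 : Fin 4))).exp).smul (hφ.comp P.symm.contDiff)
  · have hpd : ∀ μ, pd μ (fun z : Spacetime => Real.exp (l * z 0) • φ (P.symm z)) z =
        (Real.exp (l * z 0) : ℂ) • (fderiv ℝ φ (P.symm z) (EuclideanSpace.single μ 1) +
          ((l : ℂ) * (((Pi.single μ 1 : Spacetime) 0 : ℝ) : ℂ)) • φ (P.symm z)) := fun μ => by
      have h1 : HasFDerivAt (fun z : Spacetime => z 0)
        (ContinuousLinearMap.proj (R := ℝ) (φ := fun _ : Fin 4 => ℝ) 0) z :=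
        (ContinuousLinearMap.proj (R := ℝ) (φ := fun _ : Fin 4 => ℝ) 0).hasFDerivAt
      have h2 := (h1.const_mul l).exp
      have h3 : HasFDerivAt φ _ (P.symm z) := (hφ.differentiable (by simp) (P.symm z)).hasFDerivAt
      have h4 : HasFDerivAt (fun z => φ (P.symm z)) _ z := h3.comp z P.symm.hasFDerivAt
      have h5 : HasFDerivAt (fun z : Spacetime => Real.exp (l * z 0) • φ (P.symm z)) _ z :=
        h2.smul h4
      have h6 : P.symm (Pi.single μ 1) = EuclideanSpace.single μ 1 := rfl
      rw [pd, h5.fderiv]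
      simp only [_root_.add_apply, _root_.smul_apply, ContinuousLinearMap.smulRight_apply,
        ContinuousLinearMap.comp_apply, ContinuousLinearMap.proj_apply, smul_eq_mul,
        ContinuousLinearEquiv.coe_coe, h6]
      rw [smul_add, smul_smul, ← Complex.ofReal_mul, ← Complex.ofReal_mul, Complex.coe_smul,
        Complex.coe_smul]
    have h6 := heq (P.symm z)
    simp only [P.apply_symm_apply] at h6
    have hN : N₀ (P.symm z) (φ (P.symm z)) =
        Complex.I • spinL (∑ μ, ((A z μ : ℝ) : ℂ) • alphaMat μ) (φ (P.symm z)) := by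
      have h1 : N₀ (P.symm z) (φ (P.symm z)) =
          ∑ μ, ((A (P (P.symm z)) μ : ℝ) : ℂ) • T μ (φ (P.symm z)) := by
        simp only [N₀, _root_.sum_apply, _root_.smul_apply]
      rw [h1, P.apply_symm_apply, Fin.sum_univ_four, Fin.sum_univ_four]
      simp only [hTa, spinL_add, spinL_smul, smul_add]
      simp only [smul_comm Complex.I]
    have h7 : Real.exp (l * z 0) * Real.exp (-l * z 0) = 1 := by
      rw [← Real.exp_add]; simp
    have h8 : G z = (Real.exp (l * z 0) : ℂ) • (Real.exp (-l * z 0) • G z) := by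
      rw [Complex.coe_smul, smul_smul, h7, one_smul]
    have h9 : ∑ μ, spinL (alphaMat μ)
        (((l : ℂ) * (((Pi.single μ 1 : Spacetime) 0 : ℝ) : ℂ)) • φ (P.symm z)) =
        (l : ℂ) • φ (P.symm z) := by
      rw [Finset.sum_eq_single 0]
      · rw [alphaMat_zero, spinL_one]; simp
      · intro μ _ hμ
        rw [Pi.single_eq_of_ne (Ne.symm hμ)]; simp
      · simp
    rw [h8, ← sub_add_cancel (Real.exp (-l * z 0) • G z) (N₀ (P.symm z) (φ (P.symm z))), ← h6, hN,
      ← h9]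
    simp only [diracOp, hpd, map_smul, map_add, Finset.sum_add_distrib, potentialMat, spinL_add,
      spinL_smul, ← Finset.smul_sum, ← Complex.coe_smul (Real.exp (l * z 0))]
    module
  · rw [norm_smul, Real.norm_of_nonneg (Real.exp_pos _).le, mul_comm]
    exact mul_le_mul_of_nonneg_right (hC _) (Real.exp_pos _).le

end Inhomogeneous

/-! ### Retarded and advanced solutions -/

section Fundamental

open Filter Topology

/-- `u` vanishes in the open backward light cone of the event `(T, x₁)`. -/
def PastVanishing (u : Spacetime → Spinor) (T : ℝ) (x₁ : Space) : Prop :=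
  ∀ t x, ‖x - x₁‖ < T - t → u (eventAt t x) = 0

/-- `u` vanishes in the open forward light cone of the event `(T, x₁)`. -/
def FutureVanishing (u : Spacetime → Spinor) (T : ℝ) (x₁ : Space) : Prop :=
  ∀ t x, ‖x - x₁‖ < t - T → u (eventAt t x) = 0

theorem FutureVanishing.reflect {u : Spacetime → Spinor} {T : ℝ} {x₁ : Space}
    (h : FutureVanishing u T x₁) : PastVanishing (reflect u) (-T) (-x₁) := fun t x hx => by
  refine reflect_eq_zero ?_
  rw [neg_eventAt]
  refine h _ _ ?_
  rw [← norm_neg, neg_sub, sub_neg_eq_add, add_comm, ← sub_neg_eq_add]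
  linarith

theorem PastVanishing.reflect {u : Spacetime → Spinor} {T : ℝ} {x₁ : Space}
    (h : PastVanishing u (-T) (-x₁)) : FutureVanishing (reflect u) T x₁ := fun t x hx => by
  refine reflect_eq_zero ?_
  rw [neg_eventAt]
  refine h _ _ ?_
  rw [← norm_neg, neg_sub, sub_neg_eq_add, add_comm, ← sub_eq_add_neg]
  linarith

theorem PastVanishing.eq_zero_of_continuous {u : Spacetime → Spinor} {T : ℝ} {x₁ : Space}
    (h : PastVanishing u T x₁) (hu : Continuous u) : u (eventAt T x₁) = 0 := by
  have hc : Continuous fun t => u (eventAt t x₁) :=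
    hu.comp (continuous_id.eventAt continuous_const)
  have hz : Set.EqOn (fun t => u (eventAt t x₁)) (fun _ => 0) (Set.Iio T) := fun t ht =>
    h t x₁ (by rw [sub_self, norm_zero]; exact sub_pos.2 ht)
  exact hz.closure hc continuous_const (by rw [closure_Iio]; exact Set.mem_Iic.2 le_rfl)

theorem exists_bound_of_hasCompactSupport {G : Spacetime → Spinor} (hG : HasCompactSupport G) :
    ∃ R : ℝ, ∀ t x, G (eventAt t x) ≠ 0 → |t| ≤ R ∧ ‖x‖ ≤ R := by
  obtain ⟨R, hR⟩ := (hG.isCompact.image eventEquiv.symm.continuous).isBounded.exists_norm_le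
  refine ⟨R, fun t x h => ?_⟩
  have h1 := hR (t, x) ⟨eventAt t x, subset_tsupport _ h, eventEquiv.symm_apply_apply (t, x)⟩
  exact ⟨(norm_fst_le (t, x)).trans h1, (norm_snd_le (t, x)).trans h1⟩

/-- The decaying solution is retarded: it vanishes in every backward cone without sources, by the
energy inequality. -/
theorem exists_retarded_solution (m : ℝ) {A : Spacetime → Fin 4 → ℝ} (hA : ContDiff ℝ ∞ A)
    (hA' : HasCompactSupport A) {G : Spacetime → Spinor} (hG : ContDiff ℝ ∞ G)
    (hG' : HasCompactSupport G) : ∃ u : Spacetime → Spinor, ContDiff ℝ ∞ u ∧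
      (∀ z, diracOp m A u z = G z) ∧ (∃ R, SpatiallyBounded R u) ∧
      ∀ T x₁, PastVanishing G T x₁ → PastVanishing u T x₁ := by
  obtain ⟨u, hu, heq, C, l, hl, hdec⟩ := exists_decaying_solution m hA hA' hG hG'
  have hu1 : ContDiff ℝ 1 u := hu.of_le (by simp)
  have key : ∀ T x₁, PastVanishing G T x₁ → PastVanishing u T x₁ := fun T x₁ h t x hx =>
    eq_zero_of_decay hu1 hl hdec (fun s y hy => (heq _).trans (h s y hy)) hx
  obtain ⟨R, hR⟩ := exists_bound_of_hasCompactSupport hG'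
  refine ⟨u, hu, heq, ⟨2 * R, fun t x hx => ?_⟩, key⟩
  refine key (‖x‖ - 2 * R) x (fun s y hy => ?_) t x ?_
  · by_contra hne
    obtain ⟨h1, h2⟩ := hR s y hne
    have h3 := norm_sub_norm_le x y
    rw [norm_sub_rev] at h3
    have := (abs_le.1 h1).1
    linarith
  · rw [sub_self, norm_zero]
    have := le_abs_self t
    linarith

theorem hasCompactSupport_reflect {G : Spacetime → Spinor} (hG : HasCompactSupport G) :
    HasCompactSupport (reflect G) := by
  have h : HasCompactSupport fun z => G (-z) := hG.comp_homeomorph (Homeomorph.neg Spacetime)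
  exact h.comp_left (map_zero (spinL gammaFive))

/-- Advanced solutions are space-time reflections of retarded ones. -/
theorem exists_advanced_solution (m : ℝ) {A : Spacetime → Fin 4 → ℝ} (hA : ContDiff ℝ ∞ A)
    (hA' : HasCompactSupport A) {G : Spacetime → Spinor} (hG : ContDiff ℝ ∞ G)
    (hG' : HasCompactSupport G) : ∃ u : Spacetime → Spinor, ContDiff ℝ ∞ u ∧
      (∀ z, diracOp m A u z = G z) ∧ (∃ R, SpatiallyBounded R u) ∧
      ∀ T x₁, FutureVanishing G T x₁ → FutureVanishing u T x₁ := by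
  have hB : ContDiff ℝ ∞ (reflectPotential A) := (hA.comp contDiff_neg).neg
  have hB' : HasCompactSupport (reflectPotential A) := by
    have h : HasCompactSupport fun z => A (-z) := hA'.comp_homeomorph (Homeomorph.neg Spacetime)
    exact h.comp_left (g := fun a : Fin 4 → ℝ => -a) neg_zero
  have hrn : ContDiff ℝ ∞ (-reflect G) := (contDiff_reflect hG).neg
  have hrn' : HasCompactSupport (-reflect G) :=
    (hasCompactSupport_reflect hG').comp_left (g := fun a : Spinor => -a) neg_zero
  obtain ⟨v, hv, heq, ⟨R, hR⟩, hpast⟩ := exists_retarded_solution m hB hB' hrn hrn'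
  refine ⟨reflect v, contDiff_reflect hv, fun z => ?_, ⟨R, hR.reflect⟩, fun T x₁ h => ?_⟩
  · have h1 := diracOp_reflect (hv.of_le (by simp)) m (reflectPotential A) z
    rw [reflectPotential_reflectPotential] at h1
    have h2 : diracOp m (reflectPotential A) v = -reflect G := funext heq
    rw [h1, h2]
    have h3 : reflect (-reflect G) z = -reflect (reflect G) z := map_neg (spinL gammaFive) _
    rw [h3, neg_neg, reflect_reflect]
  · refine (hpast _ _ fun t x hx => ?_).reflect
    rw [Pi.neg_apply, h.reflect t x hx, neg_zero]

end Fundamental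

/-! ### Approximating Cauchy data by solutions -/

section ThinLayer

open Filter Topology

variable (S : CauchySurface)

/-- The gradient of the height function of a Cauchy surface. -/
def CauchySurface.gradient (x : Space) : Space := WithLp.toLp 2 (S.slope x)

theorem CauchySurface.norm_gradient_lt_one (x : Space) : ‖S.gradient x‖ < 1 := by
  have h := S.slope_sq_lt_one x
  have h2 : ‖S.gradient x‖ ^ 2 < 1 := by
    rw [EuclideanSpace.norm_sq_eq, Fin.sum_univ_three]
    simpa [gradient] using h
  nlinarith [norm_nonneg (S.gradient x)]

theorem CauchySurface.continuous_slope : Continuous S.slope :=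
  continuous_pi fun i => continuous_sd S.contDiff_height i

theorem CauchySurface.continuous_gradient : Continuous S.gradient :=
  (PiLp.continuous_toLp 2 _).comp S.continuous_slope

/-- The charge density of a space-like surface is positive definite, with a constant depending on
how far the surface is from being null. -/
theorem le_surfaceDensity (u : Spacetime → Spinor) (z : Spacetime) (x : Space) :
    (1 - ‖S.gradient x‖) * ‖u z‖ ^ 2 ≤
      current u 0 z - ∑ i : Fin 3, sd i S.height x * current u i.succ z := by
  have h := (le_abs_self _).trans (abs_sum_current_le u z (S.gradient x))
  have e : ∑ i : Fin 3, (S.gradient x) i * current u i.succ z =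
      ∑ i : Fin 3, sd i S.height x * current u i.succ z := rfl
  rw [current_zero]
  linarith

theorem continuous_divergence {J : Fin 4 → Spacetime → ℝ} (hJ : ∀ μ, ContDiff ℝ 1 (J μ)) :
    Continuous (divergence J) :=
  continuous_finsetSum _ fun μ _ => continuous_pd (hJ μ) μ

/-- Energy estimate: a spatially compact field which vanishes above the surface `Σ + ε` and solves
the Dirac equation with a source bounded by `M` over a compact set has small norm on `Σ`. -/
theorem flux_current_le_of_thin_source {w : Spacetime → Spinor} (hw : ContDiff ℝ 1 w) {m : ℝ}
    {A : Spacetime → Fin 4 → ℝ} {R M c ε : ℝ} (hR : SpatiallyBounded R w) {K : Set Space}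
    (hK : IsCompact K) (hc : 0 < c) (hcK : ∀ x ∈ K, c ≤ 1 - ‖S.gradient x‖)
    (hM : ∀ z, ‖diracOp m A w z‖ ≤ M) (hsupp : ∀ z, position z ∉ K → diracOp m A w z = 0)
    (hε : 0 ≤ ε) (hvan : ∀ x, w (eventAt (S.height x + ε) x) = 0) :
    flux (current w) S.height ≤ M ^ 2 / c * volume.real K * (Real.exp ε - 1) := by
  have hM0 : 0 ≤ M := (norm_nonneg _).trans (hM 0)
  have hJ : ∀ μ, ContDiff ℝ 1 (current w μ) := contDiff_current hw
  set h := S.height with hh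
  set E : ℝ → ℝ := fun s => flux (current w) fun x => h x + s * 1 with hE
  have hbd : ∀ s₀ : ℝ, ∃ K₁ : Set Space, IsCompact K₁ ∧ ∀ s ∈ Metric.ball s₀ 1, ∀ x ∉ K₁,
      w (eventAt (h x + s * 1) x) = 0 := fun s₀ => by
    have hcl : IsClosed {x | ‖x‖ ≤ (R + |s₀| + 1) + |S.height x|} :=
      isClosed_le continuous_norm (continuous_const.add S.continuous_height.abs)
    refine ⟨_, Metric.isCompact_of_isClosed_isBounded hcl (S.isBounded_cone (R + |s₀| + 1)),
      fun s hs x hx => ?_⟩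
    simp only [Set.mem_ofPred_eq, not_le] at hx
    refine hR _ _ (lt_of_le_of_lt ?_ hx)
    rw [Metric.mem_ball, Real.dist_eq] at hs
    have h1 := abs_add_le (h x) (s * 1)
    have h2 := abs_add_le s₀ (s - s₀)
    rw [add_sub_cancel] at h2
    rw [mul_one] at h1 ⊢
    linarith
  have hder : ∀ s, HasDerivAt E (∫ x, 1 * divergence (current w) (eventAt (h x + s * 1) x)) s := by
    intro s
    obtain ⟨K₁, hK₁, hz⟩ := hbd s
    exact hasDerivAt_flux hJ S.contDiff_height contDiff_const hK₁ one_pos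
      fun τ hτ x hx μ => current_eq_zero (hz τ hτ x hx) μ
  set C := M ^ 2 / c * volume.real K with hC
  have hsd : ∀ (s : ℝ) i x, sd i (fun x => h x + s * 1) x = sd i h x := fun s i x => by
    have h1 : HasFDerivAt h (fderiv ℝ h x) x :=
      (S.contDiff_height.differentiable (by simp) x).hasFDerivAt
    have h2 : HasFDerivAt (fun x => h x + s * 1) _ x := h1.add_const _
    rw [sd, h2.fderiv]; rfl
  -- With `E s` the charge on `Σ + s`, the source can decrease it at a rate of at most `E s + C`: in
  -- `2 ‖w‖ M ≤ c ‖w‖² + M² / c` the first term is absorbed by the charge density.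
  have hineq : ∀ s, 0 ≤ E s + C +
      ∫ x, 1 * divergence (current w) (eventAt (h x + s * 1) x) := by
    intro s
    obtain ⟨K₁, hK₁, hz⟩ := hbd s
    have hz' := hz s (Metric.mem_ball_self one_pos)
    have hev : Continuous fun x => eventAt (h x + s * 1) x :=
      (S.continuous_height.add continuous_const).eventAt continuous_id
    have i1 : Integrable fun x => current w 0 (eventAt (h x + s * 1) x) -
        ∑ i : Fin 3, sd i h x * current w i.succ (eventAt (h x + s * 1) x) := by
      refine Continuous.integrable_of_hasCompactSupport ?_
        (HasCompactSupport.intro hK₁ fun x hx => ?_)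
      · exact ((hJ 0).continuous.comp hev).sub (continuous_finsetSum _ fun i _ =>
          (continuous_sd S.contDiff_height i).mul ((hJ _).continuous.comp hev))
      · simp only [current_eq_zero (hz' x hx), mul_zero, Finset.sum_const_zero, sub_zero]
    have i2 : Integrable fun x => 1 * divergence (current w) (eventAt (h x + s * 1) x) := by
      refine Continuous.integrable_of_hasCompactSupport ?_
        (HasCompactSupport.intro hK₁ fun x hx => ?_)
      · exact continuous_const.mul ((continuous_divergence hJ).comp hev)
      · rw [divergence_current hw m A, hz' x hx, inner_zero_left]; simp
    have i3 : Integrable (K.indicator fun _ => M ^ 2 / c : Space → ℝ) :=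
      (integrable_indicator_iff hK.measurableSet).2 (integrableOn_const hK.measure_lt_top.ne)
    have e1 : E s = ∫ x, (current w 0 (eventAt (h x + s * 1) x) -
        ∑ i : Fin 3, sd i h x * current w i.succ (eventAt (h x + s * 1) x)) := by
      simp only [hE, flux, hsd]
    have e2 : C = ∫ x, (K.indicator fun _ => M ^ 2 / c : Space → ℝ) x := by
      rw [integral_indicator hK.measurableSet, setIntegral_const, smul_eq_mul, mul_comm, hC]
    have i13 : Integrable fun x => current w 0 (eventAt (h x + s * 1) x) -
        ∑ i : Fin 3, sd i h x * current w i.succ (eventAt (h x + s * 1) x) +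
        (K.indicator fun _ => M ^ 2 / c : Space → ℝ) x := i1.add i3
    rw [e1, e2, ← integral_add i1 i3, ← integral_add i13 i2]
    refine integral_nonneg fun x => ?_
    simp only [Pi.zero_apply]
    set z := eventAt (h x + s * 1) x
    have h1 := le_surfaceDensity S w z x
    have hpos := S.norm_gradient_lt_one x
    rw [divergence_current hw m A]
    by_cases hx : x ∈ K
    · rw [Set.indicator_of_mem hx]
      have h2 := (Complex.abs_re_le_norm _).trans (norm_inner_le_norm (𝕜 := ℂ) (w z) (diracOp m A w z))
      have h3 := (abs_le.1 h2).1
      have h4 := mul_le_mul_of_nonneg_left (hM z) (norm_nonneg (w z))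
      have h5 := mul_le_mul_of_nonneg_right (hcK x hx) (sq_nonneg ‖w z‖)
      have h6 : 2 * (‖w z‖ * M) ≤ c * ‖w z‖ ^ 2 + M ^ 2 / c := by
        have h7 : c * ‖w z‖ ^ 2 + M ^ 2 / c - 2 * (‖w z‖ * M) = (c * ‖w z‖ - M) ^ 2 / c := by
          field_simp; ring
        have h8 : 0 ≤ (c * ‖w z‖ - M) ^ 2 / c := by positivity
        linarith
      linarith
    · rw [Set.indicator_of_notMem hx, hsupp z (by rwa [position_eventAt]), inner_zero_right]
      have := mul_nonneg (sub_nonneg.2 hpos.le) (sq_nonneg ‖w z‖)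
      simp only [Complex.zero_re]
      linarith
  -- Grönwall's inequality, from `s = ε`, where the charge vanishes, down to `s = 0`.
  have hF : ∀ s, HasDerivAt (fun s => Real.exp s * (E s + C)) (Real.exp s * (E s + C) +
      Real.exp s * ∫ x, 1 * divergence (current w) (eventAt (h x + s * 1) x)) s := fun s =>
    (Real.hasDerivAt_exp s).mul ((hder s).add_const C)
  have hmono : Monotone fun s => Real.exp s * (E s + C) :=
    monotone_of_deriv_nonneg (fun s => (hF s).differentiableAt) fun s => by
      rw [(hF s).deriv, ← mul_add]
      exact mul_nonneg (Real.exp_pos s).le (hineq s)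
  have h0 := hmono hε
  have hEε : E ε = 0 := by
    simp only [hE, flux, mul_one]
    have : ∀ x, ∀ μ, current w μ (eventAt (h x + ε) x) = 0 := fun x μ =>
      current_eq_zero (hvan x) μ
    simp [this]
  have hE0 : E 0 = flux (current w) h := by simp only [hE, zero_mul, add_zero]
  simp only [Real.exp_zero, one_mul, hEε, hE0] at h0
  linarith

/-- Every compactly supported smooth field `g` is approximated by solutions, in the norm of a Cauchy
surface. The source of `g` is split into the part below the surface `Σ + ε`, up to a cut-off, and the
part above `Σ`. Subtracting the advanced solution `w` of the former and the retarded solution `v` of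
the latter from `g` gives a solution. On `Σ` the field `v` vanishes, and `w` is small by the energy
estimate for sources in a thin layer. -/
theorem exists_solution_near (m : ℝ) {A : Spacetime → Fin 4 → ℝ} (hA : ContDiff ℝ ∞ A)
    (hA' : HasCompactSupport A) {g : Spacetime → Spinor} (hg : ContDiff ℝ ∞ g)
    (hg' : HasCompactSupport g) {η : ℝ} (hη : 0 < η) : ∃ ψ : Spacetime → Spinor, ContDiff ℝ ∞ ψ ∧
      (∀ z, diracOp m A ψ z = 0) ∧ (∃ R, SpatiallyBounded R ψ) ∧
      flux (current (g - ψ)) S.height < η := by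
  have hg1 : ContDiff ℝ 1 g := hg.of_le (by simp)
  set G : Spacetime → Spinor := diracOp m A g with hGdef
  have hG : ContDiff ℝ ∞ G := by
    have h1 : ∀ μ, ContDiff ℝ ∞ (pd μ g) := fun μ =>
      (hg.fderiv_right (m := ∞) (by simp)).clm_apply contDiff_const
    have h2 : ∀ μ, ContDiff ℝ ∞ fun z => ((A z μ : ℝ) : ℂ) := fun μ =>
      Complex.ofRealCLM.contDiff.comp (contDiff_pi.1 hA μ)
    have e : G = fun z => ∑ μ, spinL (alphaMat μ) (pd μ g z) + Complex.I • ((m : ℂ) •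
        spinL (gammaMat 0) (g z) + ∑ μ, ((A z μ : ℝ) : ℂ) • spinL (alphaMat μ) (g z)) := by
      funext z
      simp only [hGdef, diracOp, potentialMat, spinL_add, spinL_smul, Fin.sum_univ_four]
    rw [e]
    have h3 : ∀ (M : Matrix (Fin 4) (Fin 4) ℂ) {f : Spacetime → Spinor}, ContDiff ℝ ∞ f →
        ContDiff ℝ ∞ fun z => spinL M (f z) := fun M f hf =>
      ((spinL M).restrictScalars ℝ).contDiff.comp hf
    have h4 : ContDiff ℝ ∞ fun z => (m : ℂ) • spinL (gammaMat 0) (g z) :=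
      (h3 _ hg).const_smul (m : ℂ)
    have h5 : ∀ μ, ContDiff ℝ ∞ fun z => ((A z μ : ℝ) : ℂ) • spinL (alphaMat μ) (g z) := fun μ =>
      (h2 μ).smul (h3 _ hg)
    have h6 : ContDiff ℝ ∞ fun z => (m : ℂ) • spinL (gammaMat 0) (g z) +
        ∑ μ, ((A z μ : ℝ) : ℂ) • spinL (alphaMat μ) (g z) := h4.add (ContDiff.sum fun μ _ => h5 μ)
    have h7 : ContDiff ℝ ∞ fun z => Complex.I • ((m : ℂ) • spinL (gammaMat 0) (g z) +
        ∑ μ, ((A z μ : ℝ) : ℂ) • spinL (alphaMat μ) (g z)) :=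
      h6.const_smul Complex.I
    exact (ContDiff.sum fun μ _ => h3 _ (h1 μ)).add h7
  have hGz : ∀ z, z ∉ tsupport g → G z = 0 := fun z hz => by
    have h1 : g =ᶠ[𝓝 z] fun _ => 0 := notMem_tsupport_iff_eventuallyEq.1 hz
    have h2 : ∀ μ, pd μ g z = 0 := fun μ => by
      rw [pd, h1.fderiv_eq]; simp
    simp [hGdef, diracOp, h2, h1.eq_of_nhds]
  have hGc : HasCompactSupport G := HasCompactSupport.intro hg' hGz
  obtain ⟨M, hM⟩ := hGc.exists_bound_of_continuous hG.continuous
  set K := position '' tsupport g with hKdef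
  have hK : IsCompact K := hg'.isCompact.image continuous_position
  have hKz : ∀ z, position z ∉ K → G z = 0 := fun z hz => hGz z fun h => hz ⟨z, h, rfl⟩
  obtain ⟨c, hc, hcK⟩ : ∃ c : ℝ, 0 < c ∧ ∀ x ∈ K, c ≤ 1 - ‖S.gradient x‖ := by
    rcases K.eq_empty_or_nonempty with h | h
    · exact ⟨1, one_pos, by simp [h]⟩
    · obtain ⟨x, -, hx⟩ := hK.exists_isMinOn h
        (f := fun x => 1 - ‖S.gradient x‖)
        (continuous_const.sub S.continuous_gradient.norm).continuousOn
      exact ⟨_, sub_pos.2 (S.norm_gradient_lt_one x), fun y hy => hx hy⟩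
  -- The thickness `ε` of the layer.
  obtain ⟨ε, hε, hεη⟩ : ∃ ε : ℝ, 0 < ε ∧ M ^ 2 / c * volume.real K * (Real.exp ε - 1) < η := by
    have hcont : Continuous fun ε : ℝ => M ^ 2 / c * volume.real K * (Real.exp ε - 1) := by fun_prop
    have h0 : M ^ 2 / c * volume.real K * (Real.exp 0 - 1) < η := by simpa using hη
    have h1 := (hcont.tendsto 0).eventually (gt_mem_nhds h0)
    obtain ⟨ε, h2, h3⟩ := ((h1.filter_mono nhdsWithin_le_nhds).and
      (self_mem_nhdsWithin (s := Set.Ioi (0 : ℝ)))).exists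
    exact ⟨ε, h3, h2⟩
  have hht : Continuous fun z : Spacetime => S.height (position z) :=
    S.continuous_height.comp continuous_position
  -- The cut-off: `χ = 0` in the past of `Σ`, and `χ = 1` in the future of `Σ + ε / 2`.
  obtain ⟨χ, hχ0, hχ1, hχ⟩ := exists_contMDiffMap_zero_one_of_isClosed
    (modelWithCornersSelf ℝ Spacetime) (n := ⊤)
    (s := {z : Spacetime | z 0 ≤ S.height (position z)})
    (t := {z : Spacetime | S.height (position z) + ε / 2 ≤ z 0})
    (isClosed_le (continuous_apply 0) hht)
    (isClosed_le (hht.add continuous_const) (continuous_apply 0))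
    (Set.disjoint_left.2 fun z h1 h2 => by
      simp only [Set.mem_ofPred_eq] at h1 h2; linarith)
  have hχs : ContDiff ℝ ∞ χ := χ.contMDiff.contDiff
  have hχr : ContDiff ℝ ∞ fun z => 1 - χ z := contDiff_const.sub hχs
  obtain ⟨v, hv, hveq, ⟨R₁, hR₁⟩, hvp⟩ := exists_retarded_solution m hA hA'
    (hχs.smul hG) hGc.smul_left
  obtain ⟨w, hw, hweq, ⟨R₂, hR₂⟩, hwf⟩ := exists_advanced_solution m hA hA'
    (hχr.smul hG) (HasCompactSupport.smul_left (f := fun z => 1 - χ z) hGc)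
  have hv1 : ContDiff ℝ 1 v := hv.of_le (by simp)
  have hw1 : ContDiff ℝ 1 w := hw.of_le (by simp)
  obtain ⟨R₀, hR₀⟩ := exists_bound_of_hasCompactSupport hg'
  have hgR : SpatiallyBounded R₀ g := fun t x hx => by
    by_contra hne
    have := (hR₀ t x hne).2
    have := abs_nonneg t
    linarith
  have hvS : ∀ x, v (eventAt (S.height x) x) = 0 := fun x => by
    refine PastVanishing.eq_zero_of_continuous (hvp _ _ fun t y hy => ?_) hv.continuous
    have h1 := (abs_le.1 (S.abs_height_sub_le x y)).1
    have h2 : χ (eventAt t y) = 0 := hχ0 (by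
      simp only [Set.mem_ofPred_eq, eventAt_zero, position_eventAt]; linarith)
    change χ (eventAt t y) • G _ = 0
    rw [h2, zero_smul]
  have hwS : ∀ x, w (eventAt (S.height x + ε) x) = 0 := fun x => by
    refine hwf (S.height x + ε / 2) x (fun t y hy => ?_) _ _ (by
      rw [sub_self, norm_zero]; linarith)
    have h1 := S.height_sub_le x y
    have h2 : χ (eventAt t y) = 1 := hχ1 (by
      simp only [Set.mem_ofPred_eq, eventAt_zero, position_eventAt]; linarith)
    change (1 - χ (eventAt t y)) • G _ = 0
    rw [h2, sub_self, zero_smul]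
  have hgw : ContDiff ℝ 1 (g - w) := hg1.sub hw1
  refine ⟨g - w - v, (hg.sub hw).sub hv, fun z => ?_, ⟨max R₀ (max R₁ R₂), ?_⟩, ?_⟩
  · rw [diracOp_sub hgw hv1, diracOp_sub hg1 hw1, hweq, hveq]
    change G z - (1 - χ z) • G z - χ z • G z = 0
    module
  · exact ((hgR.mono (le_max_left _ _)).sub
      (hR₂.mono ((le_max_right _ _).trans (le_max_right _ _)))).sub
      (hR₁.mono ((le_max_left _ _).trans (le_max_right _ _)))
  · have e : flux (current (g - (g - w - v))) S.height = flux (current w) S.height := by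
      have h1 : ∀ x μ, current (g - (g - w - v)) μ (eventAt (S.height x) x) =
          current w μ (eventAt (S.height x) x) := fun x μ => by
        simp only [current, Pi.sub_apply, hvS, sub_zero, sub_sub_cancel]
      simp only [flux, h1]
    rw [e]
    refine lt_of_le_of_lt (flux_current_le_of_thin_source S hw1 (m := m) (A := A) hR₂ hK hc hcK
      (fun z => ?_) (fun z hz => ?_) hε.le hwS) hεη
    · rw [hweq]
      change ‖(1 - χ z) • G z‖ ≤ M
      rw [norm_smul, Real.norm_of_nonneg (sub_nonneg.2 (hχ z).2)]
      exact (mul_le_of_le_one_left (norm_nonneg _) (by linarith [(hχ z).1])).trans (hM z)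
    · rw [hweq]
      change (1 - χ z) • G z = 0
      rw [hKz z hz, smul_zero]

end ThinLayer

/-! ### Traces of spinor fields on Cauchy surfaces -/

section Traces

open Filter Topology

variable (S : CauchySurface)

theorem CauchySurface.density_eq_spinL (x : Space) (a b : Spinor) :
    S.density x a b = inner ℂ a (spinL (1 - alphaDot (S.slope x)) b) := by
  rw [density, gamma_mul_volumeContraction, spinL_apply]

/-- The scalar product of `H_Σ` integrates the flux of the Dirac current through the surface. -/
theorem CauchySurface.density_eq_current (u : Spacetime → Spinor) (z : Spacetime) (x : Space) :
    S.density x (u z) (u z) = ((current u 0 z -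
      ∑ i : Fin 3, sd i S.height x * current u i.succ z : ℝ) : ℂ) := by
  have h1 := S.density_self x (u z)
  have h2 : ∑ i : Fin 3, sd i S.height x * current u i.succ z =
      (inner ℂ (u z) (spinL (alphaDot (S.slope x)) (u z)) : ℂ).re := sum_current u z (S.slope x)
  have h3 : (S.density x (u z) (u z)).re = current u 0 z -
      ∑ i : Fin 3, sd i S.height x * current u i.succ z := by
    rw [h2, S.density_eq_spinL, sub_eq_add_neg, spinL_add, spinL_neg, inner_add_right,
      inner_neg_right, current, alphaMat_zero]
    simp [sub_eq_add_neg]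
  rw [← h3, h1, Complex.ofReal_re]

theorem integrable_density {u : Spacetime → Spinor} (hu : ContDiff ℝ 1 u) {K : Set Space}
    (hK : IsCompact K) (hz : ∀ x ∉ K, u (S.chart x) = 0) :
    Integrable fun x => S.density x (u (S.chart x)) (u (S.chart x)) := by
  simp only [S.density_eq_current u]
  have hI : Integrable fun x => current u 0 (S.chart x) -
      ∑ i : Fin 3, sd i S.height x * current u i.succ (S.chart x) := by
    refine Continuous.integrable_of_hasCompactSupport ?_
      (HasCompactSupport.intro hK fun x hx => ?_)
    · exact ((contDiff_current hu 0).continuous.comp S.continuous_chart).sub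
        (continuous_finsetSum _ fun i _ => (continuous_sd S.contDiff_height i).mul
          ((contDiff_current hu _).continuous.comp S.continuous_chart))
    · simp only [current_eq_zero (hz x hx), mul_zero, Finset.sum_const_zero, sub_zero]
  exact hI.ofReal

/-- `φ` is the restriction of the spinor field `u` to the Cauchy surface `Σ`. -/
def IsTrace (u : Spacetime → Spinor) (φ : DiracSpace S) : Prop :=
  φ.field =ᵐ[volume] fun x => u (S.chart x)

variable {S}

theorem exists_isTrace {u : Spacetime → Spinor} (hu : ContDiff ℝ 1 u) {K : Set Space}
    (hK : IsCompact K) (hz : ∀ x ∉ K, u (S.chart x) = 0) : ∃ φ : DiracSpace S, IsTrace S u φ := by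
  have hm : AEStronglyMeasurable (fun x => u (S.chart x)) (volume : Measure Space) :=
    (hu.continuous.comp S.continuous_chart).aestronglyMeasurable
  have hae := AEEqFun.coeFn_mk _ hm
  have hmem : AEEqFun.mk _ hm ∈ S.squareIntegrable := by
    refine (integrable_density S hu hK hz).congr ?_
    filter_upwards [hae] with x hx
    rw [hx]
  exact ⟨(⟨_, hmem⟩ : S.squareIntegrable), hae⟩

/-- The norm of a trace is the total charge on the surface. -/
theorem IsTrace.norm_sq {u : Spacetime → Spinor} {φ : DiracSpace S} (h : IsTrace S u φ) :
    ‖φ‖ ^ 2 = flux (current u) S.height := by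
  have h1 : (inner ℂ φ φ : ℂ) = ((flux (current u) S.height : ℝ) : ℂ) := by
    rw [DiracSpace.inner_def, flux, ← integral_complex_ofReal]
    refine integral_congr_ae ?_
    filter_upwards [h] with x hx
    rw [hx, S.density_eq_current u]
    rfl
  rw [inner_self_eq_norm_sq_to_K] at h1
  apply Complex.ofReal_injective
  rw [← h1]
  push_cast
  rfl

theorem IsTrace.add {u v : Spacetime → Spinor} {φ χ : DiracSpace S} (hu : IsTrace S u φ)
    (hv : IsTrace S v χ) : IsTrace S (u + v) (φ + χ) := by
  filter_upwards [hu, hv, AEEqFun.coeFn_add φ.field χ.field] with x h1 h2 h3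
  rw [DiracSpace.field_add, h3, Pi.add_apply, h1, h2]
  rfl

theorem IsTrace.smul {u : Spacetime → Spinor} {φ : DiracSpace S} (hu : IsTrace S u φ) (c : ℂ) :
    IsTrace S (c • u) (c • φ) := by
  filter_upwards [hu, AEEqFun.coeFn_smul c φ.field] with x h1 h3
  rw [DiracSpace.field_smul, h3, Pi.smul_apply, h1]
  rfl

theorem IsTrace.sub {u v : Spacetime → Spinor} {φ χ : DiracSpace S} (hu : IsTrace S u φ)
    (hv : IsTrace S v χ) : IsTrace S (u - v) (φ - χ) := by
  have h := hu.add (hv.smul (-1))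
  rwa [neg_one_smul, neg_one_smul, ← sub_eq_add_neg, ← sub_eq_add_neg] at h

theorem isTrace_zero : IsTrace S 0 0 := AEEqFun.coeFn_zero

/-- A compactly supported smooth field on a Cauchy surface extends to space-time. -/
theorem exists_extension (S : CauchySurface) {f : Space → Spinor} (hf : ContDiff ℝ ∞ f)
    (hf' : HasCompactSupport f) : ∃ g : Spacetime → Spinor, ContDiff ℝ ∞ g ∧
      HasCompactSupport g ∧ ∀ x, g (S.chart x) = f x := by
  obtain ⟨r, hr⟩ := (hf'.isCompact.image S.continuous_height).isBounded.exists_norm_le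
  let b : ContDiffBump (0 : ℝ) :=
    ⟨|r| + 1, |r| + 2, by positivity, by linarith⟩
  have hp : ContDiff ℝ ∞ position := contDiff_snd.comp eventEquiv.symm.contDiff
  refine ⟨fun z => b (z 0) • f (position z), ?_, ?_, fun x => ?_⟩
  · exact (b.contDiff.comp (contDiff_apply ℝ ℝ (0 : Fin 4))).smul (hf.comp hp)
  · refine HasCompactSupport.intro
      ((b.hasCompactSupport.isCompact.prod hf'.isCompact).image eventEquiv.continuous) fun z hz => ?_
    by_contra hne
    refine hz ⟨(z 0, position z), ⟨subset_tsupport _ ?_, subset_tsupport _ ?_⟩, eventAt_position z⟩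
    · exact fun h => hne (by rw [h, zero_smul])
    · exact fun h => hne (by rw [h, smul_zero])
  · change b (eventAt (S.height x) x 0) • f (position (eventAt (S.height x) x)) = f x
    rw [eventAt_zero, position_eventAt]
    by_cases hx : f x = 0
    · rw [hx, smul_zero]
    · have h1 := hr _ ⟨x, subset_tsupport _ hx, rfl⟩
      rw [b.one_of_mem_closedBall, one_smul]
      rw [mem_closedBall_zero_iff]
      exact (h1.trans (le_abs_self r)).trans (by change |r| ≤ |r| + 1; linarith)

/-- The compactly supported smooth fields on a Cauchy surface. -/
def testFields (S : CauchySurface) : Submodule ℂ (DiracSpace S) where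
  carrier := {φ | ∃ f : Space → Spinor, ContDiff ℝ ∞ f ∧ HasCompactSupport f ∧
    φ.field =ᵐ[volume] f}
  zero_mem' := ⟨0, contDiff_const, HasCompactSupport.zero, AEEqFun.coeFn_zero⟩
  add_mem' := by
    rintro φ χ ⟨f, hf, hf', hφ⟩ ⟨g, hg, hg', hχ⟩
    refine ⟨f + g, hf.add hg, hf'.add hg', ?_⟩
    filter_upwards [hφ, hχ, AEEqFun.coeFn_add φ.field χ.field] with x h1 h2 h3
    rw [DiracSpace.field_add, h3, Pi.add_apply, h1, h2, Pi.add_apply]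
  smul_mem' := by
    rintro c φ ⟨f, hf, hf', hφ⟩
    refine ⟨c • f, hf.const_smul c, hf'.smul_left (f := fun _ => c), ?_⟩
    filter_upwards [hφ, AEEqFun.coeFn_smul c φ.field] with x h1 h3
    rw [DiracSpace.field_smul, h3, Pi.smul_apply, h1, Pi.smul_apply]

theorem norm_spinAct_densityRoot_le (S : CauchySurface) (x : Space) (a : Spinor) :
    ‖spinAct (densityRoot (S.slope x)) a‖ ≤ 2 * ‖a‖ := by
  have h1 : ‖spinAct (densityRoot (S.slope x)) a‖ ^ 2 ≤ (2 * ‖a‖) ^ 2 := by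
    have h2 := S.density_self x a
    rw [S.density_eq_spinL] at h2
    have h3 : ‖spinL (1 - alphaDot (S.slope x)) a‖ ≤ 2 * ‖a‖ := by
      rw [sub_eq_add_neg, spinL_add, spinL_neg, spinL_one, ← sub_eq_add_neg]
      refine (norm_sub_le _ _).trans ?_
      have h4 : ‖spinL (alphaDot (S.slope x)) a‖ = ‖S.gradient x‖ * ‖a‖ :=
        norm_spinL_alphaDot (S.gradient x) a
      have := mul_le_mul_of_nonneg_right (S.norm_gradient_lt_one x).le (norm_nonneg a)
      rw [h4]; linarith
    have h5 := norm_inner_le_norm (𝕜 := ℂ) a (spinL (1 - alphaDot (S.slope x)) a)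
    rw [h2, Complex.norm_real, Real.norm_of_nonneg (sq_nonneg _)] at h5
    nlinarith [mul_le_mul_of_nonneg_left h3 (norm_nonneg a), sq_nonneg ‖a‖]
  exact (pow_le_pow_iff_left₀ (norm_nonneg _) (by positivity) two_ne_zero).1 h1

/-- The fundamental lemma of the calculus of variations, with the density matrix `1 - α · ∇h` of the
scalar product moved to the field. -/
theorem dense_testFields (S : CauchySurface) : Dense (testFields S : Set (DiracSpace S)) := by
  rw [Submodule.dense_iff_topologicalClosure_eq_top, Submodule.topologicalClosure_eq_top_iff,
    Submodule.eq_bot_iff]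
  intro φ hφ
  rw [Submodule.mem_orthogonal] at hφ
  set F : Space → Spinor := fun x => spinL (1 - alphaDot (S.slope x)) (φ.field x) with hF
  have hFroot : ∀ x, F x = spinAct (densityRoot (S.slope x))
      (spinAct (densityRoot (S.slope x)) (φ.field x)) := fun x => by
    rw [← spinAct_mul, densityRoot_mul_self (S.slope_sq_lt_one x)]; rfl
  -- The density matrix is bounded and equals the square of its root.
  have hFL : MemLp F 2 volume := by
    refine MemLp.of_le_mul (c := 2) φ.memLp_root ?_ (Eventually.of_forall fun x => ?_)
    · simp only [funext hFroot]
      exact CauchySurface.aestronglyMeasurable_spinAct S.stronglyMeasurable_root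
        φ.memLp_root.aestronglyMeasurable
    · rw [hFroot]
      exact norm_spinAct_densityRoot_le S x _
  have hz : ∀ e : Spinor, ∀ᵐ x ∂(volume : Measure Space), inner ℂ e (F x) = 0 := fun e => by
    refine ae_eq_zero_of_integral_contDiff_smul_eq_zero
      ((hFL.const_inner e).locallyIntegrable (by norm_num)) fun g hg hg' => ?_
    obtain ⟨G, hG, hG', hGe⟩ := exists_extension S (f := fun x => g x • e)
      (hg.smul contDiff_const) hg'.smul_right
    obtain ⟨χ, hχ⟩ := exists_isTrace (S := S) (u := G) (hG.of_le (by simp))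
      hg'.isCompact fun x hx => by rw [hGe, image_eq_zero_of_notMem_tsupport hx, zero_smul]
    have h1 := hφ χ ⟨fun x => g x • e, hg.smul contDiff_const, hg'.smul_right, by
      simpa only [IsTrace, hGe] using hχ⟩
    rw [DiracSpace.inner_def] at h1
    rw [← h1]
    refine integral_congr_ae ?_
    filter_upwards [hχ] with x hx
    rw [hx, hGe, S.density_eq_spinL, ← Complex.coe_smul, ← Complex.coe_smul, inner_smul_left]
    simp [hF]
  have hz' : ∀ᵐ x ∂(volume : Measure Space), F x = 0 := by
    have := ae_all_iff.2 fun i : Fin 4 => hz (EuclideanSpace.single i 1)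
    filter_upwards [this] with x hx
    ext i
    simpa [EuclideanSpace.inner_single_left] using hx i
  have h0 : inner ℂ φ φ = 0 := by
    rw [DiracSpace.inner_def, integral_eq_zero_of_ae]
    filter_upwards [hz'] with x hx
    rw [S.density_eq_spinL]
    change inner ℂ _ (F x) = 0
    rw [hx, inner_zero_right]
  exact inner_self_eq_zero.1 h0

end Traces

/-! ### The one-particle evolution -/

section Evolution

open Filter Topology

variable {m e : ℝ} {A : Spacetime → Fin 4 → ℝ}

/-- Spatial compactness of a solution may be tested on `{x⁰ = 0}`, by finite propagation speed. -/
theorem isDiracSolution_iff {ψ : Spacetime → Spinor} : IsDiracSolution m e A ψ ↔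
    ContDiff ℝ ∞ ψ ∧ (∀ z, diracOp m (e • A) ψ z = 0) ∧ ∃ R, SpatiallyBounded R ψ := by
  constructor
  · intro h
    have h0 : ∀ z, diracOp m (e • A) ψ z = 0 := fun z => (dirac_equation_iff m e A ψ z).1 (h.dirac z)
    obtain ⟨R, hR⟩ := ((h.compact flatSurface).image continuous_position).isBounded.exists_norm_le
    refine ⟨h.smooth, h0, R, spatiallyBounded_of_data (h.smooth.of_le (by simp)) h0 fun x hx => ?_⟩
    by_contra hne
    refine hx.not_ge (hR x ⟨eventAt 0 x, ⟨subset_tsupport _ hne, ?_⟩, position_eventAt 0 x⟩)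
    rw [CauchySurface.mem_iff, CauchySurface.height_flatSurface]
  · rintro ⟨h1, h2, R, h3⟩
    exact ⟨h1, fun z => (dirac_equation_iff m e A ψ z).2 (h2 z), h3.isCompact⟩

theorem IsDiracSolution.add {ψ χ : Spacetime → Spinor} (hψ : IsDiracSolution m e A ψ)
    (hχ : IsDiracSolution m e A χ) : IsDiracSolution m e A (ψ + χ) := by
  obtain ⟨h1, h2, R, h3⟩ := isDiracSolution_iff.1 hψ
  obtain ⟨k1, k2, R', k3⟩ := isDiracSolution_iff.1 hχ
  refine isDiracSolution_iff.2 ⟨h1.add k1, fun z => ?_, max R R', fun t x hx => ?_⟩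
  · rw [diracOp_add (h1.of_le (by simp)) (k1.of_le (by simp)), h2, k2, add_zero]
  · rw [Pi.add_apply, h3.mono (le_max_left _ _) t x hx, k3.mono (le_max_right _ _) t x hx, add_zero]

theorem IsDiracSolution.smul {ψ : Spacetime → Spinor} (hψ : IsDiracSolution m e A ψ) (c : ℂ) :
    IsDiracSolution m e A (c • ψ) := by
  obtain ⟨h1, h2, R, h3⟩ := isDiracSolution_iff.1 hψ
  refine isDiracSolution_iff.2 ⟨h1.const_smul c, fun z => ?_, R, fun t x hx => ?_⟩
  · rw [diracOp_smul (h1.of_le (by simp)), h2, smul_zero]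
  · rw [Pi.smul_apply, h3 t x hx, smul_zero]

theorem isDiracSolution_zero : IsDiracSolution m e A 0 := by
  have h : ContDiff ℝ 1 (0 : Spacetime → Spinor) := contDiff_const
  refine isDiracSolution_iff.2 ⟨contDiff_const, fun z => ?_, 0, fun _ _ _ => rfl⟩
  have := diracOp_smul (m := m) (A := e • A) h 0 z
  rwa [zero_smul, zero_smul] at this

/-- Every solution has a trace on every Cauchy surface. -/
theorem IsDiracSolution.exists_isTrace {ψ : Spacetime → Spinor} (hψ : IsDiracSolution m e A ψ)
    (S : CauchySurface) : ∃ φ : DiracSpace S, IsTrace S ψ φ := by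
  refine _root_.exists_isTrace (hψ.smooth.of_le (by simp))
    ((hψ.compact S).image continuous_position) fun x hx => ?_
  by_contra hne
  exact hx ⟨S.chart x, ⟨subset_tsupport _ hne, S.chart_mem x⟩, position_eventAt _ x⟩

/-- Charge conservation. -/
theorem IsDiracSolution.norm_eq {ψ : Spacetime → Spinor} (hψ : IsDiracSolution m e A ψ)
    {S S' : CauchySurface} {φ : DiracSpace S} {φ' : DiracSpace S'} (h : IsTrace S ψ φ)
    (h' : IsTrace S' ψ φ') : ‖φ‖ = ‖φ'‖ := by
  obtain ⟨h1, h2, R, h3⟩ := isDiracSolution_iff.1 hψ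
  have hψ1 : ContDiff ℝ 1 ψ := h1.of_le (by simp)
  have key : ∀ S : CauchySurface, flux (current ψ) S.height = flux (current ψ) fun _ => 0 :=
    flux_height_eq (contDiff_current hψ1)
      (fun z => by rw [divergence_current hψ1 m (e • A), h2, inner_zero_right]; simp)
      fun μ t x hx => current_eq_zero (h3 t x hx) μ
  have := h.norm_sq.trans ((key S).trans ((key S').symm.trans h'.norm_sq.symm))
  exact (pow_left_inj₀ (norm_nonneg _) (norm_nonneg _) two_ne_zero).1 this

variable (m e A) in
/-- The pairs of traces of solutions form a subspace. -/
def traceRelation (S S' : CauchySurface) : Submodule ℂ (DiracSpace S × DiracSpace S') where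
  carrier := solutionPairs m e A S S'
  zero_mem' := ⟨0, isDiracSolution_zero, isTrace_zero, isTrace_zero⟩
  add_mem' := by
    rintro p q ⟨ψ, hψ, h1, h2⟩ ⟨χ, hχ, k1, k2⟩
    exact ⟨ψ + χ, hψ.add hχ, IsTrace.add h1 k1, IsTrace.add h2 k2⟩
  smul_mem' := by
    rintro c p ⟨ψ, hψ, h1, h2⟩
    exact ⟨c • ψ, hψ.smul c, IsTrace.smul h1 c, IsTrace.smul h2 c⟩

section Density

variable (hA : ContDiff ℝ ∞ A) (hA' : HasCompactSupport A)
include hA hA'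

/-- The traces of solutions are dense in `H_Σ`. -/
theorem dense_traces (m e : ℝ) (S : CauchySurface) :
    Dense {φ : DiracSpace S | ∃ ψ, IsDiracSolution m e A ψ ∧ IsTrace S ψ φ} := by
  refine Dense.of_closure ((dense_testFields S).mono ?_)
  rintro φ ⟨f, hf, hf', hφ⟩
  obtain ⟨g, hg, hg', hgf⟩ := exists_extension S hf hf'
  have hφg : IsTrace S g φ := by simpa only [IsTrace, hgf] using hφ
  rw [Metric.mem_closure_iff]
  intro δ hδ
  have heA : ContDiff ℝ ∞ (e • A) := hA.const_smul e
  have heA' : HasCompactSupport (e • A) := hA'.smul_left (f := fun _ => e)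
  obtain ⟨ψ, hψ, heq, hR, hlt⟩ := exists_solution_near S m heA heA' hg hg' (pow_pos hδ 2)
  have hsol : IsDiracSolution m e A ψ := isDiracSolution_iff.2 ⟨hψ, heq, hR⟩
  obtain ⟨χ, hχ⟩ := hsol.exists_isTrace S
  refine ⟨χ, ⟨ψ, hsol, hχ⟩, ?_⟩
  rw [dist_eq_norm]
  rw [← (hφg.sub hχ).norm_sq] at hlt
  exact lt_of_pow_lt_pow_left₀ 2 hδ.le hlt

/-- The relation between the traces on two surfaces is isometric, by charge conservation, and has
dense domain and range. -/
theorem exists_isDiracEvolution (m e : ℝ) (S S' : CauchySurface) :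
    ∃ U, IsDiracEvolution m e A S S' U := by
  refine exists_unitary_of_isometric_relation (traceRelation m e A S S') ?_ ?_ ?_
  · rintro p ⟨ψ, hψ, h1, h2⟩
    exact hψ.norm_eq h1 h2
  · refine (dense_traces hA hA' m e S).mono ?_
    rintro φ ⟨ψ, hψ, hφ⟩
    obtain ⟨φ', hφ'⟩ := hψ.exists_isTrace S'
    exact ⟨(φ, φ'), ⟨ψ, hψ, hφ, hφ'⟩, rfl⟩
  · refine (dense_traces hA hA' m e S').mono ?_
    rintro φ' ⟨ψ, hψ, hφ'⟩
    obtain ⟨φ, hφ⟩ := hψ.exists_isTrace S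
    exact ⟨(φ, φ'), ⟨ψ, hψ, hφ, hφ'⟩, rfl⟩

/-- The Dirac evolution is unitary and maps traces of solutions to traces of solutions. -/
theorem exists_diracEvolution_eq (m e : ℝ) (S S' : CauchySurface) :
    ∃ U : DiracSpace S ≃ₗᵢ[ℂ] DiracSpace S',
      diracEvolution m e A S S' = (U : DiracSpace S →L[ℂ] DiracSpace S') ∧
      ∀ ψ φ φ', IsDiracSolution m e A ψ → IsTrace S ψ φ → IsTrace S' ψ φ' → U φ = φ' := by
  have h := exists_isDiracEvolution hA hA' m e S S'
  refine ⟨h.choose, ?_, fun ψ φ φ' hψ hφ hφ' => ?_⟩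
  · rw [diracEvolution, dif_pos h]
  · have h1 : (φ, φ') ∈ closure (solutionPairs m e A S S') := subset_closure ⟨ψ, hψ, hφ, hφ'⟩
    rw [h.choose_spec] at h1
    exact h1.symm

/-- The evolution composes, as it does for traces of solutions. -/
theorem diracEvolution_comp (m e : ℝ) (S₁ S₂ S₃ : CauchySurface) (φ : DiracSpace S₁) :
    diracEvolution m e A S₂ S₃ (diracEvolution m e A S₁ S₂ φ) = diracEvolution m e A S₁ S₃ φ := by
  obtain ⟨U, hU, hUt⟩ := exists_diracEvolution_eq hA hA' m e S₁ S₂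
  obtain ⟨V, hV, hVt⟩ := exists_diracEvolution_eq hA hA' m e S₂ S₃
  obtain ⟨W, hW, hWt⟩ := exists_diracEvolution_eq hA hA' m e S₁ S₃
  rw [hU, hV, hW]
  have : (fun φ => V (U φ)) = fun φ => W φ := by
    refine Continuous.ext_on (dense_traces hA hA' m e S₁) (V.continuous.comp U.continuous)
      W.continuous ?_
    rintro φ ⟨ψ, hψ, hφ⟩
    obtain ⟨φ₂, h2⟩ := hψ.exists_isTrace S₂
    obtain ⟨φ₃, h3⟩ := hψ.exists_isTrace S₃
    simp only
    rw [hUt ψ φ φ₂ hψ hφ h2, hVt ψ φ₂ φ₃ hψ h2 h3, hWt ψ φ φ₃ hψ hφ h3]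
  exact congrFun this φ

end Density

end Evolution

/-! ### Polarization classes -/

section Classes

variable {H H' : Type*} [NormedAddCommGroup H] [InnerProductSpace ℂ H] [CompleteSpace H]
  [NormedAddCommGroup H'] [InnerProductSpace ℂ H'] [CompleteSpace H']

theorem IsHilbertSchmidt.comp_unitary {T : H' →L[ℂ] H'} (hT : IsHilbertSchmidt T)
    (U : H ≃ₗᵢ[ℂ] H') : IsHilbertSchmidt (T.comp (U : H →L[ℂ] H')) := .of_summable fun _ b =>
  hT.summable (b.orthonormal.comp_linearIsometryEquiv U)

theorem IsHilbertSchmidt.unitary_comp {T : H →L[ℂ] H} (hT : IsHilbertSchmidt T)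
    (U : H ≃ₗᵢ[ℂ] H') : IsHilbertSchmidt ((U : H →L[ℂ] H').comp T) := .of_summable fun _ b =>
  (hT.summable b.orthonormal).congr fun i => by
    rw [ContinuousLinearMap.comp_apply]
    exact congrArg (· ^ 2) (U.norm_map _).symm

/-- If `V` is Hilbert-Schmidt close to `X`, and `W` to `U X`, then `W` is Hilbert-Schmidt close to
`U V`. -/
theorem isHilbertSchmidt_off_diagonal (U : H ≃ₗᵢ[ℂ] H') (V X : Submodule ℂ H)
    (W X' : Submodule ℂ H') [V.HasOrthogonalProjection] [X.HasOrthogonalProjection]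
    [W.HasOrthogonalProjection] [X'.HasOrthogonalProjection]
    (hX : X' = X.map (U.toLinearEquiv : H →ₗ[ℂ] H'))
    (hV : IsHilbertSchmidt (V.starProjection - X.starProjection))
    (hW : IsHilbertSchmidt (W.starProjection - X'.starProjection)) :
    IsHilbertSchmidt (W.starProjection.comp (U : H →L[ℂ] H') -
      (U : H →L[ℂ] H').comp V.starProjection) := by
  subst hX
  have h := (hW.comp_unitary U).sub (hV.unitary_comp U)
  convert h using 1
  ext x
  have h1 := Submodule.starProjection_map_apply U X (U x)
  rw [U.symm_apply_apply] at h1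
  simp only [_root_.sub_apply, ContinuousLinearMap.comp_apply, map_sub]
  change _ = _ - Submodule.starProjection _ (U x) - _
  rw [h1]
  change _ = _ - U (X.starProjection x) - (_ - U (X.starProjection x))
  abel

/-- Transport of a subspace to `H` and `H'` commutes with a unitary `U` that intertwines the
transport maps. -/
theorem topologicalClosure_map_eq {E : Type*} [NormedAddCommGroup E] [InnerProductSpace ℂ E]
    (K : Submodule ℂ E) {T : E →L[ℂ] H} {T' : E →L[ℂ] H'} (U : H ≃ₗᵢ[ℂ] H')
    (h : ∀ x, U (T x) = T' x) :
    (K.map (T' : E →ₗ[ℂ] H')).topologicalClosure =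
      (K.map (T : E →ₗ[ℂ] H)).topologicalClosure.map (U.toLinearEquiv : H →ₗ[ℂ] H') := by
  refine SetLike.coe_injective ?_
  have e1 : ((K.map (T : E →ₗ[ℂ] H)).topologicalClosure.map (U.toLinearEquiv : H →ₗ[ℂ] H') : Set H') =
      U.toHomeomorph '' closure (T '' K) := rfl
  have e2 : ((K.map (T' : E →ₗ[ℂ] H')).topologicalClosure : Set H') = closure (T' '' K) := rfl
  rw [e1, e2, U.toHomeomorph.image_closure, Set.image_image]
  exact congrArg closure (Set.image_congr fun x _ => (h x).symm)

end Classes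

end

theorem mainTheorem6 (m e : ℝ) (hm : 0 < m) (A : Spacetime → Fin 4 → ℝ)
    (hA : ContDiff ℝ ∞ A) (hA' : HasCompactSupport A)
    (Sin : CauchySurface) (hSin : Sin.IsInitialFor A) (S S' : CauchySurface)
    (V : ClosedSubmodule ℂ (DiracSpace S)) (hV : V ∈ polarizationClass m e A Sin S)
    (W : ClosedSubmodule ℂ (DiracSpace S')) (hW : W ∈ polarizationClass m e A Sin S') :
    ∃ L : FockSpace V ≃ₗᵢ[ℂ] FockSpace W,
      IsLift V W (diracEvolution m e A S S') L ∧
      ∀ L' : FockSpace V ≃ₗᵢ[ℂ] FockSpace W,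
        IsLift V W (diracEvolution m e A S S') L' ↔
          ∃ θ : ℝ, ∀ Φ : FockSpace V, L' Φ = Complex.exp (θ * Complex.I) • L Φ := by
  obtain ⟨U, hU, -⟩ := exists_diracEvolution_eq hA hA' m e S S'
  have hcomp := diracEvolution_comp hA hA' m e Sin S S'
  rw [hU] at hcomp ⊢
  -- The reference polarization of `Σ'` is the image of the one of `Σ` under the evolution.
  have hX := topologicalClosure_map_eq (standardPolarization m Sin) U hcomp
  exact exists_lift_unique V W U (isHilbertSchmidt_off_diagonal U _ _ _ _ hX hV.2 hW.2)
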